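/- For $w,q\in\mathbb{C}$ with $0<|q|<1$ let $(q;q)_\infty=\prod_{n\ge1}(1-q^n)$ and $$\mathcal{R}_2(w;q)=-\frac{1}{(q;q)_\infty}\sum_{n\in\mathbb{Z}\setminus\{0\}}\frac{(-1)^nq^{n(3n+1)/2}}{1-e^{2\pi iw}q^n}.$$ For $x\in\mathbb{R}$ let $((x))=x-\lfloor x\rfloor-\frac12$ if $x\notin\mathbb{Z}$ and $((x))=0$ if $x\in\mathbb{Z}$, and put $$\omega_{h,k}=\exp\Big(\pi i\sum_{\mu \bmod k}\Big(\Big(\frac{\mu}{k}\Big)\Big)\Big(\Big(\frac{h\mu}{k}\Big)\Big)\Big).$$ Let $H_w(x)=\dfrac{e^x}{1-e^{2\pi iw}e^{2x}}$ and, for $\nu\in\mathbb{Z}$ and $\mathrm{Re}(z)>0$, $$I^{\pm}_{k,\nu}(z;w)=\int_{\mathbb{R}}e^{-\frac{3\pi zx^2}{k}}\,H_w\Big(\pm\Big(\frac{\pi i\nu}{k}-\frac{\pi i}{6k}-\frac{\pi zx}{k}\Big)\Big)\,dx .$$ **Theorem.** Let $h$ and $k$ be coprime integers with $k>0$. If $k$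 is odd, let $h'$ be an even integer with $hh'\equiv-1\pmod k$; if $k$ is even, let $h'$ be an integer with $hh'\equiv-1\pmod{2k}$. Let $z\in\mathbb{C}$ with $\mathrm{Re}(z)>0$, and put $q=e^{\frac{2\pi i}{k}(h+iz)}$, $q_1=e^{\frac{2\pi i}{k}(h'+\frac iz)}$; the powers $z^{\pm1/2}$ are principal. Let $w$ be a complex number in the open strip $|\mathrm{Re}(w\bar z)|<\frac{\mathrm{Re}(z)}{6k}$ around the line $iz\mathbb{R}$ (for real $z$ this is $|\mathrm{Re}(w)|<\frac1{6k}$), with $w\ne imz$ for all nonzero integers $m$. Then the series in $\mathcal{R}_2(w;q)$ and $\mathcal{R}_2(\frac{iw}{z};q_1)$ and all the integrals $I^{\pm}_{k,\nu}(z;w)$ ($\nu\in\mathbb{Z}$) converge absolutely, and if $w\neq0$ then $$\begin{aligned}\mathcal{R}_2(w;q)={}&\frac{\omega_{h,k}\,z^{1/2}\,e^{\frac{\pi}{12k}(z^{-1}-z)}}{(q_1;q_1)_\infty}\left(\frac{1}{1-e^{2\pi iw}}-\frac{i\,e^{\frac{3\pi kw^2}{z}-\pi iw-\frac{\pi w}{z}}}{z\big(1-e^{-\frac{2\pi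 w}{z}}\big)}\right)\\&+i\,z^{-1/2}\,\omega_{h,k}\,e^{\frac{\pi}{12k}(z^{-1}-z)}\,e^{\frac{3\pi kw^2}{z}-\pi iw-\frac{\pi w}{z}}\,\mathcal{R}_2\Big(\frac{iw}{z};q_1\Big)\\&-\frac{z^{1/2}}{k}\,\omega_{h,k}\,e^{-\frac{\pi z}{12k}}\sum_{\substack{\nu\bmod k\\ \pm}}(-1)^\nu e^{\frac{\pi ih'}{k}(-3\nu^2+\nu)}\,I^{\pm}_{k,\nu}(z;w).\end{aligned}$$ At $w=0$ the right-hand side has a removable singularity, and it tends to $\mathcal{R}_2(0;q)$ as $w\to0$, $w\ne0$. -/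

import Mathlib

open Complex Filter Topology MeasureTheory

noncomputable section

/-- The sawtooth function `((x))`: `x - ⌊x⌋ - 1/2` off the integers, and `0` on the integers. -/
def sawtooth (x : ℝ) : ℝ :=
  if Int.fract x = 0 then 0 else x - (⌊x⌋ : ℝ) - 1 / 2

/-- The Dedekind sum `s(h,k) = ∑_{μ mod k} ((μ/k)) ((hμ/k))`. -/
def dedekindS (h : ℤ) (k : ℕ) : ℝ :=
  ∑ μ ∈ Finset.range k, sawtooth ((μ : ℝ) / k) * sawtooth ((h : ℝ) * μ / k)

/-- The multiplier `ω_{h,k} = exp(π i s(h,k))`. -/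
def omegaHK (h : ℤ) (k : ℕ) : ℂ :=
  cexp (Real.pi * I * (dedekindS h k : ℂ))

/-- `(q;q)_∞ = ∏_{n ≥ 1} (1 - q^n)`. -/
def eulerProd (q : ℂ) : ℂ :=
  ∏' n : ℕ, (1 - q ^ (n + 1))

/-- `exp((2πi/k)(h + i z))`. -/
def nome (k : ℕ) (h : ℤ) (z : ℂ) : ℂ :=
  cexp (2 * Real.pi * I / k * (h + I * z))

/-- The term `(-1)^n q^{n(3n+1)/2} / (1 - e^{2πiw} q^n)`. The integer `n(3n+1)` is always even,
so the integer division below is exact. -/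
def rankTerm (w q : ℂ) (n : ℤ) : ℂ :=
  (-1) ^ n * q ^ (n * (3 * n + 1) / 2) / (1 - cexp (2 * Real.pi * I * w) * q ^ n)

/-- `𝓡₂(w;q) = -(1/(q;q)_∞) ∑_{n ∈ ℤ, n ≠ 0} (-1)^n q^{n(3n+1)/2} / (1 - e^{2πiw} q^n)`. -/
def calR2 (w q : ℂ) : ℂ :=
  -(1 / eulerProd q) * ∑' n : {n : ℤ // n ≠ 0}, rankTerm w q n

/-- `H_w(x) = e^x / (1 - e^{2πiw} e^{2x})`. -/
def hFun (w x : ℂ) : ℂ :=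
  cexp x / (1 - cexp (2 * Real.pi * I * w) * cexp (2 * x))

/-- The integrand of `I^±_{k,ν}(z;w)`; the sign `±` is `ε = 1` or `ε = -1`. -/
def mordellIntegrand (ε : ℤ) (k : ℕ) (ν : ℤ) (z w : ℂ) (x : ℝ) : ℂ :=
  cexp (-(3 * Real.pi * z * x ^ 2 / k)) *
    hFun w (ε * (Real.pi * I * ν / k - Real.pi * I / (6 * k) - Real.pi * z * x / k))

/-- `I^±_{k,ν}(z;w)`, the integral of `mordellIntegrand` over the real line. -/
def mordellInt (ε : ℤ) (k : ℕ) (ν : ℤ) (z w : ℂ) : ℂ :=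
  ∫ x : ℝ, mordellIntegrand ε k ν z w x

/-- The right-hand side of the transformation law. Powers `z^{±1/2}` are principal. The summand of
the sum over `ν` depends only on `ν` modulo `k`, and `{0, …, k-1}` represents the classes. -/
def transRHS (h h' : ℤ) (k : ℕ) (z w : ℂ) : ℂ :=
  omegaHK h k * z ^ (1 / 2 : ℂ) * cexp (Real.pi / (12 * k) * (z⁻¹ - z)) /
      eulerProd (nome k h' z⁻¹) *
    (1 / (1 - cexp (2 * Real.pi * I * w)) -
      I * cexp (3 * Real.pi * k * w ^ 2 / z - Real.pi * I * w - Real.pi * w / z) /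
        (z * (1 - cexp (-(2 * Real.pi * w / z))))) +
  I * z ^ (-(1 / 2) : ℂ) * omegaHK h k * cexp (Real.pi / (12 * k) * (z⁻¹ - z)) *
    cexp (3 * Real.pi * k * w ^ 2 / z - Real.pi * I * w - Real.pi * w / z) *
    calR2 (I * w / z) (nome k h' z⁻¹) -
  z ^ (1 / 2 : ℂ) / k * omegaHK h k * cexp (-(Real.pi * z / (12 * k))) *
    ∑ ν ∈ Finset.range k,
      (-1) ^ ν * cexp (Real.pi * I * h' / k * (-3 * (ν : ℂ) ^ 2 + ν)) *
        (mordellInt 1 k ν z w + mordellInt (-1) k ν z w)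

end

/-!
Write `ζ = exp(2πiw)`, `X = exp(2πw/z)`, `q₁ = nome k h' z⁻¹` and let
`A(w;q) = ∑_{n ∈ ℤ} (-1)^n q^{n(3n+1)/2} / (1 - ζ q^n)` be the rank series with its term `n = 0`
included. The whole theorem is one identity for `A` (`rank_series_transform`),
`k · A(w;q) = (q₁;q₁)_∞ · (Mordell integrals) + ρ X⁻¹ · A(iw/z;q₁)`, `ρ = poleResidue k z w`,
divided by `(q;q)_∞` and combined with the transformation law of the Euler product
(`eulerProd_nome_transform`).

*The identity for `A`.* On a progression `n ≡ -h'μ (mod k)` the roots of unity in the terms of `A`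
disappear, and `A` becomes a sum of values of a function `poissonTerm` which extends
meromorphically to complex `x` (`rankTerm_eq_poissonTerm`). Poisson summation gives
`k · A = ∑_r K(r)`, where `K(r)` is a sum over `μ` of integrals over the real line. Let `K(r, a)` be
the same sum with the line moved to `ℝ - ia/z` (`lineSum`); here `±1/6` are the values of `a` for
which the quadratic exponent turns into that of the Mordell integrals. Two relations hold:
* `K(r, 1/6) - K(r, -1/6) = ρ X^r`, since exactly one pole lies in between (`lineSum_sub`);
* `K(r, 1/6) = -q₁^{r-1} K(r-3, -1/6)`, since the integrand is quasi-periodic and the strip between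
  `a = 1/6` and `a = 5/6` contains no pole (`lineSum_shift`).

Together they form a recurrence of step three for `K(s, 1/6)` and for `K(-1-s, -1/6)`, `s ≥ 0`, which
determines the sum of the sequence from its first three members (`hasSum_of_recurrence`): these get
multiplied by series of pentagonal type, and the residues add up to a Lambert series. By the
second relation at `r = 0, 1, 2` the six initial members involve only the combination
`K(0, 1/6) + K(-1, -1/6)`, with coefficient `∑ (-1)^N q₁^{N(3N+1)/2} (1 - q₁^{2N+1}) = (q₁;q₁)_∞`
by Euler's pentagonal number theorem, and this combination is the sum of Mordell integrals
(`lineSum_add_lineSum`). The Lambert series is `A(iw/z;q₁)`.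

The Poisson summation needs the real line to avoid the poles, that is `w ∉ izℝ`. Both sides of the
identity are continuous in `w`, which gives it on `izℝ` too, apart from the points `imz`.

*The Euler product.* Its law is proved by the Euclidean algorithm on `(h, k)`, from the inversion
formula of the Dedekind eta function and the reciprocity law of Dedekind sums
(`dedekindS_reciprocity`).
-/

/-! ### Sums over residue classes and Dedekind reciprocity -/

/-- Summing a `k`-periodic function over `range k` is summing over `ZMod k`. -/
lemma sum_range_eq_sum_zmod {M : Type*} [AddCommMonoid M] (k : ℕ) [NeZero k] (g : ZMod k → M) :
    ∑ i ∈ Finset.range k, g (i : ZMod k) = ∑ x : ZMod k, g x := by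
  refine Finset.sum_bij' (fun i _ => (i : ZMod k)) (fun x _ => x.val) ?_ ?_ ?_ ?_ ?_
  · intro a _; exact Finset.mem_univ _
  · intro a _; exact Finset.mem_range.2 (ZMod.val_lt a)
  · intro a ha; exact ZMod.val_cast_of_lt (Finset.mem_range.1 ha)
  · intro a _; exact ZMod.natCast_zmod_val a
  · intro a _; rfl

lemma Function.Periodic.eq_of_modEq {M : Type*} {k : ℤ} {φ : ℤ → M} (hφ : Function.Periodic φ k)
    {a b : ℤ} (hab : a ≡ b [ZMOD k]) : φ a = φ b := by
  obtain ⟨c, hc⟩ := hab.dvd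
  have h1 : b = a + c * k := by linarith
  have h2 := (hφ.int_mul c) a
  rw [h1, ← h2]
  simp

/-- A sum over a complete residue system is unchanged by `i ↦ h i + a` with `h` prime to `k`. -/
lemma sum_range_comp_affine {M : Type*} [AddCommMonoid M] {k : ℕ} (hk : 0 < k) {φ : ℤ → M}
    (hφ : Function.Periodic φ (k : ℤ)) {h : ℤ} (hh : IsCoprime h (k : ℤ)) (a : ℤ) :
    ∑ i ∈ Finset.range k, φ (h * i + a) = ∑ i ∈ Finset.range k, φ i := by
  have : NeZero k := ⟨hk.ne'⟩
  have key : ∀ n : ℤ, φ n = φ ((n : ZMod k).val : ℤ) := by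
    intro n
    apply hφ.eq_of_modEq
    rw [← ZMod.intCast_eq_intCast_iff]
    simp
  have e1 : ∀ i : ℕ, φ (h * i + a) =
      (fun x : ZMod k => φ (((h : ZMod k) * x + a).val : ℤ)) (i : ZMod k) := by
    intro i
    rw [key]
    simp
  have e2 : ∀ i : ℕ, φ i = (fun x : ZMod k => φ (x.val : ℤ)) (i : ZMod k) := by
    intro i
    rw [key]
    simp
  rw [Finset.sum_congr rfl (fun i _ => e1 i), Finset.sum_congr rfl (fun i _ => e2 i),
    sum_range_eq_sum_zmod k (fun x : ZMod k => φ (((h : ZMod k) * x + a).val : ℤ)),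
    sum_range_eq_sum_zmod k (fun x : ZMod k => φ (x.val : ℤ))]
  obtain ⟨u, v, huv⟩ := hh
  have hu : (u : ZMod k) * h = 1 := by
    have := congrArg (Int.cast : ℤ → ZMod k) huv
    simpa using this
  refine Fintype.sum_equiv
    (⟨fun x => h * x + a, fun y => u * (y - a), fun x => ?_, fun y => ?_⟩ : ZMod k ≃ ZMod k)
    _ _ (fun x => rfl)
  · simp only [add_sub_cancel_right, ← mul_assoc, hu, one_mul]
  · simp only [← mul_assoc, mul_comm (h : ZMod k) u, hu, one_mul, sub_add_cancel]

lemma sawtooth_add_int (x : ℝ) (n : ℤ) : sawtooth (x + n) = sawtooth x := by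
  unfold sawtooth
  simp only [Int.fract_add_intCast, Int.floor_add_intCast]
  split_ifs
  · rfl
  · push_cast; ring

lemma sawtooth_neg (x : ℝ) : sawtooth (-x) = -sawtooth x := by
  unfold sawtooth
  by_cases h : Int.fract x = 0
  · have : Int.fract (-x) = 0 := by rwa [Int.fract_neg_eq_zero]
    simp [h, this]
  · have h2 : Int.fract (-x) ≠ 0 := by rwa [Ne, Int.fract_neg_eq_zero]
    rw [if_neg h, if_neg h2]
    have h3 := Int.fract_neg h
    rw [Int.fract, Int.fract] at h3
    linarith

lemma sawtooth_of_not_dvd {a : ℤ} {k : ℕ} (hk : 0 < k) (h : ¬ (k : ℤ) ∣ a) :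
    sawtooth ((a : ℝ) / k) = (a : ℝ) / k - ((a / (k : ℤ) : ℤ) : ℝ) - 1 / 2 := by
  unfold sawtooth
  have hk' : (k : ℝ) ≠ 0 := by positivity
  have hf : ⌊(a : ℝ) / k⌋ = a / (k : ℤ) := by
    have := Int.floor_div_natCast (k := ℝ) (a : ℝ) k
    simpa using this
  rw [if_neg, hf]
  intro h0
  apply h
  rw [Int.fract, sub_eq_zero, hf, div_eq_iff hk'] at h0
  exact ⟨a / (k : ℤ), by rw [mul_comm]; exact_mod_cast h0⟩

lemma periodic_sawtooth_div {k : ℕ} (hk : 0 < k) :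
    Function.Periodic (fun n : ℤ => sawtooth ((n : ℝ) / k)) (k : ℤ) := by
  intro n
  have hk' : (k : ℝ) ≠ 0 := by positivity
  have : ((n + (k : ℤ) : ℤ) : ℝ) / k = (n : ℝ) / k + (1 : ℤ) := by
    push_cast; field_simp
  simp only [this, sawtooth_add_int]

lemma dedekindS_congr {h₁ h₂ : ℤ} {k : ℕ} (hk : 0 < k) (h : h₁ ≡ h₂ [ZMOD k]) :
    dedekindS h₁ k = dedekindS h₂ k := by
  unfold dedekindS
  refine Finset.sum_congr rfl fun μ _ => ?_
  congr 1
  have := (periodic_sawtooth_div hk).eq_of_modEq (h.mul_right (μ : ℤ))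
  simpa using this

lemma dedekindS_neg (h : ℤ) (k : ℕ) : dedekindS (-h) k = -dedekindS h k := by
  unfold dedekindS
  rw [← Finset.sum_neg_distrib]
  refine Finset.sum_congr rfl fun μ _ => ?_
  rw [show ((-h : ℤ) : ℝ) * μ / k = -((h : ℝ) * μ / k) by push_cast; ring, sawtooth_neg]
  ring

lemma not_dvd_mul_of_coprime {h k i : ℕ} (hh : Nat.Coprime h k) (h0 : i ≠ 0) (hi : i < k) :
    ¬ (k : ℤ) ∣ ((h * i : ℕ) : ℤ) := by
  intro hd
  have h1 : k ∣ h * i := by exact_mod_cast hd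
  exact absurd (Nat.le_of_dvd (Nat.pos_of_ne_zero h0) (hh.symm.dvd_of_dvd_mul_left h1)) (by omega)

lemma sawtooth_mul_div {h k i : ℕ} (hh : Nat.Coprime h k) (h0 : i ≠ 0) (hi : i < k) :
    sawtooth ((h : ℝ) * i / k) = (h : ℝ) * i / k - ((h * i / k : ℕ) : ℝ) - 1 / 2 := by
  have := sawtooth_of_not_dvd (a := ((h * i : ℕ) : ℤ)) (k := k) (by omega)
    (not_dvd_mul_of_coprime hh h0 hi)
  have h2 : ((((h * i : ℕ) : ℤ) / (k : ℤ) : ℤ) : ℝ) = ((h * i / k : ℕ) : ℝ) := by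
    exact_mod_cast rfl
  rw [h2] at this
  push_cast at this ⊢
  exact this

/-- Split off the index `0`, where the sawtooth takes its exceptional value. -/
lemma sum_range_eq_sum_Ico_one {M : Type*} [AddCommMonoid M] {k : ℕ} (hk : 0 < k) (f : ℕ → M)
    (h0 : f 0 = 0) : ∑ i ∈ Finset.range k, f i = ∑ i ∈ Finset.Ico 1 k, f i := by
  rw [Finset.range_eq_Ico, Finset.sum_eq_sum_Ico_succ_bot hk, h0, zero_add]

lemma sum_Ico_one_id (k : ℕ) (hk : 0 < k) :
    ∑ i ∈ Finset.Ico 1 k, (i : ℝ) = k * (k - 1) / 2 := by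
  induction k, hk using Nat.le_induction with
  | base => simp
  | succ n hn ih =>
    rw [Finset.sum_Ico_succ_top (by omega), ih]; push_cast; ring

lemma sum_Ico_one_sq (k : ℕ) (hk : 0 < k) :
    ∑ i ∈ Finset.Ico 1 k, (i : ℝ) ^ 2 = k * (k - 1) * (2 * k - 1) / 6 := by
  induction k, hk using Nat.le_induction with
  | base => simp
  | succ n hn ih =>
    rw [Finset.sum_Ico_succ_top (by omega), ih]; push_cast; ring

/-- `μ ↦ hμ` permutes the residue classes modulo `k`. -/
lemma sum_sawtooth_mul_div {h k : ℕ} (hk : 0 < k) (hh : Nat.Coprime h k) (F : ℝ → ℝ) :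
    ∑ i ∈ Finset.range k, F (sawtooth ((h : ℝ) * i / k)) =
      ∑ i ∈ Finset.range k, F (sawtooth ((i : ℝ) / k)) := by
  have hp : Function.Periodic (fun n : ℤ => F (sawtooth ((n : ℝ) / k))) (k : ℤ) := by
    intro n; exact congrArg F (periodic_sawtooth_div hk n)
  have := sum_range_comp_affine hk hp (h := h) (Nat.isCoprime_iff_coprime.2 hh) 0
  simpa using this

/-- The Dedekind sum in terms of the lattice point sum `∑ i ⌊hi/k⌋`. -/
lemma dedekindS_eq_sum_floor {h k : ℕ} (hk : 0 < k) (hh : Nat.Coprime h k) :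
    dedekindS h k = h * (k - 1) * (2 * k - 1) / (6 * k) - (k - 1) / 4 -
      (∑ i ∈ Finset.Ico 1 k, (i : ℝ) * ((h * i / k : ℕ) : ℝ)) / k := by
  have hk' : (k : ℝ) ≠ 0 := by positivity
  -- `∑ ((hμ/k)) = ∑ ((μ/k)) = 0`, so the constant `1/2` in the first factor may be dropped
  have hz : ∑ i ∈ Finset.Ico 1 k, sawtooth ((h : ℝ) * i / k) = 0 := by
    rw [← sum_range_eq_sum_Ico_one hk (fun i : ℕ => sawtooth ((h : ℝ) * i / k)) (by simp [sawtooth]),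
      sum_sawtooth_mul_div hk hh (fun x => x), sum_range_eq_sum_Ico_one hk _ (by simp [sawtooth])]
    have : ∀ i ∈ Finset.Ico 1 k, sawtooth ((i : ℝ) / k) = (i : ℝ) / k - 1 / 2 := by
      intro i hi
      rw [Finset.mem_Ico] at hi
      have := sawtooth_mul_div (h := 1) (k := k) (i := i) (by simp) (by omega) hi.2
      simpa [Nat.div_eq_of_lt hi.2] using this
    rw [Finset.sum_congr rfl this, Finset.sum_sub_distrib, ← Finset.sum_div, sum_Ico_one_id k hk]
    simp [Nat.cast_sub (show 1 ≤ k from hk)]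
    field_simp
    ring
  unfold dedekindS
  rw [sum_range_eq_sum_Ico_one hk _ (by simp [sawtooth])]
  have : ∀ i ∈ Finset.Ico 1 k, sawtooth ((i : ℝ) / k) * sawtooth (((h : ℤ) : ℝ) * i / k) =
      h / k ^ 2 * (i : ℝ) ^ 2 - (i : ℝ) * ((h * i / k : ℕ) : ℝ) / k - 1 / (2 * k) * i
        - 1 / 2 * sawtooth ((h : ℝ) * i / k) := by
    intro i hi
    rw [Finset.mem_Ico] at hi
    have h1 := sawtooth_mul_div (h := 1) (k := k) (i := i) (by simp) (by omega) hi.2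
    have h2 := sawtooth_mul_div (h := h) (k := k) (i := i) hh (by omega) hi.2
    simp only [one_mul, Nat.div_eq_of_lt hi.2, Nat.cast_one, Nat.cast_zero, sub_zero] at h1
    rw [h1, Int.cast_natCast, h2]
    field_simp
  rw [Finset.sum_congr rfl this]
  simp only [Finset.sum_sub_distrib, ← Finset.mul_sum, ← Finset.sum_div, hz,
    sum_Ico_one_id k hk, sum_Ico_one_sq k hk]
  field_simp
  ring_nf

/-- Lattice points below the diagonal, weighted by the ordinate, counted by rows and by columns. -/
lemma sum_floor_mul_floor_add_one {h k : ℕ} (hh0 : 0 < h) (hk : 0 < k) (hh : Nat.Coprime h k) :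
    ∑ i ∈ Finset.Ico 1 k, ((h * i / k : ℕ) : ℝ) * (((h * i / k : ℕ) : ℝ) + 1) =
      (k - 1) * (h * (h - 1)) - 2 * ∑ j ∈ Finset.Ico 1 h, (j : ℝ) * ((k * j / h : ℕ) : ℝ) := by
  have h1 : ∀ i ∈ Finset.Ico 1 k, ((h * i / k : ℕ) : ℝ) * (((h * i / k : ℕ) : ℝ) + 1) =
      ∑ j ∈ Finset.Ico 1 h, if k * j < h * i then 2 * (j : ℝ) else 0 := by
    intro i hi
    rw [Finset.mem_Ico] at hi
    rw [← Finset.sum_filter, ← Finset.mul_sum]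
    have : Finset.filter (fun j => k * j < h * i) (Finset.Ico 1 h) =
        Finset.Ico 1 (h * i / k + 1) := by
      ext j
      simp only [Finset.mem_filter, Finset.mem_Ico, Nat.lt_succ_iff]
      rw [Nat.le_div_iff_mul_le hk]
      constructor
      · rintro ⟨⟨a, b⟩, c⟩; exact ⟨a, by rw [mul_comm]; exact c.le⟩
      · rintro ⟨a, b⟩
        have hne : j * k ≠ h * i := by
          intro e
          have : k ∣ h * i := ⟨j, by rw [← e, mul_comm]⟩
          exact absurd (Nat.le_of_dvd (by omega) (hh.symm.dvd_of_dvd_mul_left this)) (by omega)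
        have hlt : j * k < h * i := lt_of_le_of_ne b hne
        refine ⟨⟨a, ?_⟩, by rw [mul_comm]; exact hlt⟩
        by_contra hj
        push Not at hj
        have : h * i < h * k := Nat.mul_lt_mul_of_pos_left hi.2 hh0
        nlinarith
    rw [this, sum_Ico_one_id _ (Nat.succ_pos _)]
    push_cast; ring
  have h2 : ∀ j ∈ Finset.Ico 1 h, (∑ i ∈ Finset.Ico 1 k, if k * j < h * i then 2 * (j : ℝ) else 0) =
      2 * (k - 1) * j - 2 * ((j : ℝ) * ((k * j / h : ℕ) : ℝ)) := by
    intro j hj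
    rw [Finset.mem_Ico] at hj
    rw [← Finset.sum_filter, Finset.sum_const]
    have : Finset.filter (fun i => k * j < h * i) (Finset.Ico 1 k) =
        Finset.Ico (k * j / h + 1) k := by
      ext i
      simp only [Finset.mem_filter, Finset.mem_Ico, Nat.succ_le_iff]
      rw [Nat.div_lt_iff_lt_mul hh0, mul_comm i h]
      constructor
      · rintro ⟨⟨a, b⟩, c⟩; exact ⟨c, b⟩
      · rintro ⟨a, b⟩
        refine ⟨⟨?_, b⟩, a⟩
        rcases Nat.eq_zero_or_pos i with rfl | h'
        · simp at a
        · exact h'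
    rw [this, Nat.card_Ico]
    have hlt : k * j / h + 1 ≤ k := by
      rw [Nat.succ_le_iff, Nat.div_lt_iff_lt_mul hh0]
      exact Nat.mul_lt_mul_of_pos_left hj.2 hk
    rw [nsmul_eq_mul, Nat.cast_sub hlt]
    push_cast; ring
  rw [Finset.sum_congr rfl h1, Finset.sum_comm, Finset.sum_congr rfl h2, Finset.sum_sub_distrib,
    ← Finset.mul_sum, ← Finset.mul_sum, sum_Ico_one_id h hh0]
  ring

/-- **Dedekind's reciprocity law**: compare `∑ ((hμ/k))² = ∑ ((μ/k))²` with the lattice point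
count. -/
lemma dedekindS_reciprocity {h k : ℕ} (hh0 : 0 < h) (hk : 0 < k) (hh : Nat.Coprime h k) :
    dedekindS h k + dedekindS k h =
      -1 / 4 + 1 / 12 * ((h : ℝ) / k + k / h + 1 / (h * k)) := by
  have hk' : (k : ℝ) ≠ 0 := by positivity
  have hh' : (h : ℝ) ≠ 0 := by positivity
  have hsq := sum_sawtooth_mul_div hk hh (fun x => x ^ 2)
  rw [sum_range_eq_sum_Ico_one hk _ (by simp [sawtooth]),
    sum_range_eq_sum_Ico_one hk _ (by simp [sawtooth])] at hsq
  have e1 : ∀ i ∈ Finset.Ico 1 k, sawtooth ((h : ℝ) * i / k) ^ 2 =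
      ((h * i / k : ℕ) : ℝ) * (((h * i / k : ℕ) : ℝ) + 1) -
      2 * h / k * ((i : ℝ) * ((h * i / k : ℕ) : ℝ)) + h ^ 2 / k ^ 2 * (i : ℝ) ^ 2 - h / k * i
       + 1 / 4 := by
    intro i hi
    rw [Finset.mem_Ico] at hi
    rw [sawtooth_mul_div hh (by omega) hi.2]
    field_simp
    ring
  have e2 : ∀ i ∈ Finset.Ico 1 k, sawtooth ((i : ℝ) / k) ^ 2 =
      1 / k ^ 2 * (i : ℝ) ^ 2 - 1 / k * i + 1 / 4 := by
    intro i hi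
    rw [Finset.mem_Ico] at hi
    have h1 := sawtooth_mul_div (h := 1) (k := k) (i := i) (by simp) (by omega) hi.2
    simp only [one_mul, Nat.div_eq_of_lt hi.2, Nat.cast_one, Nat.cast_zero, sub_zero] at h1
    rw [h1]
    field_simp
    ring
  rw [Finset.sum_congr rfl e1, Finset.sum_congr rfl e2] at hsq
  simp only [Finset.sum_sub_distrib, Finset.sum_add_distrib, ← Finset.mul_sum,
    sum_Ico_one_id k hk, sum_Ico_one_sq k hk, sum_floor_mul_floor_add_one hh0 hk hh] at hsq
  rw [dedekindS_eq_sum_floor hk hh, dedekindS_eq_sum_floor hh0 hh.symm]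
  set P := ∑ i ∈ Finset.Ico 1 k, (i : ℝ) * ((h * i / k : ℕ) : ℝ)
  set Q := ∑ j ∈ Finset.Ico 1 h, (j : ℝ) * ((k * j / h : ℕ) : ℝ)
  have hP : P / k = (((k : ℝ) - 1) * (h * (h - 1)) - 2 * Q
      + h ^ 2 / k ^ 2 * (k * (k - 1) * (2 * k - 1) / 6) - h / k * (k * (k - 1) / 2)
      - (1 / k ^ 2 * (k * (k - 1) * (2 * k - 1) / 6) - 1 / k * (k * (k - 1) / 2))) / (2 * h) := by
    rw [eq_div_iff (by positivity)]
    linear_combination -hsq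
  rw [hP]
  field_simp
  ring

/-! ### The transformation law of the Euler product -/

lemma eta_eq_eulerProd (τ : ℂ) :
    ModularForm.eta τ = cexp (Real.pi * I * τ / 12) * eulerProd (cexp (2 * Real.pi * I * τ)) := by
  unfold ModularForm.eta eulerProd
  congr 1
  · unfold Function.Periodic.qParam
    congr 1
    push_cast
    ring
  · exact tprod_congr fun n => by rw [ModularForm.eta_q_eq_pow]

/-- The inversion law of the Euler product, from that of the Dedekind eta function. -/
lemma eulerProd_inversion {τ : ℂ} (hτ : 0 < τ.im) :
    eulerProd (cexp (2 * Real.pi * I * (-1 / τ))) =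
      cexp (-(Real.pi * I / 4)) * τ ^ (1 / 2 : ℂ) * cexp (Real.pi * I / 12 * (τ + 1 / τ)) *
        eulerProd (cexp (2 * Real.pi * I * τ)) := by
  have h := ModularForm.eta_comp_eq_csqrt_I_inv (x := τ) hτ
  simp only [Function.comp_apply, Pi.smul_apply, Pi.mul_apply, smul_eq_mul] at h
  rw [eta_eq_eulerProd, eta_eq_eulerProd] at h
  have hsq : ∀ x : ℂ, Complex.sqrt x = x ^ (1 / 2 : ℂ) := fun x => by
    simp [Complex.sqrt]
  rw [hsq, hsq] at h
  have hI : ((I : ℂ) ^ (1 / 2 : ℂ))⁻¹ = cexp (-(Real.pi * I / 4)) := by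
    rw [← cpow_neg, cpow_def_of_ne_zero I_ne_zero, log_I]
    congr 1; ring
  rw [hI] at h
  have h0 : cexp (Real.pi * I * (-1 / τ) / 12) ≠ 0 := exp_ne_zero _
  apply mul_left_cancel₀ h0
  rw [h]
  have : cexp (Real.pi * I * τ / 12) = cexp (Real.pi * I * (-1 / τ) / 12) *
      cexp (Real.pi * I / 12 * (τ + 1 / τ)) := by
    rw [← exp_add]; congr 1; ring
  rw [this]
  ring

lemma nome_add_mul (k : ℕ) (hk : 0 < k) (h m : ℤ) (z : ℂ) : nome k (h + k * m) z = nome k h z := by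
  unfold nome
  have hk' : (k : ℂ) ≠ 0 := by exact_mod_cast hk.ne'
  rw [show 2 * Real.pi * I / k * (((h + k * m : ℤ) : ℂ) + I * z) =
    2 * Real.pi * I / k * (h + I * z) + m * (2 * Real.pi * I) by push_cast; field_simp; ring,
    exp_add, exp_int_mul_two_pi_mul_I, mul_one]

lemma nome_congr {k : ℕ} (hk : 0 < k) {h₁ h₂ : ℤ} (h : h₁ ≡ h₂ [ZMOD k]) (z : ℂ) :
    nome k h₁ z = nome k h₂ z := by
  obtain ⟨c, hc⟩ := h.dvd
  rw [show h₂ = h₁ + k * c by linarith, nome_add_mul k hk]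

/-- The principal square root is multiplicative on `τ · (z / τ)` when `z` and `z / τ` lie in the
right half-plane and `τ` in the upper half-plane: the arguments add up without wrapping around. -/
lemma cpow_half_div_mul {τ z : ℂ} (hτ : 0 < τ.im) (hz : 0 < z.re) (hzτ : 0 < (z / τ).re) :
    τ ^ (1 / 2 : ℂ) * (z / τ) ^ (1 / 2 : ℂ) = z ^ (1 / 2 : ℂ) := by
  have hτ0 : τ ≠ 0 := by rintro rfl; simp at hτ
  have hz0 : z ≠ 0 := by rintro rfl; simp at hz
  have h1 : |arg (z / τ)| < Real.pi / 2 := abs_arg_lt_pi_div_two_iff.2 (Or.inl hzτ)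
  have h2 : |arg z| < Real.pi / 2 := abs_arg_lt_pi_div_two_iff.2 (Or.inl hz)
  have h3 : 0 ≤ arg τ := arg_nonneg_iff.2 hτ.le
  rw [abs_lt] at h1 h2
  have hlog : log (τ * (z / τ)) = log τ + log (z / τ) := by
    rw [log_mul_eq_add_log_iff hτ0 (div_ne_zero hz0 hτ0)]
    refine ⟨by linarith, ?_⟩
    by_contra hgt
    push Not at hgt
    have h5 : arg (τ * (z / τ)) = arg τ + arg (z / τ) - 2 * Real.pi := by
      have e : τ * (z / τ) = ((‖τ‖ * ‖z / τ‖ : ℝ) : ℂ) *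
          (cos ((arg τ + arg (z / τ) - 2 * Real.pi : ℝ)) +
            sin ((arg τ + arg (z / τ) - 2 * Real.pi : ℝ)) * I) := by
        conv_lhs => rw [← norm_mul_exp_arg_mul_I (z / τ)]
        conv_lhs => lhs; rw [← norm_mul_exp_arg_mul_I τ]
        rw [← exp_mul_I]
        push_cast
        rw [show ((arg τ : ℂ) + arg (z / τ) - 2 * Real.pi) * I =
          arg τ * I + arg (z / τ) * I - 2 * Real.pi * I by ring, exp_sub, exp_add, exp_two_pi_mul_I]
        ring
      rw [e]
      have hr : 0 < ‖τ‖ * ‖z / τ‖ :=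
        mul_pos (norm_pos_iff.2 hτ0) (norm_pos_iff.2 (div_ne_zero hz0 hτ0))
      refine arg_mul_cos_add_sin_mul_I hr ⟨by linarith, ?_⟩
      linarith [arg_le_pi τ, Real.pi_pos]
    rw [mul_div_cancel₀ _ hτ0] at h5
    linarith [arg_le_pi τ, Real.pi_pos]
  rw [cpow_def_of_ne_zero hτ0, cpow_def_of_ne_zero (div_ne_zero hz0 hτ0), cpow_def_of_ne_zero hz0,
    ← exp_add, ← add_mul, ← hlog, mul_div_cancel₀ _ hτ0]

/-- The transformation law of `(q;q)_∞` under a general modular substitution, with the Dedekind sum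
in the multiplier. The proof runs the Euclidean algorithm on `(h, k)`: one inversion replaces the
denominator `k` by `h mod k`, and reciprocity accounts for the change of the Dedekind sum. -/
theorem eulerProd_nome_transform (k : ℕ) (hk : 0 < k) (h h' : ℤ) (hhk : h * h' ≡ -1 [ZMOD k])
    (z : ℂ) (hz : 0 < z.re) :
    eulerProd (nome k h' z⁻¹) =
      eulerProd (nome k h z) * omegaHK h k * z ^ (1 / 2 : ℂ) *
        cexp (Real.pi / (12 * k) * (z⁻¹ - z)) := by
  induction k using Nat.strong_induction_on generalizing h h' z with
  | _ k ih =>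
  have hz0 : z ≠ 0 := by rintro rfl; simp at hz
  have hk' : (k : ℂ) ≠ 0 := by exact_mod_cast hk.ne'
  rcases Nat.lt_or_ge 1 k with hk1 | hk1
  · -- reduce `h` modulo `k`
    obtain ⟨h₀, hh₀⟩ : ∃ h₀ : ℕ, (h₀ : ℤ) = h % k :=
      ⟨(h % k).toNat, Int.toNat_of_nonneg (Int.emod_nonneg _ (by exact_mod_cast hk.ne'))⟩
    have hcong : (h₀ : ℤ) ≡ h [ZMOD k] := by rw [hh₀]; exact Int.mod_modEq h k
    have hlt : h₀ < k := by
      have := Int.emod_lt_of_pos h (show (0 : ℤ) < k by exact_mod_cast hk)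
      rw [← hh₀] at this; exact_mod_cast this
    have hprod : (h₀ : ℤ) * h' ≡ -1 [ZMOD k] := (hcong.mul_right h').trans hhk
    obtain ⟨b, hb⟩ : ∃ b : ℤ, (h₀ : ℤ) * h' = -1 + k * b := by
      obtain ⟨c, hc⟩ := hprod.symm.dvd
      exact ⟨c, by linarith⟩
    have hpos : 0 < h₀ := by
      rcases Nat.eq_zero_or_pos h₀ with h0 | h0
      · rw [h0] at hb
        have hd : (k : ℤ) ∣ 1 := ⟨b, by push_cast at hb; linarith⟩
        have := Int.le_of_dvd one_pos hd
        omega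
      · exact h0
    have hcop : Nat.Coprime h₀ k := by
      rw [← Nat.isCoprime_iff_coprime]
      exact ⟨-h', b, by linarith⟩
    have hh0 : (h₀ : ℂ) ≠ 0 := by exact_mod_cast hpos.ne'
    have hkR : (0 : ℝ) < k := by exact_mod_cast hk
    have hhR : (0 : ℝ) < h₀ := by exact_mod_cast hpos
    obtain ⟨τ, hτdef⟩ : ∃ τ : ℂ, τ = (h₀ + I * z) / k := ⟨_, rfl⟩
    have hτk : k * τ = h₀ + I * z := by rw [hτdef]; field_simp
    have hτ : 0 < τ.im := by
      have : τ.im = z.re / k := by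
        rw [hτdef, div_natCast_im]; simp
      rw [this]; positivity
    have hτ0 : τ ≠ 0 := by intro h; rw [h] at hτ; simp at hτ
    obtain ⟨z₂, hz₂def⟩ : ∃ z₂ : ℂ, z₂ = z / τ := ⟨_, rfl⟩
    have hz₂0 : z₂ ≠ 0 := hz₂def ▸ div_ne_zero hz0 hτ0
    have hz₂inv : z₂⁻¹ = h₀ / (k * z) + I / k := by
      rw [hz₂def, inv_div, hτdef]; field_simp
    have hz₂ : 0 < z₂.re := by
      have h1 : 0 < (z₂⁻¹).re := by
        rw [hz₂inv, add_re, show (h₀ : ℂ) / (k * z) = ((h₀ / k : ℝ) : ℂ) * z⁻¹ by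
          push_cast; field_simp, re_ofReal_mul]
        have h2 : (I / (k : ℂ)).re = 0 := by rw [div_natCast_re]; simp
        have h3 : 0 < (z⁻¹).re := by
          rw [inv_re]; exact div_pos hz (normSq_pos.2 hz0)
        rw [h2]; positivity
      rw [inv_re] at h1
      exact (div_pos_iff_of_pos_right (normSq_pos.2 hz₂0)).1 h1
    have hIH := ih h₀ hlt hpos (-(k : ℤ)) b (by
      rw [Int.modEq_iff_dvd]; exact ⟨h', by linarith⟩) z₂ hz₂
    have n1 : nome h₀ b z₂⁻¹ = nome k h' z⁻¹ := by
      unfold nome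
      congr 1
      rw [hz₂inv]
      have hbC : (h₀ : ℂ) * h' = -1 + k * b := by exact_mod_cast hb
      field_simp
      linear_combination (-z) * hbC + z * I_sq
    have n2 : nome h₀ (-(k : ℤ)) z₂ = cexp (2 * Real.pi * I * (-1 / τ)) := by
      unfold nome
      congr 1
      rw [hz₂def]
      field_simp
      push_cast
      linear_combination (-1 : ℂ) * hτk
    have n3 : nome k h z = cexp (2 * Real.pi * I * τ) := by
      rw [← nome_congr hk hcong, nome, hτdef]
      congr 1
      push_cast
      ring
    rw [n1, n2, eulerProd_inversion hτ] at hIH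
    rw [hIH, n3, ← cpow_half_div_mul hτ hz (hz₂def ▸ hz₂), ← hz₂def]
    have hrec := dedekindS_reciprocity hpos hk hcop
    have hω : cexp (-(Real.pi * I / 4)) * cexp (Real.pi * I / 12 * (τ + 1 / τ)) *
        omegaHK (-(k : ℤ)) h₀ * cexp (Real.pi / (12 * h₀) * (z₂⁻¹ - z₂)) =
        omegaHK h k * cexp (Real.pi / (12 * k) * (z⁻¹ - z)) := by
      unfold omegaHK
      rw [dedekindS_neg, ← dedekindS_congr hk hcong, ← exp_add, ← exp_add, ← exp_add, ← exp_add]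
      congr 1
      have hrecC : (dedekindS h₀ k : ℂ) = -1 / 4 +
          1 / 12 * ((h₀ : ℂ) / k + k / h₀ + 1 / (h₀ * k)) - (dedekindS k h₀ : ℂ) := by
        have := congrArg Complex.ofReal hrec
        push_cast at this
        linear_combination this
      rw [hrecC, hz₂inv, hz₂def]
      have hzτ : z = -I * (k * τ - h₀) := by
        rw [hτk]; linear_combination z * I_sq
      have e1 : z / τ = -I * k + I * h₀ / τ := by
        rw [hzτ]; field_simp; ring
      have e2 : τ = h₀ / k + I * z / k := by rw [hτdef]; ring
      have e3 : Real.pi * I / 12 * (τ + 1 / τ) +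
          Real.pi / (12 * h₀) * ((h₀ / (k * z) + I / k) - (-I * k + I * h₀ / τ)) =
          Real.pi * I / 12 * τ + Real.pi / (12 * k) * z⁻¹ +
            Real.pi * I / 12 * (1 / (h₀ * k) + k / h₀) := by
        field_simp; ring
      rw [e1]
      push_cast
      rw [e2] at e3 ⊢
      linear_combination e3 + Real.pi * z / (12 * k) * I_sq
    calc _ = eulerProd (cexp (2 * Real.pi * I * τ)) * (cexp (-(Real.pi * I / 4)) *
          cexp (Real.pi * I / 12 * (τ + 1 / τ)) *
          omegaHK (-(k : ℤ)) h₀ * cexp (Real.pi / (12 * h₀) * (z₂⁻¹ - z₂))) *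
          (τ ^ (1 / 2 : ℂ) * z₂ ^ (1 / 2 : ℂ)) := by ring
      _ = _ := by rw [hω]; ring
  · obtain rfl : k = 1 := by omega
    have e1 : nome 1 h z = cexp (2 * Real.pi * I * (I * z)) := by
      rw [nome_congr (h₂ := 0) one_pos (by simpa using Int.modEq_one)]
      simp [nome]
    have e2 : nome 1 h' z⁻¹ = cexp (2 * Real.pi * I * (-1 / (I * z))) := by
      rw [nome_congr (h₂ := 0) one_pos (by simpa using Int.modEq_one)]
      simp only [nome]
      congr 1
      field_simp
      simp
    have hω : omegaHK h 1 = 1 := by simp [omegaHK, dedekindS, sawtooth]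
    have hτ : 0 < (I * z).im := by simpa using hz
    have hs : (I * z) ^ (1 / 2 : ℂ) = cexp (Real.pi * I / 4) * z ^ (1 / 2 : ℂ) := by
      have hl : log (I * z) = log I + log z := by
        rw [log_mul_eq_add_log_iff I_ne_zero hz0, arg_I]
        have h2 := abs_lt.1 (abs_arg_lt_pi_div_two_iff.2 (Or.inl hz))
        constructor <;> linarith [Real.pi_pos]
      rw [cpow_def_of_ne_zero (mul_ne_zero I_ne_zero hz0), cpow_def_of_ne_zero hz0, hl, log_I,
        ← exp_add]
      congr 1; ring
    rw [e1, e2, eulerProd_inversion hτ, hω, hs]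
    have e3 : cexp (-(Real.pi * I / 4)) * cexp (Real.pi * I / 4) = 1 := by
      rw [← exp_add]; simp
    have e4 : cexp (Real.pi * I / 12 * (I * z + 1 / (I * z))) =
        cexp (Real.pi / (12 * (1 : ℕ)) * (z⁻¹ - z)) := by
      congr 1
      field_simp
      push_cast
      linear_combination z ^ 2 * I_sq
    rw [e4]
    linear_combination (z ^ (1 / 2 : ℂ) * cexp (Real.pi / (12 * (1 : ℕ)) * (z⁻¹ - z)) *
      eulerProd (cexp (2 * Real.pi * I * (I * z)))) * e3

/-! ### Contour shifts in a horizontal strip -/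

/-- Gaussian decay on a horizontal strip: the loss of half of the rate pays for the linear terms. -/
lemma norm_cexp_quadratic_le (A B C : ℂ) (hA : 0 < A.re) (M : ℝ) :
    ∃ D : ℝ, 0 < D ∧ ∀ x : ℂ, |x.im| ≤ M →
      ‖cexp (-A * x ^ 2 + B * x + C)‖ ≤ D * Real.exp (-(A.re / 2) * x.re ^ 2) := by
  set L : ℝ := 2 * |A.im| * M + |B.re| with hL
  refine ⟨Real.exp (L ^ 2 / (2 * A.re) + A.re * M ^ 2 + |B.im| * M + |C.re|), Real.exp_pos _, ?_⟩
  intro x hx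
  rw [norm_exp, ← Real.exp_add, Real.exp_le_exp]
  have hre : (-A * x ^ 2 + B * x + C).re = -A.re * x.re ^ 2 + (2 * A.im * x.im + B.re) * x.re +
      A.re * x.im ^ 2 - B.im * x.im + C.re := by
    simp only [add_re, mul_re, neg_re, neg_im, pow_two, mul_im]
    ring
  rw [hre]
  have hM : 0 ≤ M := (abs_nonneg _).trans hx
  have h1 : (2 * A.im * x.im + B.re) * x.re ≤ L * |x.re| := by
    refine (le_abs_self _).trans ?_
    rw [abs_mul]
    refine mul_le_mul_of_nonneg_right ?_ (abs_nonneg _)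
    refine (abs_add_le _ _).trans ?_
    rw [abs_mul, abs_mul, abs_two, hL]
    gcongr
  have h2 : L * |x.re| ≤ A.re / 2 * x.re ^ 2 + L ^ 2 / (2 * A.re) := by
    rw [← sq_abs x.re, ← sub_nonneg]
    have : A.re / 2 * |x.re| ^ 2 + L ^ 2 / (2 * A.re) - L * |x.re| =
        (A.re * |x.re| - L) ^ 2 / (2 * A.re) := by
      field_simp; ring
    rw [this]; positivity
  have h3 : A.re * x.im ^ 2 ≤ A.re * M ^ 2 := by
    rw [← sq_abs x.im]; gcongr
  have h4 : -(B.im * x.im) ≤ |B.im| * M := by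
    refine (neg_le_abs _).trans ?_
    rw [abs_mul]; gcongr
  linarith [le_abs_self C.re]

lemma integrable_of_gaussian_tail {g : ℝ → ℂ} (hg : Continuous g) {C α T : ℝ} (hα : 0 < α)
    (hb : ∀ t : ℝ, T ≤ |t| → ‖g t‖ ≤ C * Real.exp (-α * t ^ 2)) : Integrable g := by
  refine hg.locallyIntegrable.integrable_of_isBigO_cocompact (g := fun t : ℝ => Real.exp (-α * t ^ 2))
    ?_ ((integrable_exp_neg_mul_sq hα).integrableAtFilter _)
  refine Asymptotics.IsBigO.of_bound C ?_
  filter_upwards [(tendsto_norm_cocompact_atTop (E := ℝ)).eventually_ge_atTop T] with t ht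
  rw [Real.norm_of_nonneg (Real.exp_pos _).le]
  exact hb t ht

/-- The logarithmic part of the primitive cancels over an interval symmetric about `Re x₀`. -/
lemma integral_inv_symmetric {e : ℝ} (he : e ≠ 0) (x₀ : ℂ) (R : ℝ) :
    ∫ t in (x₀.re - R)..(x₀.re + R), ((t : ℂ) + ((x₀.im + e : ℝ) : ℂ) * I - x₀)⁻¹ =
      -2 * I * (Real.arctan (R / e) : ℂ) := by
  have hne : ∀ t : ℝ, (t : ℂ) + ((x₀.im + e : ℝ) : ℂ) * I - x₀ ≠ 0 := by
    intro t h
    have := congrArg Complex.im h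
    simp at this
    exact he this
  have hd : ∀ t ∈ Set.uIcc (x₀.re - R) (x₀.re + R), HasDerivAt
      (fun t : ℝ => (((1 / 2 * Real.log ((t - x₀.re) ^ 2 + e ^ 2) : ℝ) : ℂ)) -
        I * (Real.arctan ((t - x₀.re) / e) : ℂ))
      (((t : ℂ) + ((x₀.im + e : ℝ) : ℂ) * I - x₀)⁻¹) t := by
    intro t _
    have hpos : 0 < (t - x₀.re) ^ 2 + e ^ 2 := by positivity
    have hlin : HasDerivAt (fun t : ℝ => t - x₀.re) 1 t := (hasDerivAt_id t).sub_const _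
    have h1 : HasDerivAt (fun t : ℝ => 1 / 2 * Real.log ((t - x₀.re) ^ 2 + e ^ 2))
        ((t - x₀.re) / ((t - x₀.re) ^ 2 + e ^ 2)) t := by
      have := (((hlin.pow 2).add_const (e ^ 2)).log hpos.ne').const_mul (1 / 2)
      refine this.congr_deriv ?_
      simp
      field_simp
    have h2 : HasDerivAt (fun t : ℝ => Real.arctan ((t - x₀.re) / e))
        (e / ((t - x₀.re) ^ 2 + e ^ 2)) t := by
      refine ((hlin.div_const e).arctan).congr_deriv ?_
      field_simp
      ring
    refine (h1.ofReal_comp.sub (h2.ofReal_comp.const_mul I)).congr_deriv ?_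
    rw [eq_comm, inv_eq_one_div, div_eq_iff (hne t)]
    have hC : ((t : ℂ) - x₀.re) ^ 2 + (e : ℂ) ^ 2 ≠ 0 := by exact_mod_cast hpos.ne'
    have hx : (t : ℂ) + ((x₀.im + e : ℝ) : ℂ) * I - x₀ = (t - x₀.re) + e * I := by
      apply Complex.ext <;> simp
    rw [hx]
    push_cast
    field_simp
    linear_combination (e : ℂ) ^ 2 * I_sq
  rw [intervalIntegral.integral_eq_sub_of_hasDerivAt hd]
  · have e1 : x₀.re + R - x₀.re = R := by ring
    have e2 : x₀.re - R - x₀.re = -R := by ring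
    simp only [e1, e2, neg_sq, neg_div, Real.arctan_neg]
    push_cast
    ring
  · apply Continuous.intervalIntegrable
    exact (by fun_prop : Continuous fun t : ℝ =>
      (t : ℂ) + ((x₀.im + e : ℝ) : ℂ) * I - x₀).inv₀ hne

lemma tendsto_intervalIntegral_inv {e : ℝ} (he : e ≠ 0) (x₀ : ℂ) :
    Tendsto (fun R : ℝ => ∫ t in (x₀.re - R)..(x₀.re + R),
      ((t : ℂ) + ((x₀.im + e : ℝ) : ℂ) * I - x₀)⁻¹) atTop
      (𝓝 (if 0 < e then -(Real.pi * I) else Real.pi * I)) := by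
  simp_rw [integral_inv_symmetric he]
  rcases lt_or_gt_of_ne he with h | h
  · rw [if_neg h.le.not_gt]
    have h1 : Tendsto (fun R : ℝ => Real.arctan (R / e)) atTop (𝓝 (-(Real.pi / 2))) :=
      (Real.tendsto_arctan_atBot.mono_right nhdsWithin_le_nhds).comp
        (tendsto_id.atTop_div_const_of_neg h)
    have := ((continuous_ofReal.tendsto _).comp h1).const_mul (-2 * I)
    have e1 : -2 * I * ((-(Real.pi / 2) : ℝ) : ℂ) = Real.pi * I := by push_cast; ring
    rw [← e1]
    exact this
  · rw [if_pos h]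
    have h1 : Tendsto (fun R : ℝ => Real.arctan (R / e)) atTop (𝓝 (Real.pi / 2)) :=
      (Real.tendsto_arctan_atTop.mono_right nhdsWithin_le_nhds).comp
        (tendsto_id.atTop_div_const h)
    have := ((continuous_ofReal.tendsto _).comp h1).const_mul (-2 * I)
    have e1 : -2 * I * ((Real.pi / 2 : ℝ) : ℂ) = -(Real.pi * I) := by push_cast; ring
    rw [← e1]
    exact this

/-- The closed horizontal strip `c₁ ≤ Im x ≤ c₂`. -/
abbrev closedStrip (c₁ c₂ : ℝ) : Set ℂ := {x | x.im ∈ Set.Icc c₁ c₂}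

/-- Residue theorem for a strip and one simple pole: moving the line of integration across `x₀`
changes the integral of `φ x / (x - x₀)` by `2πi φ(x₀)`. The part `φ(x₀) / (x - x₀)` is integrated
explicitly over symmetric intervals, and Cauchy's theorem on rectangles handles the rest. -/
theorem integral_line_sub_integral_line {φ : ℂ → ℂ} {c₁ c₂ : ℝ} {x₀ : ℂ}
    (h₁ : c₁ < x₀.im) (h₂ : x₀.im < c₂) (hφ : DifferentiableOn ℂ φ (closedStrip c₁ c₂))
    {C α T : ℝ} (hα : 0 < α)
    (hb : ∀ x ∈ closedStrip c₁ c₂, T ≤ |x.re| → ‖φ x / (x - x₀)‖ ≤ C * Real.exp (-α * x.re ^ 2)) :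
    (∫ t : ℝ, φ (t + c₁ * I) / (t + c₁ * I - x₀)) - (∫ t : ℝ, φ (t + c₂ * I) / (t + c₂ * I - x₀)) =
      2 * Real.pi * I * φ x₀ := by
  have hline : ∀ c ∈ Set.Icc c₁ c₂, c ≠ x₀.im →
      Tendsto (fun R : ℝ => ∫ t in (x₀.re - R)..(x₀.re + R), φ (t + c * I) / (t + c * I - x₀)) atTop
        (𝓝 (∫ t : ℝ, φ (t + c * I) / (t + c * I - x₀))) ∧
      Continuous (fun t : ℝ => φ (t + c * I) / (t + c * I - x₀)) := by
    intro c hc hcne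
    have hcont : Continuous (fun t : ℝ => φ (t + c * I) / (t + c * I - x₀)) := by
      refine Continuous.div ?_ (by fun_prop) ?_
      · exact hφ.continuousOn.comp_continuous (by fun_prop) (fun t => by simpa using hc)
      · intro t h
        have := congrArg Complex.im h
        simp at this
        exact hcne (by linarith)
    refine ⟨?_, hcont⟩
    refine intervalIntegral_tendsto_integral (integrable_of_gaussian_tail hcont hα (C := C) (T := T)
      fun t ht => ?_) ?_ ?_
    · have := hb (t + c * I) (by simpa using hc) (by simpa using ht)
      simpa using this
    · exact tendsto_atBot_add_const_left _ _ tendsto_neg_atTop_atBot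
    · exact tendsto_atTop_add_const_left _ _ tendsto_id
  have hc₁ : c₁ ∈ Set.Icc c₁ c₂ := ⟨le_rfl, by linarith⟩
  have hc₂ : c₂ ∈ Set.Icc c₁ c₂ := ⟨by linarith, le_rfl⟩
  obtain ⟨T₁, C₁⟩ := hline c₁ hc₁ h₁.ne
  obtain ⟨T₂, C₂⟩ := hline c₂ hc₂ h₂.ne'
  have hi : ∀ c : ℝ, c ≠ x₀.im → Tendsto (fun R : ℝ => ∫ t in (x₀.re - R)..(x₀.re + R),
      ((t : ℂ) + (c : ℂ) * I - x₀)⁻¹) atTop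
      (𝓝 (if 0 < c - x₀.im then -(Real.pi * I) else Real.pi * I)) := by
    intro c hc
    have := tendsto_intervalIntegral_inv (sub_ne_zero.2 hc) x₀
    simpa only [add_sub_cancel] using this
  set h : ℂ → ℂ := dslope φ x₀ with hh
  have hnhds : closedStrip c₁ c₂ ∈ 𝓝 x₀ :=
    continuous_im.continuousAt.preimage_mem_nhds (Icc_mem_nhds h₁ h₂)
  have hhd : DifferentiableOn ℂ h (closedStrip c₁ c₂) :=
    (Complex.differentiableOn_dslope hnhds).2 hφ
  have hheq : ∀ x, x ≠ x₀ → h x = φ x / (x - x₀) - φ x₀ * (x - x₀)⁻¹ := by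
    intro x hx
    rw [hh, dslope_of_ne _ hx, slope_def_field]
    ring
  -- Cauchy's theorem for `h`
  have hrect : ∀ R : ℝ, 0 < R →
      (∫ t in (x₀.re - R)..(x₀.re + R), h (t + c₁ * I)) -
        (∫ t in (x₀.re - R)..(x₀.re + R), h (t + c₂ * I)) +
        I • (∫ y in c₁..c₂, h ((x₀.re + R : ℝ) + y * I)) -
        I • (∫ y in c₁..c₂, h ((x₀.re - R : ℝ) + y * I)) = 0 := by
    intro R _
    have := Complex.integral_boundary_rect_eq_zero_of_differentiableOn h
      (((x₀.re - R : ℝ) : ℂ) + c₁ * I) (((x₀.re + R : ℝ) : ℂ) + c₂ * I) (hhd.mono ?_)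
    · simpa using this
    · intro x hx
      have := hx.2
      simp only [Set.mem_preimage] at this
      rw [Set.uIcc_of_le (by simpa using (h₁.trans h₂).le)] at this
      simpa using this
  -- the vertical sides disappear in the limit
  have hside : ∀ s : ℝ, |s| = 1 →
      Tendsto (fun R : ℝ => ∫ y in c₁..c₂, h ((x₀.re + s * R : ℝ) + y * I)) atTop (𝓝 0) := by
    intro s hs
    have hs0 : s ≠ 0 := by rintro rfl; simp at hs
    have hlim : Tendsto (fun R : ℝ => (C * Real.exp (-α * (x₀.re + s * R) ^ 2) + ‖φ x₀‖ * R⁻¹) *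
        |c₂ - c₁|) atTop (𝓝 0) := by
      have habs : Tendsto (fun R : ℝ => |x₀.re + s * R|) atTop atTop := by
        refine tendsto_atTop_mono (f := fun R : ℝ => R - |x₀.re|) ?_
          (tendsto_atTop_add_const_right _ _ tendsto_id)
        intro R
        have h3 : |s * R| ≤ |x₀.re + s * R| + |x₀.re| := by
          have := abs_sub (x₀.re + s * R) x₀.re
          simpa using this
        rw [abs_mul, hs, one_mul] at h3
        linarith [le_abs_self R]
      have h3 : Tendsto (fun R : ℝ => Real.exp (-α * (x₀.re + s * R) ^ 2)) atTop (𝓝 0) := by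
        refine Real.tendsto_exp_atBot.comp ?_
        have h4 := ((tendsto_pow_atTop two_ne_zero).comp habs).const_mul_atTop_of_neg
          (neg_neg_of_pos hα)
        simpa [Function.comp_def, sq_abs] using h4
      have h5 := ((h3.const_mul C).add (tendsto_inv_atTop_zero.const_mul ‖φ x₀‖)).mul_const |c₂ - c₁|
      simpa using h5
    have habs : ∀ᶠ R : ℝ in atTop, T ≤ |x₀.re + s * R| := by
      filter_upwards [eventually_ge_atTop (T + |x₀.re|)] with R hR
      have h3 : |s * R| ≤ |x₀.re + s * R| + |x₀.re| := by
        have := abs_sub (x₀.re + s * R) x₀.re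
        simpa using this
      rw [abs_mul, hs, one_mul] at h3
      linarith [le_abs_self R]
    refine squeeze_zero_norm' ?_ hlim
    filter_upwards [habs, eventually_gt_atTop (0 : ℝ)] with R hR hR0
    refine intervalIntegral.norm_integral_le_of_norm_le_const fun y hy => ?_
    rw [Set.uIoc_of_le (h₁.trans h₂).le] at hy
    set x : ℂ := ((x₀.re + s * R : ℝ) : ℂ) + y * I with hx
    have hxre : x.re = x₀.re + s * R := by simp [hx]
    have hxim : x.im = y := by simp [hx]
    have hnorm : R ≤ ‖x - x₀‖ := by
      refine le_trans ?_ (abs_re_le_norm _)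
      rw [sub_re, hxre, add_sub_cancel_left, abs_mul, hs, one_mul, abs_of_pos hR0]
    have hxne : x ≠ x₀ := by
      intro e; rw [e, sub_self, norm_zero] at hnorm; linarith
    rw [hheq x hxne]
    refine (norm_sub_le _ _).trans (add_le_add ?_ ?_)
    · have := hb x (by simp only [closedStrip, Set.mem_ofPred_eq, hxim]; exact ⟨hy.1.le, hy.2⟩)
        (by rw [hxre]; exact hR)
      rwa [hxre] at this
    · rw [norm_mul, norm_inv]
      gcongr
  have hhor : ∀ c ∈ Set.Icc c₁ c₂, c ≠ x₀.im → ∀ R : ℝ,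
      (∫ t in (x₀.re - R)..(x₀.re + R), h (t + c * I)) =
      (∫ t in (x₀.re - R)..(x₀.re + R), φ (t + c * I) / (t + c * I - x₀)) -
        φ x₀ * ∫ t in (x₀.re - R)..(x₀.re + R), ((t : ℂ) + (c : ℂ) * I - x₀)⁻¹ := by
    intro c hc hcne R
    have hne : ∀ t : ℝ, (t : ℂ) + c * I - x₀ ≠ 0 := by
      intro t h
      have := congrArg Complex.im h
      simp at this
      exact hcne (by linarith)
    rw [← intervalIntegral.integral_const_mul, ← intervalIntegral.integral_sub]
    · exact intervalIntegral.integral_congr fun t _ => hheq _ (sub_ne_zero.1 (hne t))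
    · exact (hline c hc hcne).2.intervalIntegrable _ _
    · refine Continuous.intervalIntegrable ?_ _ _
      exact continuous_const.mul ((by fun_prop : Continuous fun t : ℝ =>
        (t : ℂ) + c * I - x₀).inv₀ hne)
  have L1 := (T₁.sub ((hi c₁ h₁.ne).const_mul (φ x₀)))
  have L2 := (T₂.sub ((hi c₂ h₂.ne').const_mul (φ x₀)))
  have S1 := (hside 1 (by simp)).const_smul I
  have S2 := (hside (-1) (by simp)).const_smul I
  have Ltot := ((L1.sub L2).add S1).sub S2
  rw [if_neg (by linarith), if_pos (by linarith)] at Ltot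
  have hzero : Tendsto (fun _ : ℝ => (0 : ℂ)) atTop (𝓝 0) := tendsto_const_nhds
  have huniq := tendsto_nhds_unique (Ltot.congr' ?_) hzero
  · simp only [smul_zero, add_zero, sub_zero] at huniq
    linear_combination huniq
  · filter_upwards [eventually_gt_atTop (0 : ℝ)] with R hR
    rw [← hrect R hR, hhor c₁ hc₁ h₁.ne R, hhor c₂ hc₂ h₂.ne' R]
    simp only [one_mul, neg_mul, ← sub_eq_add_neg]

/-- Cauchy's theorem for a strip: lines of integration may be moved where there is no pole. -/
theorem integral_line_eq_integral_line {f : ℂ → ℂ} {c₁ c₂ : ℝ} (h : c₁ ≤ c₂)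
    (hf : DifferentiableOn ℂ f (closedStrip c₁ c₂)) {C α T : ℝ} (hα : 0 < α)
    (hb : ∀ x ∈ closedStrip c₁ c₂, T ≤ |x.re| → ‖f x‖ ≤ C * Real.exp (-α * x.re ^ 2)) :
    (∫ t : ℝ, f (t + c₁ * I)) = ∫ t : ℝ, f (t + c₂ * I) := by
  rcases h.eq_or_lt with rfl | hlt
  · rfl
  set x₀ : ℂ := ((c₁ + c₂) / 2 : ℝ) * I with hx₀
  have him : x₀.im = (c₁ + c₂) / 2 := by simp [hx₀]
  have key := integral_line_sub_integral_line (φ := fun x => (x - x₀) * f x) (x₀ := x₀)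
    (c₁ := c₁) (c₂ := c₂) (by rw [him]; linarith) (by rw [him]; linarith)
    (DifferentiableOn.mul (by fun_prop) hf) (C := C) (T := T) hα (by
      intro x hx hT
      rcases eq_or_ne x x₀ with rfl | hne
      · simp only [sub_self, zero_mul, zero_div, norm_zero]
        exact (norm_nonneg _).trans (hb _ hx hT)
      · rw [mul_div_cancel_left₀ _ (sub_ne_zero.2 hne)]
        exact hb _ hx hT)
  have hc : ∀ c : ℝ, c ≠ (c₁ + c₂) / 2 → ∀ t : ℝ,
      (((t : ℂ) + c * I - x₀) * f (t + c * I)) / (t + c * I - x₀) = f (t + c * I) := by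
    intro c hc t
    refine mul_div_cancel_left₀ _ fun h0 => hc ?_
    have := congrArg Complex.im h0
    rw [sub_im, him] at this
    simp at this
    linarith
  simp only [hc c₁ (by linarith), hc c₂ (by linarith), sub_self, zero_mul, mul_zero] at key
  exact sub_eq_zero.1 key

/-! ### Lower bounds for `1 - exp(2πis)` -/

lemma norm_cexp_two_pi_I_mul (s : ℂ) :
    ‖cexp (2 * Real.pi * I * s)‖ = Real.exp (-(2 * Real.pi * s.im)) := by
  rw [norm_exp]
  congr 1
  simp [mul_re]

lemma half_le_norm_one_sub_cexp {s : ℂ} (hs : 1 ≤ |s.im|) :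
    1 / 2 ≤ ‖1 - cexp (2 * Real.pi * I * s)‖ := by
  have hpi := Real.pi_gt_three
  rcases le_abs.1 hs with h | h
  · have h1 : Real.exp (-(2 * Real.pi * s.im)) ≤ 1 / 2 := by
      rw [Real.exp_neg, ← one_div]
      refine one_div_le_one_div_of_le two_pos ?_
      have := Real.add_one_le_exp (2 * Real.pi * s.im)
      nlinarith
    have h2 := norm_sub_norm_le (1 : ℂ) (cexp (2 * Real.pi * I * s))
    rw [norm_one, norm_cexp_two_pi_I_mul] at h2
    linarith
  · have h1 : 2 ≤ Real.exp (-(2 * Real.pi * s.im)) := by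
      have := Real.add_one_le_exp (-(2 * Real.pi * s.im))
      nlinarith
    have h2 := norm_sub_norm_le (cexp (2 * Real.pi * I * s)) (1 : ℂ)
    rw [norm_one, norm_cexp_two_pi_I_mul, norm_sub_rev] at h2
    linarith

/-- The real coordinate of `s` in the decomposition `ℂ = ℝ ⊕ izℝ`, for `Re z ≠ 0`. -/
noncomputable def realCoord (z s : ℂ) : ℝ := (s * (starRingEnd ℂ) z).re / z.re

lemma realCoord_eq (z s : ℂ) (hz : z.re ≠ 0) : realCoord z s = s.re + s.im * z.im / z.re := by
  unfold realCoord
  simp [mul_re]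
  field_simp

lemma eq_realCoord_add {z : ℂ} (hz : z.re ≠ 0) (s : ℂ) :
    s = realCoord z s + I * z * ((s.im / z.re : ℝ) : ℂ) := by
  rw [realCoord_eq z s hz]
  apply Complex.ext
  · simp; field_simp; ring
  · simp; field_simp

lemma realCoord_intCast {z : ℂ} (hz : z.re ≠ 0) (m : ℤ) : realCoord z m = m := by
  rw [realCoord_eq z _ hz]; simp

lemma one_sub_cexp_ne_zero {z s : ℂ} (hz : z.re ≠ 0) (h : ∀ m : ℤ, realCoord z s ≠ m) :
    1 - cexp (2 * Real.pi * I * s) ≠ 0 := by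
  intro h0
  obtain ⟨n, hn⟩ := exp_eq_one_iff.1 (sub_eq_zero.1 h0).symm
  have : s = n := by
    have h2 : (2 * Real.pi * I : ℂ) ≠ 0 := two_pi_I_ne_zero
    apply mul_left_cancel₀ h2
    rw [hn]; ring
  exact h n (by rw [this, realCoord_intCast hz])

/-- Away from the lines `m + izℝ`, `m ∈ ℤ`, the function `1 - exp(2πis)` is bounded below: it has
period one, it is large or close to one when `|Im s|` is large, and the rest is compactness. -/
lemma exists_le_norm_one_sub_cexp {z : ℂ} (hz : 0 < z.re) {d : ℝ} (hd : 0 < d) :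
    ∃ c : ℝ, 0 < c ∧ ∀ s : ℂ, (∀ m : ℤ, d ≤ |realCoord z s - m|) →
      c ≤ ‖1 - cexp (2 * Real.pi * I * s)‖ := by
  let K : Set (ℝ × ℝ) := Set.Icc d (1 - d) ×ˢ Set.Icc (-(1 / z.re)) (1 / z.re)
  have hK : IsCompact K := isCompact_Icc.prod isCompact_Icc
  have hf : ContinuousOn (fun p : ℝ × ℝ =>
      ‖1 - cexp (2 * Real.pi * I * ((p.1 : ℂ) + I * z * (p.2 : ℂ)))‖) K := by
    apply Continuous.continuousOn; fun_prop
  have hpos : ∀ p ∈ K, 0 < ‖1 - cexp (2 * Real.pi * I * ((p.1 : ℂ) + I * z * (p.2 : ℂ)))‖ := by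
    rintro ⟨σ, τ⟩ ⟨⟨h1, h2⟩, -⟩
    rw [norm_pos_iff]
    refine one_sub_cexp_ne_zero (z := z) hz.ne' fun m hm => ?_
    have : realCoord z ((σ : ℂ) + I * z * (τ : ℂ)) = σ := by
      rw [realCoord_eq _ _ hz.ne']; simp; field_simp; ring
    rw [this] at hm
    simp only at h1 h2
    rw [hm] at h1 h2
    have h3 : (0 : ℤ) < m := by exact_mod_cast hd.trans_le h1
    have h4 : m < (1 : ℤ) := by
      have : (m : ℝ) < 1 := by linarith
      exact_mod_cast this
    omega
  obtain ⟨c, hc, hcb⟩ := hK.exists_forall_le' hf hpos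
  refine ⟨min c (1 / 2), lt_min hc (by norm_num), fun s hs => ?_⟩
  rcases le_or_gt 1 |s.im| with him | him
  · exact (min_le_right _ _).trans (half_le_norm_one_sub_cexp him)
  · refine (min_le_left _ _).trans ?_
    have h1 := hs ⌊realCoord z s⌋
    have h2 := hs (⌊realCoord z s⌋ + 1)
    have h3 := Int.floor_le (realCoord z s)
    have h4 := Int.lt_floor_add_one (realCoord z s)
    rw [abs_of_nonneg (by linarith)] at h1
    push_cast at h2
    rw [abs_of_neg (by linarith)] at h2
    have := hcb (realCoord z s - ⌊realCoord z s⌋, s.im / z.re) ⟨⟨h1, by simp only; linarith⟩, by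
      rw [abs_lt] at him
      refine ⟨?_, ?_⟩
      · simp only; rw [← neg_div]; gcongr; exact him.1.le
      · simp only; gcongr; exact him.2.le⟩
    refine this.trans (le_of_eq ?_)
    congr 2
    rw [show (2 * Real.pi * I * s : ℂ) = 2 * Real.pi * I *
        (((realCoord z s - ⌊realCoord z s⌋ : ℝ) : ℂ) + I * z * ((s.im / z.re : ℝ) : ℂ)) +
        ⌊realCoord z s⌋ * (2 * Real.pi * I) by
      conv_lhs => rw [eq_realCoord_add hz.ne' s]
      push_cast; ring, exp_add, exp_int_mul_two_pi_mul_I, mul_one]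

/-! ### The integrands produced by Poisson summation -/

/-- The argument `s` for which the denominator of `poissonTerm` is `1 - exp(2πis)`. -/
noncomputable def polePhase (k : ℕ) (z w : ℂ) (μ : ℤ) (x : ℂ) : ℂ := w + (μ + I * z * x) / k

/-- The numerator of `poissonTerm`, an entire function of `x` which does not involve `w`. -/
noncomputable def poissonNumer (h' : ℤ) (k : ℕ) (z : ℂ) (r μ : ℤ) (x : ℂ) : ℂ :=
  (-1) ^ μ * cexp (-(Real.pi * I * h' / k * (3 * μ ^ 2 + (2 * r + 1) * μ))) *
    cexp (-(3 * Real.pi * z / k) * x ^ 2 +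
      (-(Real.pi * I * (2 * r + 1) / k) - Real.pi * z / k) * x + Real.pi * I * μ / k)

/-- The integrand of the `r`-th Fourier coefficient of the terms of the rank series with
`n ≡ -h'μ (mod k)`, continued to complex `x`. It is `k`-periodic in `μ` when `h' + k` is odd. -/
noncomputable def poissonTerm (h' : ℤ) (k : ℕ) (z w : ℂ) (r μ : ℤ) (x : ℂ) : ℂ :=
  poissonNumer h' k z r μ x / (1 - cexp (2 * Real.pi * I * polePhase k z w μ x))

/-- The integral of `poissonTerm` over the line `ℝ - ia/z`, on which `izx` has real coordinate `a`
with respect to `ℂ = ℝ ⊕ izℝ`. -/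
noncomputable def lineInt (h' : ℤ) (k : ℕ) (z w : ℂ) (r μ : ℤ) (a : ℝ) : ℂ :=
  ∫ t : ℝ, poissonTerm h' k z w r μ (t - I * a / z)

lemma neg_one_zpow_eq_cexp (n : ℤ) : ((-1 : ℂ)) ^ n = cexp (Real.pi * I * n) := by
  rw [← exp_pi_mul_I, ← exp_int_mul]
  congr 1; ring

lemma cexp_eq_of_eq_add {a b : ℂ} (n : ℤ) (h : a = b + 2 * Real.pi * I * n) : cexp a = cexp b := by
  rw [h, exp_add, show 2 * Real.pi * I * (n : ℂ) = n * (2 * Real.pi * I) by ring,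
    exp_int_mul_two_pi_mul_I, mul_one]

lemma hFun_eq (k : ℕ) (z w : ℂ) (μ : ℤ) (x : ℂ) :
    hFun w (Real.pi * I * (μ + I * z * x) / k) =
      cexp (Real.pi * I * (μ + I * z * x) / k) /
        (1 - cexp (2 * Real.pi * I * polePhase k z w μ x)) := by
  unfold hFun polePhase
  rw [← exp_add]
  congr 3
  ring_nf

lemma poissonTerm_eq_hFun (h' : ℤ) (k : ℕ) (z w : ℂ) (r μ : ℤ) (x : ℂ) :
    poissonTerm h' k z w r μ x =
      (-1) ^ μ * cexp (-(Real.pi * I * h' / k * (3 * μ ^ 2 + (2 * r + 1) * μ))) *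
      cexp (-(3 * Real.pi * z * x ^ 2 / k) - Real.pi * I * (2 * r + 1) * x / k) *
        hFun w (Real.pi * I * (μ + I * z * x) / k) := by
  have e : cexp (-(3 * Real.pi * z / k) * x ^ 2 +
      (-(Real.pi * I * (2 * r + 1) / k) - Real.pi * z / k) * x + Real.pi * I * μ / k) =
      cexp (-(3 * Real.pi * z * x ^ 2 / k) - Real.pi * I * (2 * r + 1) * x / k) *
        cexp (Real.pi * I * (μ + I * z * x) / k) := by
    rw [← exp_add]
    congr 1
    linear_combination (-Real.pi * z * x / k) * I_sq
  rw [hFun_eq, poissonTerm, poissonNumer, e]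
  ring

lemma poissonTerm_add_period {h' : ℤ} {k : ℕ} (hk : 0 < k) (hpar : Odd (h' + k)) (z w : ℂ)
    (r μ : ℤ) (x : ℂ) : poissonTerm h' k z w r (μ + k) x = poissonTerm h' k z w r μ x := by
  have hk' : (k : ℂ) ≠ 0 := by exact_mod_cast hk.ne'
  unfold poissonTerm poissonNumer
  congr 1
  · rw [neg_one_zpow_eq_cexp, neg_one_zpow_eq_cexp, ← exp_add, ← exp_add, ← exp_add, ← exp_add]
    obtain ⟨j, hj⟩ : Even ((k : ℤ) + 1 - h' * (6 * μ + 3 * k + 2 * r + 1)) := by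
      rcases Int.even_or_odd (k : ℤ) with hk2 | hk2
      · have : Odd h' := by
          by_contra hh
          rw [Int.not_odd_iff_even] at hh
          exact (Int.not_odd_iff_even.2 (hh.add hk2)) hpar
        obtain ⟨a, ha⟩ := hk2
        obtain ⟨b, hb⟩ := this
        exact ⟨a - (b * (6 * μ + 3 * k + 2 * r + 1) + 3 * μ + 3 * a + r), by rw [ha, hb]; ring⟩
      · have : Even h' := by
          by_contra hh
          rw [Int.not_even_iff_odd] at hh
          exact (Int.not_odd_iff_even.2 (hh.add_odd hk2)) hpar
        obtain ⟨a, ha⟩ := hk2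
        obtain ⟨b, hb⟩ := this
        exact ⟨a + 1 - b * (6 * μ + 3 * k + 2 * r + 1), by rw [ha, hb]; ring⟩
    apply cexp_eq_of_eq_add j
    have hjC : (k : ℂ) + 1 - h' * (6 * μ + 3 * k + 2 * r + 1) = j + j := by exact_mod_cast hj
    push_cast
    field_simp
    linear_combination (I * k) * hjC
  · congr 1
    apply cexp_eq_of_eq_add 1
    unfold polePhase
    push_cast
    field_simp
    ring

/-- Moving `izx` by one lowers the Fourier index by three. -/
lemma poissonTerm_shift {h' : ℤ} {k : ℕ} (hk : 0 < k) {z : ℂ} (hz : z ≠ 0) (w : ℂ)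
    (r μ : ℤ) (x : ℂ) :
    poissonTerm h' k z w r μ (x - I / z) =
      -nome k h' z⁻¹ ^ (r - 1) * poissonTerm h' k z w (r - 3) (μ + 1) x := by
  have hk' : (k : ℂ) ≠ 0 := by exact_mod_cast hk.ne'
  unfold poissonTerm poissonNumer nome
  have hneg : ∀ y : ℂ, -cexp y = cexp (Real.pi * I + y) := fun y => by
    rw [exp_add, exp_pi_mul_I]; ring
  rw [← mul_div_assoc, ← exp_int_mul, hneg]
  congr 1
  · rw [neg_one_zpow_eq_cexp, neg_one_zpow_eq_cexp, ← exp_add, ← exp_add, ← exp_add, ← exp_add,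
      ← exp_add]
    apply cexp_eq_of_eq_add (-1)
    push_cast
    field_simp
    ring_nf
  · congr 3
    unfold polePhase
    field_simp
    push_cast
    linear_combination -I_sq

/-- The Fourier index enters through a character, evaluated at `x + h'μ`. -/
lemma poissonTerm_index (h' : ℤ) (k : ℕ) (z w : ℂ) (r μ : ℤ) (x : ℂ) :
    poissonTerm h' k z w r μ x =
      cexp (-(2 * Real.pi * I * r * (h' * μ + x) / k)) * poissonTerm h' k z w 0 μ x := by
  unfold poissonTerm poissonNumer
  rw [← mul_div_assoc]
  congr 1
  simp only [mul_assoc ((-1 : ℂ) ^ μ), mul_left_comm _ ((-1 : ℂ) ^ μ)]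
  rw [← exp_add, ← exp_add, ← exp_add]
  congr 2
  push_cast
  ring

section Strip

variable {h' : ℤ} {k : ℕ} {z w : ℂ}

/-- The real coordinate of the phase depends only on the height of `x`. As `1 - exp(2πis)` vanishes
only at integers, this locates the horizontal lines that carry poles. -/
lemma realCoord_polePhase (hz : 0 < z.re) (μ : ℤ) (x : ℂ) :
    realCoord z (polePhase k z w μ x) = realCoord z w + (μ - x.im / (z⁻¹).re) / k := by
  have hz0 : z ≠ 0 := by rintro rfl; simp at hz
  have hn : normSq z ≠ 0 := (normSq_pos.2 hz0).ne'
  rw [realCoord_eq _ _ hz.ne', realCoord_eq _ _ hz.ne', polePhase, inv_re]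
  simp only [add_re, add_im, div_natCast_re, div_natCast_im, mul_re, mul_im, intCast_re, intCast_im,
    I_re, I_im]
  rw [normSq_apply] at hn ⊢
  field_simp
  ring

lemma continuous_polePhase (μ : ℤ) : Continuous (polePhase k z w μ) := by
  unfold polePhase; fun_prop

lemma differentiable_polePhase (μ : ℤ) : Differentiable ℂ (polePhase k z w μ) := by
  unfold polePhase; fun_prop

lemma differentiable_poissonNumer (r μ : ℤ) : Differentiable ℂ (poissonNumer h' k z r μ) := by
  unfold poissonNumer; fun_prop

lemma norm_poissonNumer_le (hk : 0 < k) (hz : 0 < z.re) (h' r μ : ℤ) (M : ℝ) :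
    ∃ D : ℝ, 0 < D ∧ ∀ x : ℂ, |x.im| ≤ M →
      ‖poissonNumer h' k z r μ x‖ ≤ D * Real.exp (-(3 * Real.pi * z.re / k / 2) * x.re ^ 2) := by
  have hkR : (0 : ℝ) < k := by exact_mod_cast hk
  have hre : (3 * Real.pi * z / k : ℂ).re = 3 * Real.pi * z.re / k := by
    rw [div_natCast_re, show (3 * Real.pi * z : ℂ) = ((3 * Real.pi : ℝ) : ℂ) * z by push_cast; ring,
      re_ofReal_mul]
  obtain ⟨D, hD, hb⟩ := norm_cexp_quadratic_le (3 * Real.pi * z / k)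
    (-(Real.pi * I * (2 * r + 1) / k) - Real.pi * z / k) (Real.pi * I * μ / k)
    (by rw [hre]; have := Real.pi_pos; positivity) M
  refine ⟨‖(-1 : ℂ) ^ μ * cexp (-(Real.pi * I * h' / k * (3 * μ ^ 2 + (2 * r + 1) * μ)))‖ * D,
    mul_pos (norm_pos_iff.2 (mul_ne_zero (zpow_ne_zero _ (by simp)) (exp_ne_zero _))) hD,
    fun x hx => ?_⟩
  rw [poissonNumer, norm_mul]
  rw [hre] at hb
  exact (mul_le_mul_of_nonneg_left (hb x hx) (norm_nonneg _)).trans (le_of_eq (by ring))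

/-- Gaussian decay on horizontal strips. The threshold `T` avoids the poles: beyond it the phase has
imaginary part at least one in absolute value. -/
lemma exists_poissonTerm_tail (hk : 0 < k) (hz : 0 < z.re) (h' r μ : ℤ) (w : ℂ) (M : ℝ) :
    ∃ C T : ℝ, ∀ x : ℂ, |x.im| ≤ M → T ≤ |x.re| →
      ‖poissonTerm h' k z w r μ x‖ ≤ C * Real.exp (-(3 * Real.pi * z.re / k / 2) * x.re ^ 2) := by
  obtain ⟨D, hD, hb⟩ := norm_poissonNumer_le hk hz h' r μ M
  have hkR : (0 : ℝ) < k := by exact_mod_cast hk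
  refine ⟨2 * D, (1 + |w.im| + |z.im| * M / k) * k / z.re, fun x hx hT => ?_⟩
  have him : (polePhase k z w μ x).im = w.im + (z.re * x.re - z.im * x.im) / k := by
    rw [polePhase, add_im, div_natCast_im]
    simp only [add_im, mul_re, mul_im, intCast_im, I_re, I_im]
    ring
  have h1 : 1 ≤ |(polePhase k z w μ x).im| := by
    rw [him]
    have h2 : |z.re * x.re / k| ≤
        |w.im + (z.re * x.re - z.im * x.im) / k| + (|w.im| + |z.im| * M / k) := by
      have e : z.re * x.re / k = (w.im + (z.re * x.re - z.im * x.im) / k) +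
        (-w.im + z.im * x.im / k) := by ring
      rw [e]
      refine (abs_add_le _ _).trans (add_le_add (le_of_eq ?_) ((abs_add_le _ _).trans ?_))
      · rfl
      · rw [abs_neg, abs_div, abs_mul, abs_of_pos hkR]
        gcongr
    have h3 : 1 + |w.im| + |z.im| * M / k ≤ |z.re * x.re / k| := by
      rw [abs_div, abs_mul, abs_of_pos hkR, abs_of_pos hz, le_div_iff₀ hkR]
      rw [div_le_iff₀ hz] at hT
      linarith
    linarith
  have h2 := half_le_norm_one_sub_cexp h1
  rw [poissonTerm, norm_div, div_le_iff₀ (by linarith)]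
  refine (hb x hx).trans ?_
  have h3 : 0 < D * Real.exp (-(3 * Real.pi * z.re / k / 2) * x.re ^ 2) :=
    mul_pos hD (Real.exp_pos _)
  nlinarith

lemma gaussian_rate_pos (hk : 0 < k) (hz : 0 < z.re) : 0 < 3 * Real.pi * z.re / k / 2 := by
  have hkR : (0 : ℝ) < k := by exact_mod_cast hk
  have := Real.pi_pos
  positivity

lemma inv_re_pos (hz : 0 < z.re) : 0 < (z⁻¹).re := by
  have hz0 : z ≠ 0 := by rintro rfl; simp at hz
  rw [inv_re]; exact div_pos hz (normSq_pos.2 hz0)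

lemma line_im (a t : ℝ) : ((t : ℂ) - I * a / z).im = -(a * (z⁻¹).re) := by
  rw [div_eq_mul_inv, mul_assoc]
  simp

lemma line_re (a t : ℝ) : ((t : ℂ) - I * a / z).re = t + a * (z⁻¹).im := by
  rw [div_eq_mul_inv, mul_assoc]
  simp

lemma continuous_poissonTerm_line (hz : 0 < z.re) (r μ : ℤ) {c : ℂ}
    (hc : ∀ m : ℤ, realCoord z w + (μ - c.im / (z⁻¹).re) / k ≠ m) :
    Continuous (fun t : ℝ => poissonTerm h' k z w r μ (t + c)) := by
  unfold poissonTerm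
  refine Continuous.div ?_ ?_ fun t => ?_
  · exact (differentiable_poissonNumer r μ).continuous.comp (by fun_prop)
  · have := (continuous_polePhase (k := k) (z := z) (w := w) μ).comp
      (show Continuous fun t : ℝ => (t : ℂ) + c by fun_prop)
    exact continuous_const.sub (continuous_exp.comp (continuous_const.mul this))
  · refine one_sub_cexp_ne_zero hz.ne' fun m => ?_
    rw [realCoord_polePhase hz]
    simpa using hc m

lemma integrable_poissonTerm_line (hk : 0 < k) (hz : 0 < z.re) (r μ : ℤ) {c : ℝ}
    (hc : ∀ m : ℤ, realCoord z w + (μ - c / (z⁻¹).re) / k ≠ m) :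
    Integrable (fun t : ℝ => poissonTerm h' k z w r μ (t + c * I)) := by
  obtain ⟨C, T, hb⟩ := exists_poissonTerm_tail hk hz h' r μ w |c|
  refine integrable_of_gaussian_tail (continuous_poissonTerm_line hz r μ (by simpa using hc))
    (gaussian_rate_pos hk hz) (C := C) (T := T) fun t ht => ?_
  have := hb (t + c * I) (by simp) (by simpa using ht)
  simpa using this

lemma line_eq (a t : ℝ) : (t : ℂ) - I * a / z =
    ((t + a * (z⁻¹).im : ℝ) : ℂ) + ((-(a * (z⁻¹).re) : ℝ) : ℂ) * I := by
  apply Complex.ext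
  · rw [line_re]; simp
  · rw [line_im]; simp

lemma lineInt_eq (r μ : ℤ) (a : ℝ) : lineInt h' k z w r μ a =
    ∫ t : ℝ, poissonTerm h' k z w r μ (t + ((-(a * (z⁻¹).re) : ℝ) : ℂ) * I) := by
  unfold lineInt
  simp_rw [line_eq]
  exact integral_add_right_eq_self (fun t : ℝ =>
    poissonTerm h' k z w r μ (t + ((-(a * (z⁻¹).re) : ℝ) : ℂ) * I)) _

lemma line_level (hz : 0 < z.re) (a : ℝ) : -(-(a * (z⁻¹).re)) / (z⁻¹).re = a := by
  rw [neg_neg, mul_div_cancel_right₀ _ (inv_re_pos hz).ne']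

lemma integrable_lineInt (hk : 0 < k) (hz : 0 < z.re) (r μ : ℤ) {a : ℝ}
    (ha : ∀ m : ℤ, realCoord z w + (μ + a) / k ≠ m) :
    Integrable (fun t : ℝ => poissonTerm h' k z w r μ (t - I * a / z)) := by
  simp_rw [line_eq]
  refine (integrable_poissonTerm_line hk hz r μ (c := -(a * (z⁻¹).re)) fun m => ?_).comp_add_right
    (a * (z⁻¹).im)
  rw [sub_eq_add_neg, ← neg_div, line_level hz]
  exact ha m

/-- The line of integration may be moved as long as it meets no pole. -/
lemma lineInt_congr (hk : 0 < k) (hz : 0 < z.re) (r μ : ℤ) {a b : ℝ} (hab : a ≤ b)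
    (h : ∀ c ∈ Set.Icc a b, ∀ m : ℤ, realCoord z w + (μ + c) / k ≠ m) :
    lineInt h' k z w r μ a = lineInt h' k z w r μ b := by
  have hκ := inv_re_pos hz
  rw [lineInt_eq, lineInt_eq, eq_comm]
  have hmem : ∀ x ∈ closedStrip (-(b * (z⁻¹).re)) (-(a * (z⁻¹).re)),
      -x.im / (z⁻¹).re ∈ Set.Icc a b := by
    rintro x ⟨h1, h2⟩
    rw [Set.mem_Icc, le_div_iff₀ hκ, div_le_iff₀ hκ]
    constructor <;> linarith
  obtain ⟨C, T, hb⟩ := exists_poissonTerm_tail hk hz h' r μ w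
    (max |-(b * (z⁻¹).re)| |-(a * (z⁻¹).re)|)
  refine integral_line_eq_integral_line (by nlinarith) ?_ (gaussian_rate_pos hk hz)
    (C := C) (T := T) fun x hx => hb x (abs_le_max_abs_abs hx.1 hx.2)
  unfold poissonTerm
  refine (differentiable_poissonNumer r μ).differentiableOn.div ?_ fun x hx => ?_
  · have := differentiable_polePhase (k := k) (z := z) (w := w) μ
    fun_prop
  · refine one_sub_cexp_ne_zero hz.ne' fun m => ?_
    rw [realCoord_polePhase hz, sub_eq_add_neg, ← neg_div]
    exact h _ (hmem x hx) m

/-- For `μ = 0` the strip between the lines `a = ±1/6` contains the one pole `x = ikw/z`. -/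
lemma lineInt_zero_sub (hk : 0 < k) (hz : 0 < z.re) (hw : |realCoord z w| < 1 / (6 * k)) (r : ℤ) :
    lineInt h' k z w r 0 (1 / 6) - lineInt h' k z w r 0 (-(1 / 6)) =
      I * k / z * cexp (3 * Real.pi * k * w ^ 2 / z - Real.pi * I * w + Real.pi * w / z) *
        cexp (2 * Real.pi * w / z) ^ r := by
  have hκ := inv_re_pos hz
  have hz0 : z ≠ 0 := by rintro rfl; simp at hz
  have hk' : (k : ℂ) ≠ 0 := by exact_mod_cast hk.ne'
  have hkR : (1 : ℝ) ≤ k := by exact_mod_cast hk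
  set x₀ : ℂ := I * k * w / z with hx₀
  set κ := (z⁻¹).re with hκdef
  have hph : polePhase k z w 0 x₀ = 0 := by
    unfold polePhase; rw [hx₀]; field_simp; push_cast; linear_combination (w * k) * I_sq
  have hx₀im : x₀.im = k * realCoord z w * κ := by
    have h1 := realCoord_polePhase (k := k) (w := w) hz 0 x₀
    rw [hph, ← hκdef] at h1
    have h2 : realCoord z 0 = 0 := by simp [realCoord]
    rw [h2] at h1
    field_simp at h1
    push_cast at h1
    linarith
  have hkw : |k * realCoord z w| < 1 / 6 := by
    rw [abs_mul, abs_of_nonneg (by positivity)]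
    rw [lt_div_iff₀ (by positivity)] at hw
    linarith
  obtain ⟨hw1, hw2⟩ := abs_lt.1 hkw
  set D : ℂ → ℂ := fun x => 1 - cexp (2 * Real.pi * I * polePhase k z w 0 x) with hD
  have hDx₀ : D x₀ = 0 := by
    simp [hD, hph]
  have hDdiff : Differentiable ℂ D := by
    have := differentiable_polePhase (k := k) (z := z) (w := w) 0
    fun_prop
  have hDderiv : deriv D x₀ = 2 * Real.pi * z / k := by
    have h1 : HasDerivAt (polePhase k z w 0) (I * z / k) x₀ := by
      unfold polePhase
      have := (((hasDerivAt_id x₀).const_mul (I * z)).const_add ((0 : ℤ) : ℂ)).div_const (k : ℂ)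
        |>.const_add w
      simpa using this
    have h2 := ((h1.const_mul (2 * Real.pi * I)).cexp).const_sub 1
    rw [hph] at h2
    rw [h2.deriv]
    simp only [mul_zero, exp_zero, one_mul]
    linear_combination (-2 * Real.pi * z / k) * I_sq
  -- the denominator with its simple zero at `x₀` divided out
  set E : ℂ → ℂ := dslope D x₀ with hE
  have hEdiff : Differentiable ℂ E := by
    rw [← differentiableOn_univ] at hDdiff ⊢
    exact (Complex.differentiableOn_dslope univ_mem).2 hDdiff
  have hEx₀ : E x₀ = 2 * Real.pi * z / k := by rw [hE, dslope_same, hDderiv]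
  have hDE : ∀ x, x ≠ x₀ → E x = D x / (x - x₀) := by
    intro x hx
    rw [hE, dslope_of_ne _ hx, slope_def_field, hDx₀, sub_zero]
  have hEne : ∀ x ∈ closedStrip (-(1 / 6 * κ)) (-(-(1 / 6) * κ)), E x ≠ 0 := by
    intro x hx
    rcases eq_or_ne x x₀ with rfl | hne
    · rw [hEx₀]
      have : (Real.pi : ℂ) ≠ 0 := by exact_mod_cast Real.pi_ne_zero
      exact div_ne_zero (mul_ne_zero (mul_ne_zero two_ne_zero this) hz0) hk'
    · rw [hDE x hne]
      refine div_ne_zero ?_ (sub_ne_zero.2 hne)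
      intro h0
      obtain ⟨n, hn⟩ := exp_eq_one_iff.1 (sub_eq_zero.1 h0).symm
      have hph : polePhase k z w 0 x = n := by
        have h2 : (2 * Real.pi * I : ℂ) ≠ 0 := two_pi_I_ne_zero
        apply mul_left_cancel₀ h2
        rw [hn]; ring
      have hrc := realCoord_polePhase (k := k) (w := w) hz 0 x
      rw [hph, realCoord_intCast hz.ne', ← hκdef] at hrc
      have hb1 : -(1 / 6) ≤ x.im / κ := by rw [le_div_iff₀ hκ]; linarith [hx.1]
      have hb2 : x.im / κ ≤ 1 / 6 := by rw [div_le_iff₀ hκ]; linarith [hx.2]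
      have hnk : (n : ℝ) * k = k * realCoord z w - x.im / κ := by
        rw [hrc]; field_simp; push_cast; ring
      have hn0 : n = 0 := by
        by_contra hne0
        have h1 : (1 : ℝ) ≤ |(n : ℝ)| := by exact_mod_cast Int.one_le_abs hne0
        have h2 : |(n : ℝ) * k| < 1 := by rw [hnk, abs_lt]; constructor <;> linarith
        rw [abs_mul, abs_of_pos (by linarith : (0 : ℝ) < k)] at h2
        nlinarith
      apply hne
      rw [hn0] at hph
      unfold polePhase at hph
      push_cast at hph
      field_simp at hph
      rw [hx₀]
      field_simp
      linear_combination (-I) * hph + (z * x) * I_sq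
  obtain ⟨C, T, hb⟩ := exists_poissonTerm_tail hk hz h' r 0 w (1 / 6 * κ)
  have hquot : ∀ x, x ≠ x₀ → poissonNumer h' k z r 0 x / E x / (x - x₀) =
      poissonTerm h' k z w r 0 x := by
    intro x hx
    rw [hDE x hx, poissonTerm, div_div, div_mul_cancel₀ _ (sub_ne_zero.2 hx)]
  have key := integral_line_sub_integral_line (φ := fun x => poissonNumer h' k z r 0 x / E x)
    (c₁ := -(1 / 6 * κ)) (c₂ := -(-(1 / 6) * κ)) (x₀ := x₀)
    (by rw [hx₀im]; nlinarith) (by rw [hx₀im]; nlinarith)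
    ((differentiable_poissonNumer r 0).differentiableOn.div hEdiff.differentiableOn hEne)
    (C := max C 0) (T := T) (gaussian_rate_pos hk hz) (by
      intro x hx hT
      rcases eq_or_ne x x₀ with rfl | hne
      · simp only [sub_self, div_zero, norm_zero]
        positivity
      · rw [hquot x hne]
        refine (hb x (abs_le.2 ⟨hx.1, ?_⟩) hT).trans ?_
        · linarith [hx.2]
        · gcongr; exact le_max_left _ _)
  rw [lineInt_eq, lineInt_eq]
  have hline : ∀ c : ℝ, c ≠ x₀.im → ∀ t : ℝ, poissonNumer h' k z r 0 (t + c * I) / E (t + c * I) /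
      (t + c * I - x₀) = poissonTerm h' k z w r 0 (t + c * I) := by
    intro c hc t
    refine hquot _ fun h0 => hc ?_
    rw [← h0]; simp
  rw [← hκdef]
  simp only [hline (-(1 / 6 * κ)) (by rw [hx₀im]; nlinarith),
    hline (-(-(1 / 6) * κ)) (by rw [hx₀im]; nlinarith)] at key
  rw [key, hEx₀, poissonNumer, ← exp_int_mul, hx₀]
  have hpi : (Real.pi : ℂ) ≠ 0 := by exact_mod_cast Real.pi_ne_zero
  have e1 : (-1 : ℂ) ^ (0 : ℤ) * cexp (-(Real.pi * I * h' / k * (3 * ((0 : ℤ) : ℂ) ^ 2 +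
      (2 * r + 1) * ((0 : ℤ) : ℂ)))) = 1 := by simp
  rw [e1, one_mul, mul_assoc (I * k / z), ← exp_add]
  have e2 : -(3 * Real.pi * z / k) * (I * k * w / z) ^ 2 +
      (-(Real.pi * I * (2 * r + 1) / k) - Real.pi * z / k) * (I * k * w / z) +
      Real.pi * I * ((0 : ℤ) : ℂ) / k = 3 * Real.pi * k * w ^ 2 / z - Real.pi * I * w +
        Real.pi * w / z + r * (2 * Real.pi * w / z) := by
    push_cast
    field_simp
    ring_nf
    simp only [I_sq]
    ring
  rw [e2]
  field_simp

/-- On the line with parameter `a` the integrals decay geometrically for `r → ∞` if `a > 0`, and for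
`r → -∞` if `a < 0`. -/
lemma norm_lineInt_le (r μ : ℤ) (a : ℝ) : ‖lineInt h' k z w r μ a‖ ≤
    Real.exp (-(2 * Real.pi * a * (z⁻¹).re / k)) ^ r *
      ∫ t : ℝ, ‖poissonTerm h' k z w 0 μ (t - I * a / z)‖ := by
  unfold lineInt
  refine (norm_integral_le_integral_norm _).trans (le_of_eq ?_)
  rw [← integral_const_mul]
  congr 1
  ext t
  rw [poissonTerm_index, norm_mul, norm_exp, ← Real.rpow_intCast, ← Real.exp_mul]
  congr 2
  rw [neg_re, div_natCast_re]
  have : (2 * Real.pi * I * r * (h' * μ + ((t : ℂ) - I * a / z)) : ℂ) =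
      ((2 * Real.pi * r : ℝ) : ℂ) * (I * (((h' * μ + t : ℝ) : ℂ) - I * a / z)) := by
    push_cast; ring
  rw [this, re_ofReal_mul, I_mul_re, line_im]
  ring

end Strip

/-! ### Pentagonal numbers and the recurrence in the Fourier index -/

/-- The term `(-1)^N q^{N(3N+1)/2}` of the pentagonal number series. -/
noncomputable def pentTerm (q : ℂ) (N : ℕ) : ℂ := (-1) ^ N * q ^ (N * (3 * N + 1) / 2)

lemma pent_exponent_succ (N : ℕ) :
    (N + 1) * (3 * (N + 1) + 1) / 2 = N * (3 * N + 1) / 2 + (3 * N + 2) := by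
  rw [show (N + 1) * (3 * (N + 1) + 1) = N * (3 * N + 1) + 2 * (3 * N + 2) by ring,
    Nat.add_mul_div_left _ _ two_pos]

lemma pentTerm_succ (q : ℂ) (N : ℕ) : pentTerm q (N + 1) = -q ^ (3 * N + 2) * pentTerm q N := by
  unfold pentTerm
  rw [pent_exponent_succ, pow_add, pow_succ]
  ring

lemma le_pent_exponent (N : ℕ) : N ≤ N * (3 * N + 1) / 2 := by
  induction N with
  | zero => simp
  | succ n ih => rw [pent_exponent_succ]; omega

lemma norm_pentTerm_le {q : ℂ} (hq : ‖q‖ < 1) (N : ℕ) : ‖pentTerm q N‖ ≤ ‖q‖ ^ N := by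
  unfold pentTerm
  rw [norm_mul, norm_pow, norm_neg, norm_one, one_pow, one_mul, norm_pow]
  exact pow_le_pow_of_le_one (norm_nonneg _) hq.le (le_pent_exponent N)

lemma norm_prod_one_sub_pow_le {q : ℂ} (hq : ‖q‖ < 1) (k n : ℕ) :
    ‖∏ i ∈ Finset.range n, (1 - q ^ (k + i + 1))‖ ≤ Real.exp (1 - ‖q‖)⁻¹ := by
  rw [norm_prod]
  calc ∏ i ∈ Finset.range n, ‖1 - q ^ (k + i + 1)‖
      ≤ ∏ i ∈ Finset.range n, Real.exp (‖q‖ ^ i) := by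
        refine Finset.prod_le_prod (fun _ _ => norm_nonneg _) fun i _ => ?_
        refine (norm_sub_le _ _).trans ?_
        rw [norm_one, norm_pow]
        have h1 : ‖q‖ ^ (k + i + 1) ≤ ‖q‖ ^ i :=
          pow_le_pow_of_le_one (norm_nonneg _) hq.le (by omega)
        linarith [Real.add_one_le_exp (‖q‖ ^ i)]
    _ = Real.exp (∑ i ∈ Finset.range n, ‖q‖ ^ i) := (Real.exp_sum _ _).symm
    _ ≤ Real.exp (1 - ‖q‖)⁻¹ := by
        rw [Real.exp_le_exp, ← tsum_geometric_of_lt_one (norm_nonneg _) hq]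
        exact (summable_geometric_of_lt_one (norm_nonneg _) hq).sum_le_tsum _
          fun _ _ => by positivity

/-- Euler's pentagonal number theorem for `‖q‖ < 1`. -/
theorem hasSum_pentagonal {q : ℂ} (hq : ‖q‖ < 1) :
    HasSum (fun N : ℕ => pentTerm q N * (1 - q ^ (2 * N + 1))) (eulerProd q) := by
  have h0 := norm_nonneg q
  have hgeo := summable_geometric_of_lt_one h0 hq
  set B := Real.exp (1 - ‖q‖)⁻¹ with hB
  have hterm : ∀ N : ℕ, (-1 : ℂ) ^ N * (q ^ pentagonal (-(N : ℤ)) - q ^ pentagonal ((N : ℤ) + 1)) =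
      pentTerm q N * (1 - q ^ (2 * N + 1)) := by
    intro N
    have e1 : pentagonal (-(N : ℤ)) = N * (3 * N + 1) / 2 := by
      have := two_mul_natCast_pentagonal_neg (N : ℤ)
      have h2 : 2 * pentagonal (-(N : ℤ)) = N * (3 * N + 1) := by exact_mod_cast this
      omega
    have e2 : pentagonal ((N : ℤ) + 1) = N * (3 * N + 1) / 2 + (2 * N + 1) := by
      have := two_mul_natCast_pentagonal ((N : ℤ) + 1)
      have h2 : 2 * (pentagonal ((N : ℤ) + 1) : ℤ) =
          N * (3 * N + 1) + 2 * (2 * N + 1) := by rw [this]; ring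
      have h3 : 2 * pentagonal ((N : ℤ) + 1) = N * (3 * N + 1) + 2 * (2 * N + 1) := by
        exact_mod_cast h2
      omega
    rw [e1, e2, pentTerm, pow_add]
    ring
  have hsum : Summable fun N : ℕ => pentTerm q N * (1 - q ^ (2 * N + 1)) := by
    refine Summable.of_norm_bounded (hgeo.mul_right 2) fun N => ?_
    rw [norm_mul]
    refine mul_le_mul (norm_pentTerm_le hq N) ?_ (norm_nonneg _) (by positivity)
    refine (norm_sub_le _ _).trans ?_
    rw [norm_one, norm_pow]
    linarith [pow_le_one₀ (n := 2 * N + 1) h0 hq.le]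
  have hbd : ∀ k n : ℕ, ‖q ^ ((k + 1) * n) * ∏ i ∈ Finset.range (n + 1), (1 - q ^ (k + i + 1))‖ ≤
      ‖q‖ ^ n * B := by
    intro k n
    rw [norm_mul, norm_pow]
    refine mul_le_mul (pow_le_pow_of_le_one h0 hq.le (by nlinarith)) (norm_prod_one_sub_pow_le hq _ _)
      (norm_nonneg _) (by positivity)
  have hmain := Pentagonal.tprod_one_sub_pow (x := q) ?_ ?_ ?_ ?_ ?_
  · unfold eulerProd
    rw [hmain]
    simp_rw [hterm]
    exact hsum.hasSum
  · exact tendsto_pow_atTop_nhds_zero_of_norm_lt_one hq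
  · exact fun k => Summable.of_norm_bounded (hgeo.mul_right B) (hbd k)
  · intro k
    have : Multipliable fun n : ℕ => 1 + -q ^ (n + k + 1) := by
      refine multipliable_one_add_of_summable ?_
      simp_rw [norm_neg, norm_pow, add_assoc]
      exact (summable_nat_add_iff (k + 1)).2 hgeo
    simpa [sub_eq_add_neg] using this
  · simp_rw [hterm]; exact hsum
  · have hlim : Tendsto (fun k : ℕ => ‖q‖ ^ (k + 1) * ∑' n : ℕ, ‖q‖ ^ n * B) atTop (𝓝 0) := by
      have := ((tendsto_pow_atTop_nhds_zero_of_lt_one h0 hq).comp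
        (tendsto_add_atTop_nat 1)).mul_const (∑' n : ℕ, ‖q‖ ^ n * B)
      simpa using this
    refine squeeze_zero_norm (fun k => ?_) hlim
    rw [norm_mul, norm_mul, norm_pow, norm_neg, norm_one, one_pow, one_mul, norm_pow]
    refine mul_le_mul (pow_le_pow_of_le_one h0 hq.le ?_) ?_ (norm_nonneg _) (by positivity)
    · rw [Nat.le_div_iff_mul_le two_pos]; nlinarith
    · exact tsum_of_norm_bounded (hgeo.mul_right B).hasSum (hbd k)

lemma gap_le_norm_one_sub {q X : ℂ} (hq : ‖q‖ < 1) (N : ℕ) :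
    1 - ‖q * X‖ ≤ ‖1 - X * q ^ (N + 1)‖ := by
  have h1 : ‖X * q ^ (N + 1)‖ ≤ ‖q * X‖ := by
    rw [pow_succ, show X * (q ^ N * q) = q ^ N * (q * X) by ring, norm_mul (q ^ N), norm_pow]
    exact mul_le_of_le_one_left (norm_nonneg _) (pow_le_one₀ (norm_nonneg _) hq.le)
  have h2 := norm_sub_norm_le (1 : ℂ) (X * q ^ (N + 1))
  rw [norm_one] at h2
  linarith

lemma summable_pentTerm_div {q X : ℂ} (hq : ‖q‖ < 1) (hX : ‖q * X‖ < 1) :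
    Summable fun N : ℕ => pentTerm q (N + 1) / (1 - X * q ^ (N + 1)) := by
  have hgeo := summable_geometric_of_lt_one (norm_nonneg q) hq
  refine Summable.of_norm_bounded
    (((summable_nat_add_iff 1).2 hgeo).mul_right (1 - ‖q * X‖)⁻¹) fun N => ?_
  rw [norm_div, div_eq_mul_inv]
  refine mul_le_mul (norm_pentTerm_le hq _) ?_ (by positivity) (by positivity)
  exact inv_anti₀ (by linarith) (gap_le_norm_one_sub hq N)

/-- Summation of a sequence with `u (s + 3) = -q^(s+2) (u s - ρ X^s)`. Put
`T N = θ_N ∑ₛ q^(sN) u s` with `θ_N` the pentagonal terms. Splitting off the first three terms and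
applying the recurrence to the others expresses `T N` by `T (N + 1)` and a geometric series, and
`T N → 0`. -/
theorem hasSum_of_recurrence {q X ρ : ℂ} {u : ℕ → ℂ} (hq : ‖q‖ < 1) (hX : ‖q * X‖ < 1)
    (hu : Summable u) (hrec : ∀ s, u (s + 3) = -q ^ (s + 2) * (u s - ρ * X ^ s)) :
    HasSum (fun N : ℕ => pentTerm q N * (u 0 + q ^ N * u 1 + q ^ (2 * N) * u 2) -
      ρ * (pentTerm q (N + 1) / (1 - X * q ^ (N + 1)))) (∑' s, u s) := by
  have h0 := norm_nonneg q
  have hgeo := summable_geometric_of_lt_one h0 hq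
  have hun : Summable fun s => ‖u s‖ := hu.norm
  have hle : ∀ N s : ℕ, ‖q ^ (s * N) * u s‖ ≤ ‖u s‖ := by
    intro N s
    rw [norm_mul, norm_pow]
    exact mul_le_of_le_one_left (norm_nonneg _) (pow_le_one₀ h0 hq.le)
  have hsN : ∀ N : ℕ, Summable fun s : ℕ => q ^ (s * N) * u s := fun N =>
    Summable.of_norm_bounded hun (hle N)
  set T : ℕ → ℂ := fun N => pentTerm q N * ∑' s : ℕ, q ^ (s * N) * u s with hT
  have hT0 : T 0 = ∑' s, u s := by simp [hT, pentTerm]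
  have hTlim : Tendsto T atTop (𝓝 0) := by
    have hlim := (tendsto_pow_atTop_nhds_zero_of_lt_one h0 hq).mul_const (∑' s, ‖u s‖)
    rw [zero_mul] at hlim
    refine squeeze_zero_norm (fun N => ?_) hlim
    rw [hT, norm_mul]
    exact mul_le_mul (norm_pentTerm_le hq N) (tsum_of_norm_bounded hun.hasSum (hle N))
      (norm_nonneg _) (by positivity)
  have hstep : ∀ N : ℕ, T N = (pentTerm q N * (u 0 + q ^ N * u 1 + q ^ (2 * N) * u 2) -
      ρ * (pentTerm q (N + 1) / (1 - X * q ^ (N + 1)))) + T (N + 1) := by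
    intro N
    have hsplit := ((hsN N).sum_add_tsum_nat_add 3).symm
    have hXN : ‖X * q ^ (N + 1)‖ < 1 := by
      rw [pow_succ, show X * (q ^ N * q) = q ^ N * (q * X) by ring, norm_mul (q ^ N), norm_pow]
      exact (mul_le_of_le_one_left (norm_nonneg _) (pow_le_one₀ h0 hq.le)).trans_lt hX
    have hterm : ∀ s : ℕ, q ^ ((s + 3) * N) * u (s + 3) =
        -q ^ (3 * N + 2) * (q ^ (s * (N + 1)) * u s) +
          q ^ (3 * N + 2) * ρ * (X * q ^ (N + 1)) ^ s := by
      intro s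
      rw [hrec, mul_pow, ← pow_mul]
      ring
    have htail : ∑' s : ℕ, q ^ ((s + 3) * N) * u (s + 3) =
        -q ^ (3 * N + 2) * (∑' s : ℕ, q ^ (s * (N + 1)) * u s) +
          q ^ (3 * N + 2) * ρ * (1 - X * q ^ (N + 1))⁻¹ := by
      simp_rw [hterm]
      rw [Summable.tsum_add ((hsN (N + 1)).mul_left _)
        ((summable_geometric_of_norm_lt_one hXN).mul_left _), tsum_mul_left, tsum_mul_left,
        tsum_geometric_of_norm_lt_one hXN]
    simp only [hT]
    rw [hsplit, htail, pentTerm_succ]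
    simp only [Finset.sum_range_succ, Finset.sum_range_zero, zero_mul, pow_zero, one_mul, zero_add]
    ring
  have hsum : Summable fun N : ℕ => pentTerm q N * (u 0 + q ^ N * u 1 + q ^ (2 * N) * u 2) -
      ρ * (pentTerm q (N + 1) / (1 - X * q ^ (N + 1))) := by
    refine Summable.sub ?_ ((summable_pentTerm_div hq hX).mul_left ρ)
    refine Summable.of_norm_bounded (hgeo.mul_right (‖u 0‖ + ‖u 1‖ + ‖u 2‖)) fun N => ?_
    rw [norm_mul]
    refine mul_le_mul (norm_pentTerm_le hq N) ?_ (norm_nonneg _) (by positivity)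
    refine (norm_add₃_le).trans ?_
    have h1 := mul_le_of_le_one_left (norm_nonneg (u 1)) (pow_le_one₀ (n := N) h0 hq.le)
    have h2 := mul_le_of_le_one_left (norm_nonneg (u 2)) (pow_le_one₀ (n := 2 * N) h0 hq.le)
    rw [norm_mul, norm_mul, norm_pow, norm_pow]
    linarith
  rw [hsum.hasSum_iff_tendsto_nat]
  have hpartial : ∀ M : ℕ, ∑ N ∈ Finset.range M,
      (pentTerm q N * (u 0 + q ^ N * u 1 + q ^ (2 * N) * u 2) -
        ρ * (pentTerm q (N + 1) / (1 - X * q ^ (N + 1)))) = T 0 - T M := by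
    intro M
    induction M with
    | zero => simp
    | succ M ih => rw [Finset.sum_range_succ, ih, hstep M]; ring
  simp_rw [hpartial, ← hT0]
  simpa using tendsto_const_nhds.sub hTlim

/-! ### Convergence of the rank series -/

lemma natAbs_le_rank_exponent (n : ℤ) : (n.natAbs : ℤ) ≤ n * (3 * n + 1) / 2 := by
  rw [Int.le_ediv_iff_mul_le two_pos]
  rcases Int.natAbs_eq n with h | h <;> rcases Nat.eq_zero_or_pos n.natAbs with h0 | h0
  · rw [h, h0]; simp
  · have h1 : (1 : ℤ) ≤ n.natAbs := by exact_mod_cast h0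
    rw [h]; simp only [Int.natAbs_natCast]; nlinarith
  · rw [h, h0]; simp
  · have h1 : (1 : ℤ) ≤ n.natAbs := by exact_mod_cast h0
    rw [h]; simp only [Int.natAbs_neg, Int.natAbs_natCast]; nlinarith

/-- The denominators of the rank series stay away from zero, locally uniformly in `ζ`. -/
lemma exists_le_norm_one_sub_mul_zpow {q ζ₀ : ℂ} (hq0 : q ≠ 0) (hq : ‖q‖ < 1) (hζ₀ : ζ₀ ≠ 0)
    {S : Set ℤ} (hS : ∀ n ∈ S, 1 - ζ₀ * q ^ n ≠ 0) :
    ∃ c : ℝ, 0 < c ∧ ∀ᶠ ζ in 𝓝 ζ₀, ∀ n ∈ S, c ≤ ‖1 - ζ * q ^ n‖ := by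
  have hqn : 0 < ‖q‖ := norm_pos_iff.2 hq0
  have hζn : 0 < ‖ζ₀‖ := norm_pos_iff.2 hζ₀
  obtain ⟨N, hN⟩ : ∃ N : ℕ, ‖q‖ ^ N < min (1 / (4 * ‖ζ₀‖)) (‖ζ₀‖ / 4) :=
    exists_pow_lt_of_lt_one (by positivity) hq
  have hN1 := hN.le.trans (min_le_left _ _)
  have hN2 := hN.le.trans (min_le_right _ _)
  set F : Set ℤ := S ∩ Set.Icc (-(N : ℤ)) N with hF
  have hFfin : F.Finite := (Set.finite_Icc _ _).inter_of_right _
  obtain ⟨a, ha, hab⟩ := hFfin.isCompact.exists_forall_le' (f := fun n : ℤ => ‖1 - ζ₀ * q ^ n‖)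
    (continuous_of_discreteTopology.continuousOn) (a := 0) fun n hn => norm_pos_iff.2 (hS n hn.1)
  refine ⟨min (a / 2) (1 / 2), by positivity, ?_⟩
  have e1 : ∀ᶠ ζ in 𝓝 ζ₀, ∀ n ∈ F, a / 2 < ‖1 - ζ * q ^ n‖ := by
    rw [Filter.eventually_all_finite hFfin]
    intro n hn
    have hc : ContinuousAt (fun ζ : ℂ => ‖1 - ζ * q ^ n‖) ζ₀ := by fun_prop
    exact hc.eventually (lt_mem_nhds (by linarith [hab n hn]))
  have e2 : ∀ᶠ ζ : ℂ in 𝓝 ζ₀, ‖ζ‖ < 2 * ‖ζ₀‖ :=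
    continuous_norm.continuousAt.eventually (gt_mem_nhds (by linarith))
  have e3 : ∀ᶠ ζ : ℂ in 𝓝 ζ₀, ‖ζ₀‖ / 2 < ‖ζ‖ :=
    continuous_norm.continuousAt.eventually (lt_mem_nhds (by linarith))
  filter_upwards [e1, e2, e3] with ζ h1 h2 h3 n hn
  by_cases hmem : n ∈ Set.Icc (-(N : ℤ)) N
  · exact (min_le_left _ _).trans (h1 n ⟨hn, hmem⟩).le
  · refine (min_le_right _ _).trans ?_
    rw [Set.mem_Icc, not_and_or, not_le, not_le] at hmem
    rcases hmem with hlt | hgt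
    · have h4 : (‖q‖ ^ N)⁻¹ ≤ ‖q‖ ^ n := by
        rw [← zpow_natCast, ← zpow_neg]
        exact zpow_le_zpow_right_of_le_one₀ hqn hq.le hlt.le
      have h5 : 4 / ‖ζ₀‖ ≤ (‖q‖ ^ N)⁻¹ := by
        rw [← inv_div]
        exact inv_anti₀ (by positivity) hN2
      have h6 : 2 ≤ ‖ζ * q ^ n‖ := by
        rw [norm_mul, norm_zpow]
        calc (2 : ℝ) = ‖ζ₀‖ / 2 * (4 / ‖ζ₀‖) := by field_simp; norm_num
          _ ≤ ‖ζ‖ * ‖q‖ ^ n := by gcongr; exact h5.trans h4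
      have h7 := norm_sub_norm_le (ζ * q ^ n) (1 : ℂ)
      rw [norm_one, norm_sub_rev] at h7
      linarith
    · have h4 : ‖q‖ ^ n ≤ ‖q‖ ^ N := by
        rw [← zpow_natCast ‖q‖ N]
        exact zpow_le_zpow_right_of_le_one₀ hqn hq.le hgt.le
      have h6 : ‖ζ * q ^ n‖ ≤ 1 / 2 := by
        rw [norm_mul, norm_zpow]
        calc ‖ζ‖ * ‖q‖ ^ n ≤ (2 * ‖ζ₀‖) * (1 / (4 * ‖ζ₀‖)) := by gcongr; exact h4.trans hN1
          _ = 1 / 2 := by field_simp; norm_num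
      have h7 := norm_sub_norm_le (1 : ℂ) (ζ * q ^ n)
      rw [norm_one] at h7
      linarith

lemma norm_rankTerm_le {w q : ℂ} (hq0 : q ≠ 0) (hq : ‖q‖ < 1) {c : ℝ} (hc : 0 < c) (n : ℤ)
    (h : c ≤ ‖1 - cexp (2 * Real.pi * I * w) * q ^ n‖) :
    ‖rankTerm w q n‖ ≤ ‖q‖ ^ n.natAbs * c⁻¹ := by
  rw [rankTerm, norm_div, norm_mul, norm_zpow, norm_neg, norm_one, one_zpow, one_mul, norm_zpow,
    div_eq_mul_inv]
  refine mul_le_mul ?_ (inv_anti₀ hc h) (by positivity) (by positivity)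
  rw [← zpow_natCast]
  exact zpow_le_zpow_right_of_le_one₀ (norm_pos_iff.2 hq0) hq.le (natAbs_le_rank_exponent n)

lemma summable_pow_natAbs {x : ℝ} (h0 : 0 ≤ x) (h1 : x < 1) :
    Summable fun n : ℤ => x ^ n.natAbs := by
  have hgeo := summable_geometric_of_lt_one h0 h1
  exact Summable.of_nat_of_neg (by simpa using hgeo) (by simpa using hgeo)

lemma summable_rankTerm {w q : ℂ} (hq0 : q ≠ 0) (hq : ‖q‖ < 1) {S : Set ℤ}
    (hS : ∀ n ∈ S, 1 - cexp (2 * Real.pi * I * w) * q ^ n ≠ 0) :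
    Summable fun n : S => rankTerm w q n := by
  obtain ⟨c, hc, hev⟩ := exists_le_norm_one_sub_mul_zpow hq0 hq (exp_ne_zero _) hS
  exact Summable.of_norm_bounded
    (((summable_pow_natAbs (norm_nonneg _) hq).mul_right c⁻¹).comp_injective
      Subtype.val_injective) fun n => norm_rankTerm_le hq0 hq hc n (hev.self_of_nhds n n.2)

lemma continuousAt_tsum_rankTerm {w₀ q : ℂ} (hq0 : q ≠ 0) (hq : ‖q‖ < 1) {S : Set ℤ}
    (hS : ∀ n ∈ S, 1 - cexp (2 * Real.pi * I * w₀) * q ^ n ≠ 0) :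
    ContinuousAt (fun w => ∑' n : S, rankTerm w q n) w₀ := by
  obtain ⟨c, hc, hev⟩ := exists_le_norm_one_sub_mul_zpow hq0 hq (exp_ne_zero _) hS
  have hcexp : ContinuousAt (fun w : ℂ => cexp (2 * Real.pi * I * w)) w₀ := by fun_prop
  refine tendsto_tsum_of_dominated_convergence (bound := fun n : S => ‖q‖ ^ (n : ℤ).natAbs * c⁻¹)
    (((summable_pow_natAbs (norm_nonneg _) hq).mul_right c⁻¹).comp_injective
      Subtype.val_injective) (fun n => ?_) ?_
  · unfold rankTerm
    refine ContinuousAt.div (by fun_prop) (by fun_prop) (hS n n.2)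
  · filter_upwards [hcexp.eventually hev] with w hw n
    exact norm_rankTerm_le hq0 hq hc n (hw n n.2)

/-- The rank series regrouped by `|n|`, in terms of pentagonal terms. -/
lemma rankTerm_add_rankTerm_neg {w q : ℂ} (hq0 : q ≠ 0) (N : ℕ)
    (h : 1 - (cexp (2 * Real.pi * I * w))⁻¹ * q ^ (N + 1) ≠ 0) :
    rankTerm w q (N + 1 : ℕ) + rankTerm w q (-((N : ℤ) + 1)) =
      pentTerm q (N + 1) / (1 - cexp (2 * Real.pi * I * w) * q ^ (N + 1)) -
      (cexp (2 * Real.pi * I * w))⁻¹ *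
        (pentTerm q (N + 1) / (1 - (cexp (2 * Real.pi * I * w))⁻¹ * q ^ (N + 1))) := by
  have hζ : cexp (2 * Real.pi * I * w) ≠ 0 := exp_ne_zero _
  set ζ := cexp (2 * Real.pi * I * w)
  have e1 : ((N + 1 : ℕ) : ℤ) * (3 * ((N + 1 : ℕ) : ℤ) + 1) / 2 =
      (((N + 1) * (3 * (N + 1) + 1) / 2 : ℕ) : ℤ) := by push_cast; rfl
  have e2 : -((N : ℤ) + 1) * (3 * (-((N : ℤ) + 1)) + 1) / 2 + ((N : ℤ) + 1) =
      (((N + 1) * (3 * (N + 1) + 1) / 2 : ℕ) : ℤ) := by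
    push_cast
    rw [← Int.add_mul_ediv_left _ _ (two_ne_zero)]
    congr 1; ring
  have e3 : q ^ (-((N : ℤ) + 1) * (3 * (-((N : ℤ) + 1)) + 1) / 2) * q ^ (N + 1) =
      q ^ ((N + 1) * (3 * (N + 1) + 1) / 2) := by
    rw [← zpow_natCast q ((N + 1) * (3 * (N + 1) + 1) / 2), ← e2, zpow_add₀ hq0]
    congr 1
  have hm : (-1 : ℂ) ^ (-((N : ℤ) + 1)) = (-1) ^ (N + 1) := by
    rw [zpow_neg, ← inv_zpow]
    norm_num
    exact_mod_cast rfl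
  have hqN : q ^ (N + 1) ≠ 0 := pow_ne_zero _ hq0
  have hqz : q ^ (-((N : ℤ) + 1)) = (q ^ (N + 1))⁻¹ := by
    rw [zpow_neg]; exact_mod_cast rfl
  have hne : 1 - ζ * (q ^ (N + 1))⁻¹ ≠ 0 := by
    intro h0
    apply h
    have : q ^ (N + 1) = ζ := by
      field_simp at h0
      linear_combination h0
    rw [this, inv_mul_cancel₀ hζ, sub_self]
  have key : (-1) ^ (N + 1) * q ^ (-((N : ℤ) + 1) * (3 * (-((N : ℤ) + 1)) + 1) / 2) /
      (1 - ζ * (q ^ (N + 1))⁻¹) =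
      -(ζ⁻¹ * (pentTerm q (N + 1) / (1 - ζ⁻¹ * q ^ (N + 1)))) := by
    unfold pentTerm
    rw [← e3]
    have h2 : ζ - q ^ (N + 1) ≠ 0 := by
      intro h0; apply h
      rw [← sub_eq_zero.1 h0, inv_mul_cancel₀ hζ, sub_self]
    have h3 : q ^ (N + 1) - ζ ≠ 0 := by
      intro h0; apply h2; linear_combination -h0
    generalize q ^ (-((N : ℤ) + 1) * (3 * (-((N : ℤ) + 1)) + 1) / 2) = y
    generalize q ^ (N + 1) = p at *
    clear_value ζ
    field_simp
    ring
  rw [rankTerm, rankTerm, e1, zpow_natCast, zpow_natCast, zpow_natCast, hm, hqz, key, pentTerm]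
  rfl

/-! ### Poisson summation of the rank series -/

open FourierTransform in
/-- Poisson summation over the progression `-h'μ + kℤ`. -/
lemma tsum_poissonTerm {h' : ℤ} {k : ℕ} {z w : ℂ} (hk : 0 < k) (hz : 0 < z.re) (μ : ℤ)
    (hμ : ∀ m : ℤ, realCoord z w + (μ : ℝ) / k ≠ m)
    (hsum : Summable fun r : ℤ => lineInt h' k z w r μ 0) :
    ∑' m : ℤ, poissonTerm h' k z w 0 μ ((-h' * μ + k * m : ℤ) : ℂ) =
      1 / k * ∑' r : ℤ, lineInt h' k z w r μ 0 := by
  have hkR : (0 : ℝ) < k := by exact_mod_cast hk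
  have hkC : (k : ℂ) ≠ 0 := by exact_mod_cast hk.ne'
  set g : ℝ → ℂ := fun t => poissonTerm h' k z w 0 μ t with hg
  have hgcont : Continuous g := by
    have := continuous_poissonTerm_line (h' := h') (k := k) (z := z) (w := w) hz 0 μ (c := 0)
      (by simpa using hμ)
    simpa using this
  have hcont : Continuous fun t : ℝ => g (k * t) := hgcont.comp (by fun_prop)
  have hF : ∀ r : ℤ, 𝓕 (fun t : ℝ => g (k * t)) (r : ℝ) =
      1 / k * (lineInt h' k z w r μ 0 * cexp (2 * Real.pi * I * r * (h' * μ) / k)) := by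
    intro r
    rw [Real.fourier_real_eq_integral_exp_smul]
    have e1 : ∀ v : ℝ, cexp (((-2 * Real.pi * v * (r : ℝ) : ℝ) : ℂ) * I) • g (k * v) =
        (fun t : ℝ => poissonTerm h' k z w r μ t * cexp (2 * Real.pi * I * r * (h' * μ) / k))
          (k * v) := by
      intro v
      simp only [hg, smul_eq_mul]
      have e0 : cexp (((-2 * Real.pi * v * (r : ℝ) : ℝ) : ℂ) * I) =
          cexp (-(2 * Real.pi * I * r * (h' * μ + ((k * v : ℝ) : ℂ)) / k)) *
            cexp (2 * Real.pi * I * r * (h' * μ) / k) := by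
        rw [← exp_add]
        congr 1
        push_cast
        field_simp
        ring
      rw [poissonTerm_index h' k z w r, e0]
      ring
    rw [integral_congr_ae (ae_of_all _ e1), Measure.integral_comp_mul_left (fun t : ℝ =>
      poissonTerm h' k z w r μ t * cexp (2 * Real.pi * I * r * (h' * μ) / k)),
      integral_mul_const, abs_of_pos (by positivity), lineInt]
    simp
  have hO : (fun t : ℝ => g (k * t)) =O[cocompact ℝ] fun x : ℝ => |x| ^ (-2 : ℝ) := by
    obtain ⟨C, T, hb⟩ := exists_poissonTerm_tail hk hz h' 0 μ w 0
    have hα := gaussian_rate_pos hk hz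
    set α := 3 * Real.pi * z.re / k / 2
    have h1 : (fun t : ℝ => g (k * t)) =O[cocompact ℝ]
        fun x : ℝ => Real.exp (-(α * k ^ 2) * x ^ 2) := by
      refine Asymptotics.IsBigO.of_bound C ?_
      filter_upwards [(tendsto_norm_cocompact_atTop (E := ℝ)).eventually_ge_atTop (T / k)] with t ht
      rw [Real.norm_of_nonneg (Real.exp_pos _).le]
      have := hb ((k * t : ℝ) : ℂ) (by simp) (by
        rw [ofReal_re, abs_mul, abs_of_pos hkR]
        rw [div_le_iff₀ hkR, Real.norm_eq_abs] at ht
        linarith)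
      rw [ofReal_re] at this
      rw [show -(α * k ^ 2) * t ^ 2 = -α * (k * t) ^ 2 by ring]
      exact this
    refine h1.trans ?_
    have h2 : (fun x : ℝ => Real.exp (-(α * k ^ 2) * x ^ 2)) =o[cocompact ℝ]
        fun x : ℝ => |x| ^ (-2 : ℝ) := by
      have := cexp_neg_quadratic_isLittleO_abs_rpow_cocompact (a := (-(α * k ^ 2) : ℝ))
        (by rw [ofReal_re]; have : 0 < α * k ^ 2 := by positivity
            linarith) 0 (-2)
      refine this.norm_left.congr_left fun x => ?_
      rw [norm_exp]
      congr 1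
      simp [← ofReal_pow]
    exact h2.isBigO
  have hS : Summable fun r : ℤ => 𝓕 (fun t : ℝ => g (k * t)) (r : ℝ) := by
    simp_rw [hF]
    refine Summable.mul_left _ (Summable.of_norm (hsum.norm.congr fun r => ?_))
    rw [norm_mul, norm_exp]
    have : (2 * Real.pi * I * r * (h' * μ) / k : ℂ).re = 0 := by
      rw [show (2 * Real.pi * I * r * (h' * μ) / k : ℂ) =
        ((2 * Real.pi * r * (h' * μ) / k : ℝ) : ℂ) * I by push_cast; ring]
      simp
    rw [this, Real.exp_zero, mul_one]
  have key := Real.tsum_eq_tsum_fourier_of_rpow_decay_of_summable hcont one_lt_two hO hS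
    (-(h' * μ) / k)
  have e2 : ∀ m : ℤ, g (k * ((-(h' * μ) / k : ℝ) + m)) =
      poissonTerm h' k z w 0 μ ((-h' * μ + k * m : ℤ) : ℂ) := by
    intro m
    simp only [hg]
    congr 1
    push_cast
    field_simp
  have e3 : ∀ r : ℤ, 𝓕 (fun t : ℝ => g (k * t)) (r : ℝ) *
      fourier r ((-(h' * μ) / k : ℝ) : UnitAddCircle) = 1 / k * lineInt h' k z w r μ 0 := by
    intro r
    rw [hF, fourier_coe_apply, mul_assoc, mul_assoc, ← exp_add]
    have : (2 * Real.pi * I * r * (h' * μ) / k : ℂ) +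
        2 * Real.pi * I * r * ((-(h' * μ) / k : ℝ) : ℂ) / ((1 : ℝ) : ℂ) = 0 := by
      push_cast; field_simp; ring
    rw [this, exp_zero, mul_one]
  simp_rw [e2] at key
  rw [key, ← tsum_mul_left]
  exact tsum_congr e3

/-- Arithmetic of the multiplier: along `n = -h'μ + km` the root of unity in the rank series
becomes `(-1)^m` times a factor depending on `μ` only. -/
lemma rankTerm_eq_poissonTerm {h h' b : ℤ} {k : ℕ} (hk : 0 < k) (hb : h * h' = -1 + k * b)
    (hbk : Even (b + k)) (hpar : Odd (h' + k)) (z w : ℂ) (μ m : ℤ) :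
    rankTerm w (nome k h z) (-h' * μ + k * m) =
      poissonTerm h' k z w 0 μ ((-h' * μ + k * m : ℤ) : ℂ) := by
  have hk' : (k : ℂ) ≠ 0 := by exact_mod_cast hk.ne'
  obtain ⟨n, hn⟩ : ∃ n : ℤ, n = -h' * μ + k * m := ⟨_, rfl⟩
  obtain ⟨e, he⟩ : ∃ e : ℤ, e = h * m - b * μ := ⟨_, rfl⟩
  have hhn : h * n = μ + k * e := by rw [hn, he]; linear_combination (-μ) * hb
  rw [← hn]
  have heven : Even (n - μ + 3 * μ * m + e * (3 * n + 1) + m) := by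
    have h1 : Even (h * h') ↔ Even (-1 + k * b) := by rw [hb]
    have h3 : ¬ Even (3 : ℤ) := by decide
    rw [← Int.not_even_iff_odd] at hpar
    rw [hn, he]
    simp only [Int.even_add, Int.even_mul, Int.even_sub, even_neg, Int.not_even_one, h3]
      at h1 hbk hpar ⊢
    clear hn he hhn hb h3
    by_cases p1 : Even h <;> by_cases p2 : Even h' <;> by_cases p3 : Even b <;>
      by_cases p4 : Even (k : ℤ) <;> by_cases p5 : Even μ <;> by_cases p6 : Even m <;>
      simp only [p1, p2, p3, p4, p5, p6] at h1 hbk hpar ⊢ <;> simp at h1 hbk hpar ⊢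
  obtain ⟨j, hj⟩ := heven
  have hnC : (n : ℂ) = -h' * μ + k * m := by exact_mod_cast hn
  have hhnC : (h : ℂ) * n = μ + k * e := by exact_mod_cast hhn
  have hjC : (n : ℂ) - μ + 3 * μ * m + e * (3 * n + 1) + m = j + j := by exact_mod_cast hj
  obtain ⟨p, hp⟩ : ∃ p : ℤ, p = n * (3 * n + 1) / 2 := ⟨_, rfl⟩
  have hpC : (2 : ℂ) * p = n * (3 * n + 1) := by
    have : 2 * p = n * (3 * n + 1) := by
      rw [hp]
      refine Int.mul_ediv_cancel' ?_
      rcases Int.even_or_odd n with ⟨a, ha⟩ | ⟨a, ha⟩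
      · exact ⟨a * (3 * n + 1), by rw [ha]; ring⟩
      · exact ⟨n * (3 * a + 2), by rw [ha]; ring⟩
    exact_mod_cast this
  unfold rankTerm poissonTerm poissonNumer nome
  rw [← hp, neg_one_zpow_eq_cexp, neg_one_zpow_eq_cexp, ← exp_int_mul, ← exp_int_mul, ← exp_add,
    ← exp_add, ← exp_add, ← exp_add]
  congr 1
  · apply cexp_eq_of_eq_add j
    have e1 : (p : ℂ) * (2 * Real.pi * I / k * (h + I * z)) =
        Real.pi * I / k * (h + I * z) * (n * (3 * n + 1)) := by rw [← hpC]; ring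
    rw [e1]
    push_cast
    field_simp
    linear_combination (I * k) * hjC + (3 * n + 1) * I * hhnC + 3 * μ * I * hnC + I * hnC +
      (z * n * (3 * n + 1)) * I_sq
  · congr 1
    apply cexp_eq_of_eq_add e
    unfold polePhase
    field_simp
    linear_combination hhnC

/-- Splitting a series over `ℤ` into residue classes modulo `k`, with representatives `-h'μ`. -/
lemma tsum_int_eq_sum_tsum {f : ℤ → ℂ} (hf : Summable f) {k : ℕ} (hk : 0 < k) {h' : ℤ}
    (hcop : IsCoprime h' (k : ℤ)) :
    ∑' n : ℤ, f n = ∑ μ ∈ Finset.range k, ∑' m : ℤ, f (-h' * μ + k * m) := by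
  have : NeZero k := ⟨hk.ne'⟩
  have hper : Function.Periodic (fun ν : ℤ => ∑' m : ℤ, f (ν + k * m)) (k : ℤ) := by
    intro ν
    simp only
    rw [← (Equiv.addRight (1 : ℤ)).tsum_eq (fun m : ℤ => f (ν + k * m))]
    refine tsum_congr fun m => ?_
    simp only [Equiv.coe_addRight]
    congr 1; ring
  have h1 := sum_range_comp_affine hk hper (h := -h') hcop.neg_left 0
  simp only [add_zero] at h1
  rw [h1]
  have h2 : Summable fun p : ℤ × Fin k => f ((Int.divModEquiv k).symm p) :=
    (Equiv.summable_iff _).2 hf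
  have h3 : Summable fun p : Fin k × ℤ => f ((Int.divModEquiv k).symm (p.2, p.1)) :=
    (Equiv.prodComm (Fin k) ℤ).summable_iff.2 h2
  have h4 : ∑' p : ℤ × Fin k, f ((Int.divModEquiv k).symm p) =
      ∑' p : Fin k × ℤ, f ((Int.divModEquiv k).symm (p.2, p.1)) :=
    ((Equiv.prodComm (Fin k) ℤ).tsum_eq fun p => f ((Int.divModEquiv k).symm p)).symm
  rw [← (Int.divModEquiv k).symm.tsum_eq f, h4, h3.tsum_prod, tsum_fintype,
    ← Fin.sum_univ_eq_sum_range (fun ν : ℕ => ∑' m : ℤ, f (ν + k * m))]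
  refine Finset.sum_congr rfl fun i _ => tsum_congr fun m => ?_
  simp [Int.divModEquiv]
  congr 1; ring

/-! ### The transformation of the full rank series off the line `izℝ` -/

/-- The sum of `lineInt` over the residue classes `μ` modulo `k`. -/
noncomputable def lineSum (h' : ℤ) (k : ℕ) (z w : ℂ) (r : ℤ) (a : ℝ) : ℂ :=
  ∑ μ ∈ Finset.range k, lineInt h' k z w r μ a

/-- The residue at the pole `x = ikw/z`, up to the factor `exp(2πw/z) ^ r`. -/
noncomputable def poleResidue (k : ℕ) (z w : ℂ) : ℂ :=
  I * k / z * cexp (3 * Real.pi * k * w ^ 2 / z - Real.pi * I * w + Real.pi * w / z)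

section Lines

variable {h' : ℤ} {k : ℕ} {z w : ℂ}

/-- A line contains no pole when `k · realCoord z w + c` is not an integer. -/
lemma realCoord_add_ne (hk : 0 < k) {c : ℝ} (h : ∀ n : ℤ, k * realCoord z w + c ≠ n) (μ m : ℤ) :
    realCoord z w + (μ + c) / k ≠ m := by
  have hkR : (k : ℝ) ≠ 0 := by positivity
  intro e
  apply h (k * m - μ)
  push_cast
  rw [← e]
  field_simp
  ring

lemma not_int_of_mem_Ioo {x : ℝ} {a : ℤ} (h1 : (a : ℝ) < x) (h2 : x < a + 1) (n : ℤ) : x ≠ n := by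
  rintro rfl
  have h3 : a < n := by exact_mod_cast h1
  have h4 : n < a + 1 := by exact_mod_cast h2
  omega

lemma abs_mul_realCoord_lt (hk : 0 < k) (hw : |realCoord z w| < 1 / (6 * k)) :
    |k * realCoord z w| < 1 / 6 := by
  have hkR : (0 : ℝ) < k := by exact_mod_cast hk
  rw [abs_mul, abs_of_pos hkR]
  rw [lt_div_iff₀ (by positivity)] at hw
  linarith

/-- The line `a = 1/6` carries no pole. -/
lemma sixth_line_ne (hk : 0 < k) (hw : |realCoord z w| < 1 / (6 * k)) (μ m : ℤ) :
    realCoord z w + (μ + (1 / 6 : ℝ)) / k ≠ m := by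
  obtain ⟨h1, h2⟩ := abs_lt.1 (abs_mul_realCoord_lt hk hw)
  exact realCoord_add_ne hk (not_int_of_mem_Ioo (a := 0) (by push_cast; linarith)
    (by push_cast; linarith)) μ m

/-- The line `a = -1/6` carries no pole. -/
lemma neg_sixth_line_ne (hk : 0 < k) (hw : |realCoord z w| < 1 / (6 * k)) (μ m : ℤ) :
    realCoord z w + (μ + (-(1 / 6) : ℝ)) / k ≠ m := by
  obtain ⟨h1, h2⟩ := abs_lt.1 (abs_mul_realCoord_lt hk hw)
  exact realCoord_add_ne hk (not_int_of_mem_Ioo (a := -1) (by push_cast; linarith)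
    (by push_cast; linarith)) μ m

lemma lineInt_add_period (hk : 0 < k) (hpar : Odd (h' + k)) (r : ℤ) (a : ℝ) :
    Function.Periodic (fun μ : ℤ => lineInt h' k z w r μ a) (k : ℤ) := by
  intro μ
  unfold lineInt
  simp_rw [poissonTerm_add_period hk hpar]

/-- Move the line from `a = 1/6` to `a = 5/6 = 1 - 1/6`, then use `poissonTerm_shift`. -/
lemma lineInt_shift (hk : 0 < k) (hz : 0 < z.re) (hw : |realCoord z w| < 1 / (6 * k)) (r μ : ℤ) :
    lineInt h' k z w r μ (1 / 6) =
      -nome k h' z⁻¹ ^ (r - 1) * lineInt h' k z w (r - 3) (μ + 1) (-(1 / 6)) := by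
  have hz0 : z ≠ 0 := by rintro rfl; simp at hz
  obtain ⟨h1, h2⟩ := abs_lt.1 (abs_mul_realCoord_lt hk hw)
  rw [lineInt_congr hk hz r μ (show (1 / 6 : ℝ) ≤ 5 / 6 by norm_num) fun c hc =>
    realCoord_add_ne hk (not_int_of_mem_Ioo (a := 0) (by push_cast; linarith [hc.1])
    (by push_cast; linarith [hc.2])) μ]
  unfold lineInt
  rw [← integral_const_mul]
  congr 1
  ext t
  rw [← poissonTerm_shift hk hz0]
  congr 1
  push_cast
  field_simp
  ring

lemma lineSum_shift (hk : 0 < k) (hz : 0 < z.re) (hpar : Odd (h' + k))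
    (hw : |realCoord z w| < 1 / (6 * k)) (r : ℤ) :
    lineSum h' k z w r (1 / 6) =
      -nome k h' z⁻¹ ^ (r - 1) * lineSum h' k z w (r - 3) (-(1 / 6)) := by
  have h1 := sum_range_comp_affine hk (lineInt_add_period (z := z) (w := w) hk hpar (r - 3)
    (-(1 / 6))) (h := 1) isCoprime_one_left 1
  unfold lineSum
  rw [← h1, Finset.mul_sum]
  refine Finset.sum_congr rfl fun μ _ => ?_
  rw [lineInt_shift hk hz hw, one_mul]

/-- Crossing from `a = 1/6` to `a = -1/6`, only the class `μ = 0` contributes a residue. -/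
lemma lineInt_sub (hk : 0 < k) (hz : 0 < z.re) (hw : |realCoord z w| < 1 / (6 * k)) (r : ℤ)
    {μ : ℕ} (hμ : μ < k) :
    lineInt h' k z w r μ (1 / 6) - lineInt h' k z w r μ (-(1 / 6)) =
      if μ = 0 then poleResidue k z w * cexp (2 * Real.pi * w / z) ^ r else 0 := by
  split_ifs with h0
  · rw [h0]
    exact lineInt_zero_sub hk hz hw r
  · obtain ⟨h1, h2⟩ := abs_lt.1 (abs_mul_realCoord_lt hk hw)
    have hkR : (0 : ℝ) < k := by exact_mod_cast hk
    have hμ1 : (1 : ℝ) ≤ μ := by exact_mod_cast Nat.one_le_iff_ne_zero.2 h0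
    have hμ2 : (μ : ℝ) + 1 ≤ k := by exact_mod_cast hμ
    rw [lineInt_congr hk hz r μ (show (-(1 / 6) : ℝ) ≤ 1 / 6 by norm_num), sub_self]
    intro c hc
    have e : realCoord z w + (((μ : ℤ) : ℝ) + c) / k = (k * realCoord z w + μ + c) / k := by
      push_cast; field_simp; ring
    rw [e]
    refine not_int_of_mem_Ioo (a := 0) ?_ ?_
    · push_cast
      exact div_pos (by linarith [hc.1]) hkR
    · push_cast
      rw [div_lt_iff₀ hkR]
      linarith [hc.2]

/-- The two lines differ by one residue, at `x = ikw/z`. -/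
lemma lineSum_sub (hk : 0 < k) (hz : 0 < z.re) (hw : |realCoord z w| < 1 / (6 * k)) (r : ℤ) :
    lineSum h' k z w r (1 / 6) - lineSum h' k z w r (-(1 / 6)) =
      poleResidue k z w * cexp (2 * Real.pi * w / z) ^ r := by
  unfold lineSum
  rw [← Finset.sum_sub_distrib,
    Finset.sum_congr rfl fun μ hμ => lineInt_sub hk hz hw r (Finset.mem_range.1 hμ),
    Finset.sum_ite_eq' _ 0 (fun _ => poleResidue k z w * cexp (2 * Real.pi * w / z) ^ r),
    if_pos (Finset.mem_range.2 hk)]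

lemma decay_base_lt_one (hk : 0 < k) (hz : 0 < z.re) :
    Real.exp (-(2 * Real.pi * (1 / 6) * (z⁻¹).re / k)) < 1 := by
  have hkR : (0 : ℝ) < k := by exact_mod_cast hk
  have h1 := inv_re_pos hz
  have h2 := Real.pi_pos
  rw [Real.exp_lt_one_iff]
  have : 0 < 2 * Real.pi * (1 / 6) * (z⁻¹).re / k := by positivity
  linarith

lemma summable_lineInt_nat (hk : 0 < k) (hz : 0 < z.re) (μ : ℤ) :
    Summable fun n : ℕ => lineInt h' k z w n μ (1 / 6) := by
  have hb := fun n : ℕ => norm_lineInt_le (h' := h') (k := k) (z := z) (w := w) n μ (1 / 6)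
  simp only [zpow_natCast] at hb
  exact Summable.of_norm_bounded ((summable_geometric_of_lt_one (Real.exp_pos _).le
    (decay_base_lt_one hk hz)).mul_right _) hb

lemma summable_lineInt_neg (hk : 0 < k) (hz : 0 < z.re) (μ : ℤ) :
    Summable fun n : ℕ => lineInt h' k z w (-((n : ℤ) + 1)) μ (-(1 / 6)) := by
  have hb := fun n : ℕ =>
    norm_lineInt_le (h' := h') (k := k) (z := z) (w := w) (-((n : ℤ) + 1)) μ (-(1 / 6))
  have e : ∀ n : ℕ, Real.exp (-(2 * Real.pi * (-(1 / 6)) * (z⁻¹).re / k)) ^ (-((n : ℤ) + 1)) =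
      Real.exp (-(2 * Real.pi * (1 / 6) * (z⁻¹).re / k)) ^ (n + 1) := by
    intro n
    rw [zpow_neg, ← inv_zpow, ← Real.exp_neg, ← zpow_natCast]
    congr 1
    congr 1; ring
  simp only [e] at hb
  exact Summable.of_norm_bounded (((summable_nat_add_iff 1).2 (summable_geometric_of_lt_one
    (Real.exp_pos _).le (decay_base_lt_one hk hz))).mul_right _) hb

lemma norm_cexp_two_pi_mul_div (hz : 0 < z.re) (w : ℂ) :
    ‖cexp (2 * Real.pi * w / z)‖ = Real.exp (2 * Real.pi * realCoord z w * (z⁻¹).re) := by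
  have hz0 : z ≠ 0 := by rintro rfl; simp at hz
  have hn : normSq z ≠ 0 := (normSq_pos.2 hz0).ne'
  rw [norm_exp]
  congr 1
  rw [mul_div_assoc, show (2 * Real.pi : ℂ) = ((2 * Real.pi : ℝ) : ℂ) by push_cast; ring,
    re_ofReal_mul, div_re, inv_re, realCoord_eq z w hz.ne']
  field_simp

lemma HasSum.of_eq_fun {f g : ℕ → ℂ} {a : ℂ} (hf : HasSum f a) (h : ∀ n, g n = f n) :
    HasSum g a :=
  (funext h) ▸ hf

/-- The real line carries the Fourier coefficients. According to the side on which it passes the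
pole it can be moved to `a = 1/6` or to `a = -1/6`; the residues picked up for the indices `r` for
which the other line is needed form a geometric series, and its sum is the same in both cases. -/
lemma hasSum_lineInt_zero (hk : 0 < k) (hz : 0 < z.re) (hw : |realCoord z w| < 1 / (6 * k))
    (hw0 : realCoord z w ≠ 0) {μ : ℕ} (hμ : μ < k) :
    HasSum (fun r : ℤ => lineInt h' k z w r μ 0)
      ((∑' n : ℕ, lineInt h' k z w n μ (1 / 6)) +
        (∑' n : ℕ, lineInt h' k z w (-((n : ℤ) + 1)) μ (-(1 / 6))) +
        if μ = 0 then poleResidue k z w / (cexp (2 * Real.pi * w / z) - 1) else 0) := by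
  obtain ⟨h1, h2⟩ := abs_lt.1 (abs_mul_realCoord_lt hk hw)
  have hkR : (0 : ℝ) < k := by exact_mod_cast hk
  have hκ := inv_re_pos hz
  have hpi := Real.pi_pos
  have hX := norm_cexp_two_pi_mul_div hz w
  have hX0 : cexp (2 * Real.pi * w / z) ≠ 0 := exp_ne_zero _
  set X := cexp (2 * Real.pi * w / z)
  have S1 := (summable_lineInt_nat (h' := h') (w := w) hk hz μ).hasSum
  have S2 := (summable_lineInt_neg (h' := h') (w := w) hk hz μ).hasSum
  have hdiff := fun r : ℤ => lineInt_sub (h' := h') hk hz hw r hμ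
  rcases lt_or_gt_of_ne hw0 with hneg | hpos
  · have hkneg : k * realCoord z w < 0 := mul_neg_of_pos_of_neg hkR hneg
    have hX1 : ‖X‖ < 1 := by
      rw [hX, Real.exp_lt_one_iff]
      have : 0 < 2 * Real.pi * -realCoord z w * (z⁻¹).re := by
        have : 0 < -realCoord z w := by linarith
        positivity
      linarith
    have hmove : ∀ r : ℤ, lineInt h' k z w r μ 0 = lineInt h' k z w r μ (-(1 / 6)) := by
      intro r
      refine (lineInt_congr hk hz r μ (by norm_num) fun c hc => realCoord_add_ne hk
        (not_int_of_mem_Ioo (a := -1) ?_ ?_) μ).symm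
      · push_cast; linarith [hc.1]
      · push_cast; linarith [hc.2]
    have S3 : HasSum (fun n : ℕ => if μ = 0 then poleResidue k z w * X ^ (n : ℤ) else 0)
        (if μ = 0 then poleResidue k z w * (1 - X)⁻¹ else 0) := by
      split_ifs
      · simpa using (hasSum_geometric_of_norm_lt_one hX1).mul_left (poleResidue k z w)
      · exact hasSum_zero
    have A1 := HasSum.of_eq_fun (g := fun n : ℕ => lineInt h' k z w n μ 0)
      (S1.sub S3) fun n => by rw [hmove, ← hdiff]; ring
    have A2 := HasSum.of_eq_fun (g := fun n : ℕ => lineInt h' k z w (-((n : ℤ) + 1)) μ 0)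
      S2 fun n => by rw [hmove]
    have hres := HasSum.of_nat_of_neg_add_one (f := fun r : ℤ => lineInt h' k z w r μ 0) A1 A2
    convert hres using 1
    split_ifs
    · have h3 : 1 - X ≠ 0 := by
        intro h0
        rw [← sub_eq_zero.1 h0, norm_one] at hX1
        exact lt_irrefl _ hX1
      have h4 : X - 1 ≠ 0 := by intro h0; apply h3; linear_combination -h0
      rw [← neg_sub 1 X, div_neg, div_eq_mul_inv]
      ring
    · ring
  · have hkpos : 0 < k * realCoord z w := mul_pos hkR hpos
    have hX1 : ‖X⁻¹‖ < 1 := by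
      rw [norm_inv, hX]
      refine inv_lt_one_of_one_lt₀ ?_
      rw [Real.one_lt_exp_iff]
      positivity
    have hmove : ∀ r : ℤ, lineInt h' k z w r μ 0 = lineInt h' k z w r μ (1 / 6) := by
      intro r
      refine lineInt_congr hk hz r μ (by norm_num) fun c hc => realCoord_add_ne hk
        (not_int_of_mem_Ioo (a := 0) ?_ ?_) μ
      · push_cast; linarith [hc.1]
      · push_cast; linarith [hc.2]
    have S3 : HasSum (fun n : ℕ => if μ = 0 then poleResidue k z w * X ^ (-((n : ℤ) + 1)) else 0)
        (if μ = 0 then poleResidue k z w * X⁻¹ * (1 - X⁻¹)⁻¹ else 0) := by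
      split_ifs
      · refine ((hasSum_geometric_of_norm_lt_one hX1).mul_left
          (poleResidue k z w * X⁻¹)).of_eq_fun fun n : ℕ => ?_
        rw [neg_add, zpow_add₀ hX0, zpow_neg, zpow_natCast, inv_pow, zpow_neg_one]
        ring
      · exact hasSum_zero
    have A1 := HasSum.of_eq_fun (g := fun n : ℕ => lineInt h' k z w n μ 0)
      S1 fun n => by rw [hmove]
    have A2 := HasSum.of_eq_fun (g := fun n : ℕ => lineInt h' k z w (-((n : ℤ) + 1)) μ 0)
      (S2.add S3) fun n => by rw [hmove, ← hdiff]; ring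
    have hres := HasSum.of_nat_of_neg_add_one (f := fun r : ℤ => lineInt h' k z w r μ 0) A1 A2
    convert hres using 1
    split_ifs
    · have h3 : 1 - X⁻¹ ≠ 0 := by
        intro h0
        rw [← sub_eq_zero.1 h0, norm_one] at hX1
        exact lt_irrefl _ hX1
      have h4 : X - 1 = X * (1 - X⁻¹) := by rw [mul_sub, mul_inv_cancel₀ hX0]; ring
      rw [h4, div_mul_eq_div_div, div_eq_mul_inv _ (1 - X⁻¹), div_eq_mul_inv _ X]
      ring
    · ring

end Lines

/-! ### Zeros of the denominators -/

lemma norm_nome (k : ℕ) (h : ℤ) (z : ℂ) : ‖nome k h z‖ = Real.exp (-(2 * Real.pi * z.re / k)) := by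
  rw [nome, norm_exp]
  congr 1
  rw [show (2 * Real.pi * I / k * (h + I * z) : ℂ) = ((2 * Real.pi / k : ℝ) : ℂ) * (I * (h + I * z)) by
    push_cast; ring, re_ofReal_mul]
  simp
  ring

lemma nome_ne_zero (k : ℕ) (h : ℤ) (z : ℂ) : nome k h z ≠ 0 := exp_ne_zero _

lemma norm_nome_lt_one {k : ℕ} (hk : 0 < k) (h : ℤ) {z : ℂ} (hz : 0 < z.re) :
    ‖nome k h z‖ < 1 := by
  have hkR : (0 : ℝ) < k := by exact_mod_cast hk
  have := Real.pi_pos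
  rw [norm_nome, Real.exp_lt_one_iff]
  have : 0 < 2 * Real.pi * z.re / k := by positivity
  linarith

/-- Within the strip, the denominators of the rank series vanish only at points of `izℤ`. -/
lemma exists_eq_of_rank_denom_eq_zero {h : ℤ} {k : ℕ} {z w : ℂ} (hk : 0 < k) (hz : 0 < z.re)
    (hcop : IsCoprime h (k : ℤ)) (hw : |realCoord z w| < 1 / (6 * k)) {n : ℤ}
    (h0 : 1 - cexp (2 * Real.pi * I * w) * nome k h z ^ n = 0) :
    ∃ m : ℤ, n = k * m ∧ w = ((-m : ℤ) : ℂ) * (I * z) := by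
  have hkR : (0 : ℝ) < k := by exact_mod_cast hk
  have hkC : (k : ℂ) ≠ 0 := by exact_mod_cast hk.ne'
  have h1 : cexp (2 * Real.pi * I * (w + n * (h + I * z) / k)) = 1 := by
    rw [sub_eq_zero] at h0
    rw [h0, nome, ← exp_int_mul, ← exp_add]
    congr 1
    ring
  obtain ⟨j, hj⟩ := exp_eq_one_iff.1 h1
  have hj2 : w + n * (h + I * z) / k = j := by
    have h2 : (2 * Real.pi * I : ℂ) ≠ 0 := two_pi_I_ne_zero
    apply mul_left_cancel₀ h2
    rw [hj]; ring
  have hrc : k * realCoord z w = (j * k - n * h : ℤ) := by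
    have e : w = j - n * (h + I * z) / k := by linear_combination hj2
    rw [e, realCoord_eq _ _ hz.ne']
    simp only [sub_re, sub_im, intCast_re, intCast_im, div_natCast_re, div_natCast_im, mul_re,
      mul_im, add_re, add_im, I_re, I_im]
    push_cast
    field_simp
    ring
  have hlt := abs_mul_realCoord_lt hk hw
  have hzero : j * k - n * h = 0 := by
    by_contra hne
    have h3 : (1 : ℝ) ≤ |((j * k - n * h : ℤ) : ℝ)| := by exact_mod_cast Int.one_le_abs hne
    rw [← hrc] at h3
    linarith
  have hdvd : (k : ℤ) ∣ n := hcop.symm.dvd_of_dvd_mul_right ⟨j, by linarith⟩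
  obtain ⟨m, hm⟩ := hdvd
  refine ⟨m, hm, ?_⟩
  have hjm : j = m * h := by
    rw [hm] at hzero
    have : (k : ℤ) * (j - m * h) = 0 := by linear_combination hzero
    rcases mul_eq_zero.1 this with h4 | h4
    · exact absurd h4 (by exact_mod_cast hk.ne')
    · linarith
  have e : w = j - n * (h + I * z) / k := by linear_combination hj2
  rw [e, hjm, hm]
  push_cast
  field_simp
  ring

lemma cexp_two_pi_I_mul_div (z w : ℂ) :
    cexp (2 * Real.pi * I * (I * w / z)) = (cexp (2 * Real.pi * w / z))⁻¹ := by
  rw [← exp_neg]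
  congr 1
  linear_combination (2 * Real.pi * w / z) * I_sq

lemma norm_cexp_mul_dual_nome (h' : ℤ) {k : ℕ} {z : ℂ} (hz : 0 < z.re) (w : ℂ) (n : ℤ) :
    ‖cexp (2 * Real.pi * w / z) * nome k h' z⁻¹ ^ n‖ =
      Real.exp (2 * Real.pi * (z⁻¹).re * (realCoord z w - n / k)) := by
  rw [norm_mul, norm_zpow, norm_nome, norm_cexp_two_pi_mul_div hz, ← Real.rpow_intCast,
    ← Real.exp_mul, ← Real.exp_add]
  congr 1
  ring

lemma norm_inv_cexp_mul_dual_nome (h' : ℤ) {k : ℕ} {z : ℂ} (hz : 0 < z.re) (w : ℂ) (n : ℤ) :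
    ‖(cexp (2 * Real.pi * w / z))⁻¹ * nome k h' z⁻¹ ^ n‖ =
      Real.exp (2 * Real.pi * (z⁻¹).re * (-realCoord z w - n / k)) := by
  rw [norm_mul, norm_zpow, norm_nome, norm_inv, norm_cexp_two_pi_mul_div hz, ← Real.exp_neg,
    ← Real.rpow_intCast, ← Real.exp_mul, ← Real.exp_add]
  congr 1
  ring

/-- On the dual side the strip excludes all zeros but that of the term `n = 0`. -/
lemma dual_denom_ne_zero {h' : ℤ} {k : ℕ} {z w : ℂ} (hk : 0 < k) (hz : 0 < z.re)
    (hw : |realCoord z w| < 1 / (6 * k)) {n : ℤ} (hn : n ≠ 0) :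
    1 - cexp (2 * Real.pi * I * (I * w / z)) * nome k h' z⁻¹ ^ n ≠ 0 := by
  have hkR : (0 : ℝ) < k := by exact_mod_cast hk
  intro h0
  rw [cexp_two_pi_I_mul_div, sub_eq_zero] at h0
  have h1 := norm_inv_cexp_mul_dual_nome h' (k := k) hz w n
  rw [← h0, norm_one, eq_comm, Real.exp_eq_one_iff] at h1
  have hpos : 0 < 2 * Real.pi * (z⁻¹).re :=
    mul_pos (mul_pos two_pos Real.pi_pos) (inv_re_pos hz)
  rcases mul_eq_zero.1 h1 with h2 | h2
  · exact hpos.ne' h2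
  · have h3 : k * realCoord z w = -n := by
      field_simp at h2
      linarith
    have h4 := abs_mul_realCoord_lt hk hw
    rw [h3, abs_neg] at h4
    have h5 : (1 : ℝ) ≤ |(n : ℝ)| := by exact_mod_cast Int.one_le_abs hn
    linarith

lemma exists_eq_of_cexp_eq_one {z w : ℂ} (hz : z ≠ 0) (h : cexp (2 * Real.pi * w / z) = 1) :
    ∃ m : ℤ, w = m * (I * z) := by
  obtain ⟨n, hn⟩ := exp_eq_one_iff.1 h
  refine ⟨n, ?_⟩
  have hpi : (Real.pi : ℂ) ≠ 0 := by exact_mod_cast Real.pi_ne_zero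
  field_simp at hn
  linear_combination hn

lemma summable_univ {f : ℤ → ℂ} : (Summable fun n : (Set.univ : Set ℤ) => f n) ↔ Summable f :=
  (Equiv.Set.univ ℤ).summable_iff (f := f)

/-! ### Combining the two halves of the Fourier series -/

/-- The transformation of the full rank series, before continuation to the line `izℝ`. -/
theorem rank_series_transform_off_line {h h' : ℤ} {k : ℕ} {z w : ℂ} (hk : 0 < k) (hz : 0 < z.re)
    (hcop : IsCoprime h (k : ℤ)) {b : ℤ} (hb : h * h' = -1 + k * b) (hbk : Even (b + k))
    (hpar : Odd (h' + k)) (hw : |realCoord z w| < 1 / (6 * k)) (hw0 : realCoord z w ≠ 0) :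
    k * ∑' n : ℤ, rankTerm w (nome k h z) n =
      eulerProd (nome k h' z⁻¹) *
        (lineSum h' k z w 0 (1 / 6) + lineSum h' k z w (-1) (-(1 / 6))) +
      poleResidue k z w * (cexp (2 * Real.pi * w / z))⁻¹ *
        ∑' n : ℤ, rankTerm (I * w / z) (nome k h' z⁻¹) n := by
  have hkR : (0 : ℝ) < k := by exact_mod_cast hk
  have hkC : (k : ℂ) ≠ 0 := by exact_mod_cast hk.ne'
  have hz0 : z ≠ 0 := by rintro rfl; simp at hz
  have hκ := inv_re_pos hz
  have hcop' : IsCoprime h' (k : ℤ) := ⟨-h, b, by linarith⟩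
  obtain ⟨hδ1, hδ2⟩ := abs_lt.1 hw
  have h6 : 1 / (6 * (k : ℝ)) < 1 / k := by
    apply one_div_lt_one_div_of_lt hkR; linarith
  -- the left-hand side as a sum of Fourier coefficients
  have hline : ∀ m : ℤ, w ≠ m * (I * z) := by
    intro m e
    apply hw0
    rw [e, realCoord_eq _ _ hz.ne']
    simp
    field_simp
    ring
  have hdenom : ∀ n : ℤ, 1 - cexp (2 * Real.pi * I * w) * nome k h z ^ n ≠ 0 := by
    intro n h0
    obtain ⟨m, -, hm⟩ := exists_eq_of_rank_denom_eq_zero hk hz hcop hw h0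
    exact hline _ hm
  have hsumL : Summable fun n : ℤ => rankTerm w (nome k h z) n := by
    have := summable_rankTerm (S := Set.univ) (nome_ne_zero k h z) (norm_nome_lt_one hk h hz)
      fun n _ => hdenom n
    exact summable_univ.1 this
  have hL : k * ∑' n : ℤ, rankTerm w (nome k h z) n =
      (∑' s : ℕ, lineSum h' k z w s (1 / 6)) +
      (∑' s : ℕ, lineSum h' k z w (-((s : ℤ) + 1)) (-(1 / 6))) +
      poleResidue k z w / (cexp (2 * Real.pi * w / z) - 1) := by
    have hμ : ∀ μ ∈ Finset.range k, ∑' m : ℤ, rankTerm w (nome k h z) (-h' * μ + k * m) =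
        1 / k * ((∑' n : ℕ, lineInt h' k z w n μ (1 / 6)) +
        (∑' n : ℕ, lineInt h' k z w (-((n : ℤ) + 1)) μ (-(1 / 6))) +
        if μ = 0 then poleResidue k z w / (cexp (2 * Real.pi * w / z) - 1) else 0) := by
      intro μ hμ
      have hS := hasSum_lineInt_zero (h' := h') hk hz hw hw0 (Finset.mem_range.1 hμ)
      rw [← hS.tsum_eq, ← tsum_poissonTerm hk hz μ _ hS.summable]
      · exact tsum_congr fun m => rankTerm_eq_poissonTerm hk hb hbk hpar z w μ m
      · intro m
        obtain ⟨h1, h2⟩ := abs_lt.1 (abs_mul_realCoord_lt hk hw)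
        have hne : ∀ n : ℤ, k * realCoord z w + 0 ≠ n := by
          intro n e
          rw [add_zero] at e
          have hn : n = 0 := by
            by_contra hne
            have h3 : (1 : ℝ) ≤ |(n : ℝ)| := by exact_mod_cast Int.one_le_abs hne
            rw [← e] at h3
            linarith [abs_mul_realCoord_lt hk hw]
          rw [hn, Int.cast_zero] at e
          exact (mul_ne_zero hkR.ne' hw0) e
        simpa using realCoord_add_ne hk hne μ m
    rw [tsum_int_eq_sum_tsum hsumL hk hcop', Finset.sum_congr rfl hμ, ← Finset.mul_sum, ← mul_assoc,
      mul_one_div_cancel hkC, one_mul, Finset.sum_add_distrib, Finset.sum_add_distrib,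
      Finset.sum_ite_eq' _ 0 (fun _ => poleResidue k z w / (cexp (2 * Real.pi * w / z) - 1)),
      if_pos (Finset.mem_range.2 hk)]
    have e1 : ∑' s : ℕ, lineSum h' k z w s (1 / 6) =
        ∑ μ ∈ Finset.range k, ∑' s : ℕ, lineInt h' k z w s μ (1 / 6) :=
      Summable.tsum_finsetSum fun μ _ => summable_lineInt_nat hk hz μ
    have e2 : ∑' s : ℕ, lineSum h' k z w (-((s : ℤ) + 1)) (-(1 / 6)) =
        ∑ μ ∈ Finset.range k, ∑' s : ℕ, lineInt h' k z w (-((s : ℤ) + 1)) μ (-(1 / 6)) :=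
      Summable.tsum_finsetSum fun μ _ => summable_lineInt_neg hk hz μ
    rw [e1, e2]
  have hq := norm_nome_lt_one hk h' hκ
  have hq0 := nome_ne_zero k h' z⁻¹
  have hX0 : cexp (2 * Real.pi * w / z) ≠ 0 := exp_ne_zero _
  have hpos : 0 < 2 * Real.pi * (z⁻¹).re := mul_pos (mul_pos two_pos Real.pi_pos) hκ
  have hqX : ‖nome k h' z⁻¹ * cexp (2 * Real.pi * w / z)‖ < 1 := by
    have := norm_cexp_mul_dual_nome h' (k := k) hz w 1
    rw [zpow_one] at this
    rw [mul_comm, this, Real.exp_lt_one_iff]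
    refine mul_neg_of_pos_of_neg hpos ?_
    push_cast; linarith
  have hqX' : ‖nome k h' z⁻¹ * (cexp (2 * Real.pi * w / z))⁻¹‖ < 1 := by
    have := norm_inv_cexp_mul_dual_nome h' (k := k) hz w 1
    rw [zpow_one] at this
    rw [mul_comm, this, Real.exp_lt_one_iff]
    refine mul_neg_of_pos_of_neg hpos ?_
    push_cast; linarith
  have hX1 : cexp (2 * Real.pi * w / z) ≠ 1 := fun e => by
    obtain ⟨m, hm⟩ := exists_eq_of_cexp_eq_one hz0 e
    exact hline m hm
  have hsub := lineSum_sub (h' := h') hk hz hw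
  have hshift := lineSum_shift hk hz hpar hw
  have hdual : ∀ n : ℤ, 1 - cexp (2 * Real.pi * I * (I * w / z)) * nome k h' z⁻¹ ^ n ≠ 0 := by
    intro n
    rcases eq_or_ne n 0 with rfl | hn
    · rw [cexp_two_pi_I_mul_div, zpow_zero, mul_one, sub_ne_zero]
      intro e
      exact hX1 (inv_eq_one.1 e.symm)
    · exact dual_denom_ne_zero hk hz hw hn
  have hsumR : Summable fun n : ℤ => rankTerm (I * w / z) (nome k h' z⁻¹) n := by
    have := summable_rankTerm (S := Set.univ) hq0 hq fun n _ => hdual n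
    exact summable_univ.1 this
  have hpair : ∀ N : ℕ, _ := fun N : ℕ => rankTerm_add_rankTerm_neg (w := I * w / z) hq0 N (by
    have := hdual (-((N : ℤ) + 1))
    rw [cexp_two_pi_I_mul_div] at this ⊢
    rw [inv_inv]
    intro e
    apply this
    have e2 : cexp (2 * Real.pi * w / z) * nome k h' z⁻¹ ^ (N + 1) = 1 := (sub_eq_zero.1 e).symm
    have e3 : nome k h' z⁻¹ ^ (-((N : ℤ) + 1)) = (nome k h' z⁻¹ ^ (N + 1))⁻¹ := by
      rw [zpow_neg]; exact_mod_cast rfl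
    rw [e3, ← mul_inv, e2, inv_one, sub_self])
  simp only [cexp_two_pi_I_mul_div, inv_inv] at hpair
  -- the dual rank series without its term `n = 0`, regrouped by `|n|`
  have hA := ((hasSum_nat_add_iff' 1).2 hsumR.hasSum.nat_add_neg)
  rw [hL]
  have hsu : Summable fun s : ℕ => lineSum h' k z w s (1 / 6) :=
    summable_sum fun μ _ => summable_lineInt_nat hk hz μ
  have hsv : Summable fun s : ℕ => lineSum h' k z w (-((s : ℤ) + 1)) (-(1 / 6)) :=
    summable_sum fun μ _ => summable_lineInt_neg hk hz μ
  set X := cexp (2 * Real.pi * w / z)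
  set q := nome k h' z⁻¹
  set ρ := poleResidue k z w
  -- the two halves of the Fourier series obey recurrences of the same shape, the second one with
  -- `X⁻¹` and `-ρX⁻¹` in place of `X` and `ρ`
  have hrecu : ∀ s : ℕ, lineSum h' k z w ((s + 3 : ℕ) : ℤ) (1 / 6) =
      -q ^ (s + 2) * (lineSum h' k z w s (1 / 6) - ρ * X ^ s) := by
    intro s
    have h1 := hsub s
    rw [zpow_natCast] at h1
    rw [hshift, ← h1, show ((s + 3 : ℕ) : ℤ) - 1 = ((s + 2 : ℕ) : ℤ) by push_cast; ring,
      show ((s + 3 : ℕ) : ℤ) - 3 = (s : ℤ) by push_cast; ring, zpow_natCast]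
    ring
  have hrecv : ∀ s : ℕ, lineSum h' k z w (-(((s + 3 : ℕ) : ℤ) + 1)) (-(1 / 6)) =
      -q ^ (s + 2) * (lineSum h' k z w (-((s : ℤ) + 1)) (-(1 / 6)) - -(ρ * X⁻¹) * X⁻¹ ^ s) := by
    intro s
    have h1 := hsub (-((s : ℤ) + 1))
    have h2 := hshift (-((s : ℤ) + 1))
    have e1 : X ^ (-((s : ℤ) + 1)) = X⁻¹ * X⁻¹ ^ s := by
      rw [neg_add, zpow_add₀ hX0, zpow_neg, zpow_natCast, inv_pow, zpow_neg_one, mul_comm]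
    have e2 : q ^ (-((s : ℤ) + 1) - 1) = (q ^ (s + 2))⁻¹ := by
      rw [← zpow_natCast, ← zpow_neg]; rfl
    have e3 : -((s : ℤ) + 1) - 3 = -(((s + 3 : ℕ) : ℤ) + 1) := by push_cast; ring
    rw [e1] at h1
    rw [e2, e3] at h2
    have hqs : q ^ (s + 2) ≠ 0 := pow_ne_zero _ hq0
    have h3 : lineSum h' k z w (-(((s + 3 : ℕ) : ℤ) + 1)) (-(1 / 6)) =
        -q ^ (s + 2) * lineSum h' k z w (-((s : ℤ) + 1)) (1 / 6) := by
      rw [h2]; field_simp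
    rw [h3]
    linear_combination (-q ^ (s + 2)) * h1
  have hU := hasSum_of_recurrence hq hqX hsu hrecu
  have hV := hasSum_of_recurrence hq hqX' hsv hrecv
  -- the six initial values reduce to the two in the statement
  have c0 := hshift 0
  have c1 := hshift 1
  have c2 := hshift 2
  norm_num at c0 c1 c2
  have hE := (hasSum_pentagonal hq).mul_left
    (lineSum h' k z w 0 (1 / 6) + lineSum h' k z w (-1) (-(1 / 6)))
  have hR := ((hU.add hV).sub hE).unique ((hA.mul_left (ρ * X⁻¹)).of_eq_fun fun N => by
    have e1 : (-((N + 1 : ℕ) : ℤ)) = -((N : ℤ) + 1) := by push_cast; ring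
    have e2 : (-(((1 : ℕ) : ℤ) + 1)) = -2 := by norm_num
    have e3 : (-(((2 : ℕ) : ℤ) + 1)) = -3 := by norm_num
    have e4 : (-(((0 : ℕ) : ℤ) + 1)) = -1 := by norm_num
    have c0' : lineSum h' k z w (-3) (-(1 / 6)) = -(q * lineSum h' k z w 0 (1 / 6)) := by
      rw [c0]; field_simp
    rw [e1, hpair, e2, e3, e4, Nat.cast_zero, Nat.cast_one, Nat.cast_ofNat, c1, c2, c0']
    field_simp
    ring)
  have h0 : rankTerm (I * w / z) q 0 = 1 / (1 - X⁻¹) := by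
    simp [rankTerm, cexp_two_pi_I_mul_div, X]
  simp only [Finset.sum_range_one, Nat.cast_zero, neg_zero, h0] at hR
  have hX2 : X - 1 ≠ 0 := sub_ne_zero.2 hX1
  have h1X : 1 / (1 - X⁻¹) = X / (X - 1) := by
    have : 1 - X⁻¹ ≠ 0 := fun e => hX1 (inv_eq_one.1 (sub_eq_zero.1 e).symm)
    field_simp
  rw [h1X] at hR
  have h2 : ρ / (X - 1) = ρ * X⁻¹ * (X / (X - 1)) := by field_simp
  rw [h2]
  linear_combination hR

/-! ### Continuation of the rank series transformation to the line `izℝ` -/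

lemma continuous_realCoord (z : ℂ) : Continuous (realCoord z) := by
  unfold realCoord
  fun_prop

lemma continuousAt_lineInt {h' : ℤ} {k : ℕ} {z w₀ : ℂ} (hk : 0 < k) (hz : 0 < z.re) (r μ : ℤ)
    {a : ℝ} (ha : ∀ m : ℤ, realCoord z w₀ + (μ + a) / k ≠ m) :
    ContinuousAt (fun w => lineInt h' k z w r μ a) w₀ := by
  set x := realCoord z w₀ + (μ + a) / k with hx
  have hκ := inv_re_pos hz
  set d := |x - round x| / 2 with hd
  have hd0 : 0 < d := half_pos (abs_pos.2 (sub_ne_zero.2 (ha _)))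
  have hnear : ∀ᶠ w in 𝓝 w₀, ∀ m : ℤ, d ≤ |realCoord z w + (μ + a) / k - m| := by
    have h1 : ∀ᶠ w in 𝓝 w₀, |realCoord z w - realCoord z w₀| < d := by
      have := (continuous_realCoord z).continuousAt (x := w₀)
      exact (Metric.tendsto_nhds.1 this) d hd0
    filter_upwards [h1] with w hw m
    have h2 : 2 * d ≤ |x - m| := by
      rw [hd, mul_div_cancel₀ _ two_ne_zero]
      exact round_le x m
    have h3 : x - m = (realCoord z w + (μ + a) / k - m) - (realCoord z w - realCoord z w₀) := by
      rw [hx]; ring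
    rw [h3] at h2
    have := abs_sub (realCoord z w + (μ + a) / k - m) (realCoord z w - realCoord z w₀)
    linarith
  have hphase : ∀ (w : ℂ) (t : ℝ), realCoord z (polePhase k z w μ (t - I * a / z)) =
      realCoord z w + (μ + a) / k := by
    intro w t
    rw [realCoord_polePhase hz, line_im, sub_eq_add_neg, ← neg_div, line_level hz]
  obtain ⟨c, hc, hlow⟩ := exists_le_norm_one_sub_cexp hz hd0
  obtain ⟨D, hD, hnum⟩ := norm_poissonNumer_le hk hz h' r μ |a * (z⁻¹).re|
  have hα := gaussian_rate_pos hk hz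
  set α := 3 * Real.pi * z.re / k / 2
  refine continuousAt_of_dominated
    (bound := fun t => D * Real.exp (-α * (t + a * (z⁻¹).im) ^ 2) * c⁻¹) ?_ ?_ ?_ ?_
  · filter_upwards [hnear] with w hw
    refine (integrable_lineInt hk hz r μ fun m e => ?_).aestronglyMeasurable
    have := hw m
    rw [e, sub_self, abs_zero] at this
    linarith
  · filter_upwards [hnear] with w hw
    refine ae_of_all _ fun t => ?_
    rw [poissonTerm, norm_div, div_eq_mul_inv]
    have h1 := hnum (t - I * a / z) (by rw [line_im, abs_neg])
    rw [line_re] at h1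
    refine mul_le_mul h1 (inv_anti₀ hc (hlow _ fun m => ?_)) (by positivity) (by positivity)
    rw [hphase]
    exact hw m
  · exact (((integrable_exp_neg_mul_sq hα).comp_add_right _).const_mul D).mul_const _
  · refine ae_of_all _ fun t => ?_
    unfold poissonTerm
    refine continuousAt_const.div ?_ ?_
    · unfold polePhase
      fun_prop
    · refine one_sub_cexp_ne_zero hz.ne' fun m => ?_
      rw [hphase]
      exact ha m

lemma tsum_univ_int (f : ℤ → ℂ) : ∑' n : (Set.univ : Set ℤ), f n = ∑' n, f n :=
  (Equiv.Set.univ ℤ).tsum_eq f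

/-- The transformation of the full rank series. -/
theorem rank_series_transform {h h' : ℤ} {k : ℕ} {z w : ℂ} (hk : 0 < k) (hz : 0 < z.re)
    (hcop : IsCoprime h (k : ℤ)) {b : ℤ} (hb : h * h' = -1 + k * b) (hbk : Even (b + k))
    (hpar : Odd (h' + k)) (hw : |realCoord z w| < 1 / (6 * k))
    (hline : ∀ m : ℤ, w ≠ m * (I * z)) :
    k * ∑' n : ℤ, rankTerm w (nome k h z) n =
      eulerProd (nome k h' z⁻¹) *
        (lineSum h' k z w 0 (1 / 6) + lineSum h' k z w (-1) (-(1 / 6))) +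
      poleResidue k z w * (cexp (2 * Real.pi * w / z))⁻¹ *
        ∑' n : ℤ, rankTerm (I * w / z) (nome k h' z⁻¹) n := by
  have hz0 : z ≠ 0 := by rintro rfl; simp at hz
  by_cases hw0 : realCoord z w ≠ 0
  · exact rank_series_transform_off_line hk hz hcop hb hbk hpar hw hw0
  rw [not_not] at hw0
  set L : ℂ → ℂ := fun w => k * ∑' n : ℤ, rankTerm w (nome k h z) n with hL
  set R : ℂ → ℂ := fun w => eulerProd (nome k h' z⁻¹) *
        (lineSum h' k z w 0 (1 / 6) + lineSum h' k z w (-1) (-(1 / 6))) +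
      poleResidue k z w * (cexp (2 * Real.pi * w / z))⁻¹ *
        ∑' n : ℤ, rankTerm (I * w / z) (nome k h' z⁻¹) n with hR
  have hLc : ContinuousAt L w := by
    have := continuousAt_tsum_rankTerm (S := Set.univ) (nome_ne_zero k h z)
      (norm_nome_lt_one hk h hz) (w₀ := w) fun n _ h0 => by
        obtain ⟨m, -, hm⟩ := exists_eq_of_rank_denom_eq_zero hk hz hcop hw h0
        exact hline _ hm
    simp_rw [tsum_univ_int] at this
    exact continuousAt_const.mul this
  have hRc : ContinuousAt R w := by
    have h1 := continuousAt_tsum_rankTerm (S := Set.univ) (nome_ne_zero k h' z⁻¹)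
      (norm_nome_lt_one hk h' (inv_re_pos hz)) (w₀ := I * w / z) fun n _ => by
        rcases eq_or_ne n 0 with rfl | hn
        · rw [cexp_two_pi_I_mul_div, zpow_zero, mul_one, sub_ne_zero]
          intro e
          obtain ⟨m, hm⟩ := exists_eq_of_cexp_eq_one hz0 (inv_eq_one.1 e.symm)
          exact hline m hm
        · exact dual_denom_ne_zero hk hz hw hn
    simp_rw [tsum_univ_int] at h1
    have h2 : ContinuousAt (fun w => ∑' n : ℤ, rankTerm (I * w / z) (nome k h' z⁻¹) n) w :=
      ContinuousAt.comp (f := fun w => I * w / z) h1 (by fun_prop)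
    have h3 : ContinuousAt (fun w => lineSum h' k z w 0 (1 / 6)) w :=
      tendsto_finsetSum _ fun μ _ => continuousAt_lineInt hk hz 0 μ (sixth_line_ne hk hw μ)
    have h4 : ContinuousAt (fun w => lineSum h' k z w (-1) (-(1 / 6))) w :=
      tendsto_finsetSum _ fun μ _ => continuousAt_lineInt hk hz (-1) μ (neg_sixth_line_ne hk hw μ)
    have h5 : ContinuousAt (fun w => poleResidue k z w * (cexp (2 * Real.pi * w / z))⁻¹) w := by
      unfold poleResidue
      simp_rw [← exp_neg]
      fun_prop
    exact (continuousAt_const.mul (h3.add h4)).add (h5.mul h2)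
  -- approach `w` along a real segment, which meets `izℝ` in `w` only
  have hpath : Tendsto (fun t : ℝ => w + t) (𝓝[≠] 0) (𝓝 w) := by
    have : Continuous fun t : ℝ => w + t := by fun_prop
    simpa using (this.tendsto 0).mono_left (nhdsWithin_le_nhds (s := {0}ᶜ))
  have hEq : ∀ᶠ t : ℝ in 𝓝[≠] 0, L (w + t) = R (w + t) := by
    have hnear : ∀ᶠ t : ℝ in 𝓝[≠] 0, |realCoord z (w + t)| < 1 / (6 * k) :=
      hpath.eventually (((continuous_realCoord z).abs.continuousAt).eventually_lt_const hw)
    filter_upwards [hnear, self_mem_nhdsWithin] with t ht ht0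
    refine rank_series_transform_off_line hk hz hcop hb hbk hpar ht ?_
    rw [realCoord_eq _ _ hz.ne'] at hw0 ⊢
    rw [add_re, add_im, ofReal_re, ofReal_im, add_zero]
    intro e
    exact ht0 (by rw [Set.mem_singleton_iff]; linarith)
  exact tendsto_nhds_unique ((hLc.tendsto.comp hpath).congr' hEq) (hRc.tendsto.comp hpath)

/-! ### The Mordell integrals -/

/-- The coefficient of the Mordell integrals with index `ν`. -/
noncomputable def mordellCoeff (h' : ℤ) (k : ℕ) (ν : ℤ) : ℂ :=
  (-1) ^ ν * cexp (Real.pi * I * h' / k * (-3 * (ν : ℂ) ^ 2 + ν))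

lemma mordellCoeff_ne_zero (h' : ℤ) (k : ℕ) (ν : ℤ) : mordellCoeff h' k ν ≠ 0 :=
  mul_ne_zero (zpow_ne_zero _ (by simp)) (exp_ne_zero _)

/-- Completing the square: on the line `a = 1/6` and for `r = 0` the linear term of the exponent
cancels, which leaves the integrand of `I⁻`. -/
lemma poissonTerm_sixth_line {k : ℕ} (hk : 0 < k) {z : ℂ} (hz : z ≠ 0) (h' : ℤ) (w : ℂ) (ν : ℤ)
    (t : ℝ) : poissonTerm h' k z w 0 (-ν) (t - I * (1 / 6 : ℝ) / z) =
      cexp (-(Real.pi / (12 * k) * z⁻¹)) * mordellCoeff h' k ν *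
        mordellIntegrand (-1) k ν z w (-t) := by
  have hk' : (k : ℂ) ≠ 0 := by exact_mod_cast hk.ne'
  rw [poissonTerm_eq_hFun, mordellIntegrand, mordellCoeff]
  have e1 : (Real.pi * I * (((-ν : ℤ) : ℂ) + I * z * (t - I * (1 / 6 : ℝ) / z)) / k : ℂ) =
      ((-1 : ℤ) : ℂ) * (Real.pi * I * ν / k - Real.pi * I / (6 * k) -
        Real.pi * z * ((-t : ℝ) : ℂ) / k) := by
    push_cast
    field_simp
    linear_combination (6 * z * t - I) * I_sq
  have e2 : cexp (-(3 * Real.pi * z * (t - I * (1 / 6 : ℝ) / z) ^ 2 / k) -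
      Real.pi * I * (2 * ((0 : ℤ) : ℂ) + 1) * (t - I * (1 / 6 : ℝ) / z) / k) =
      cexp (-(Real.pi / (12 * k) * z⁻¹)) *
        cexp (-(3 * Real.pi * z * ((-t : ℝ) : ℂ) ^ 2 / k)) := by
    rw [← exp_add]
    congr 1
    push_cast
    field_simp
    linear_combination 36 * I_sq
  have e3 : cexp (-(Real.pi * I * h' / k * (3 * ((-ν : ℤ) : ℂ) ^ 2 +
      (2 * ((0 : ℤ) : ℂ) + 1) * ((-ν : ℤ) : ℂ)))) =
      cexp (Real.pi * I * h' / k * (-3 * (ν : ℂ) ^ 2 + ν)) := by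
    congr 1
    push_cast
    ring
  have e4 : (-1 : ℂ) ^ (-ν) = (-1) ^ ν := by
    rw [zpow_neg, ← inv_zpow]; norm_num
  rw [e1, e2, e3, e4]
  ring

/-- On the line `a = -1/6` and for `r = -1` the linear term cancels as well, which leaves the
integrand of `I⁺`. -/
lemma poissonTerm_neg_sixth_line {k : ℕ} (hk : 0 < k) {z : ℂ} (hz : z ≠ 0) (h' : ℤ) (w : ℂ)
    (ν : ℤ) (t : ℝ) : poissonTerm h' k z w (-1) ν (t - I * (-(1 / 6) : ℝ) / z) =
      cexp (-(Real.pi / (12 * k) * z⁻¹)) * mordellCoeff h' k ν *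
        mordellIntegrand 1 k ν z w t := by
  have hk' : (k : ℂ) ≠ 0 := by exact_mod_cast hk.ne'
  rw [poissonTerm_eq_hFun, mordellIntegrand, mordellCoeff]
  have e1 : (Real.pi * I * ((ν : ℂ) + I * z * (t - I * (-(1 / 6) : ℝ) / z)) / k : ℂ) =
      ((1 : ℤ) : ℂ) * (Real.pi * I * ν / k - Real.pi * I / (6 * k) -
        Real.pi * z * t / k) := by
    push_cast
    field_simp
    linear_combination (6 * z * t + I) * I_sq
  have e2 : cexp (-(3 * Real.pi * z * (t - I * (-(1 / 6) : ℝ) / z) ^ 2 / k) -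
      Real.pi * I * (2 * ((-1 : ℤ) : ℂ) + 1) * (t - I * (-(1 / 6) : ℝ) / z) / k) =
      cexp (-(Real.pi / (12 * k) * z⁻¹)) *
        cexp (-(3 * Real.pi * z * (t : ℂ) ^ 2 / k)) := by
    rw [← exp_add]
    congr 1
    push_cast
    field_simp
    linear_combination 36 * I_sq
  have e3 : cexp (-(Real.pi * I * h' / k * (3 * (ν : ℂ) ^ 2 +
      (2 * ((-1 : ℤ) : ℂ) + 1) * (ν : ℂ)))) =
      cexp (Real.pi * I * h' / k * (-3 * (ν : ℂ) ^ 2 + ν)) := by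
    congr 1
    push_cast
    ring
  rw [e1, e2, e3]
  ring

section Mordell

variable {h' : ℤ} {k : ℕ} {z w : ℂ}

/-- The integrand does not involve `h'`, so `h' = 0` serves for the comparison. -/
lemma integrable_mordellIntegrand_neg_one (hk : 0 < k) (hz : 0 < z.re)
    (hw : |realCoord z w| < 1 / (6 * k)) (ν : ℤ) : Integrable (mordellIntegrand (-1) k ν z w) := by
  have hz0 : z ≠ 0 := by rintro rfl; simp at hz
  have h1 := integrable_lineInt (h' := 0) hk hz 0 (-ν) (sixth_line_ne hk hw (-ν))
  simp_rw [poissonTerm_sixth_line hk hz0] at h1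
  rw [integrable_const_mul_iff
    (mul_ne_zero (exp_ne_zero _) (mordellCoeff_ne_zero _ _ _)).isUnit] at h1
  simpa using h1.comp_neg

lemma integrable_mordellIntegrand_one (hk : 0 < k) (hz : 0 < z.re)
    (hw : |realCoord z w| < 1 / (6 * k)) (ν : ℤ) : Integrable (mordellIntegrand 1 k ν z w) := by
  have hz0 : z ≠ 0 := by rintro rfl; simp at hz
  have h1 := integrable_lineInt (h' := 0) hk hz (-1) ν (neg_sixth_line_ne hk hw ν)
  simp_rw [poissonTerm_neg_sixth_line hk hz0] at h1
  rwa [integrable_const_mul_iff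
    (mul_ne_zero (exp_ne_zero _) (mordellCoeff_ne_zero _ _ _)).isUnit] at h1

/-- The first sum runs over `ν = -μ`, a complete residue system again. -/
lemma lineSum_add_lineSum (hk : 0 < k) (hz : 0 < z.re) (hpar : Odd (h' + k)) :
    lineSum h' k z w 0 (1 / 6) + lineSum h' k z w (-1) (-(1 / 6)) =
      cexp (-(Real.pi / (12 * k) * z⁻¹)) * ∑ ν ∈ Finset.range k,
        (-1) ^ ν * cexp (Real.pi * I * h' / k * (-3 * (ν : ℂ) ^ 2 + ν)) *
        (mordellInt 1 k ν z w + mordellInt (-1) k ν z w) := by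
  have hz0 : z ≠ 0 := by rintro rfl; simp at hz
  have h1 := sum_range_comp_affine hk (lineInt_add_period (z := z) (w := w) hk hpar 0 (1 / 6))
    (h := -1) isCoprime_one_left.neg_left 0
  unfold lineSum
  rw [← h1, ← Finset.sum_add_distrib, Finset.mul_sum]
  refine Finset.sum_congr rfl fun ν _ => ?_
  have h2 : lineInt h' k z w 0 (-1 * ν + 0) (1 / 6) =
      cexp (-(Real.pi / (12 * k) * z⁻¹)) * mordellCoeff h' k ν * mordellInt (-1) k ν z w := by
    rw [neg_one_mul, add_zero, lineInt]
    simp_rw [poissonTerm_sixth_line hk hz0]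
    rw [integral_const_mul, integral_neg_eq_self (fun t => mordellIntegrand (-1) k ν z w t), mordellInt]
  have h3 : lineInt h' k z w (-1) ν (-(1 / 6)) =
      cexp (-(Real.pi / (12 * k) * z⁻¹)) * mordellCoeff h' k ν * mordellInt 1 k ν z w := by
    rw [lineInt]
    simp_rw [poissonTerm_neg_sixth_line hk hz0]
    rw [integral_const_mul, mordellInt]
  rw [h2, h3, mordellCoeff, zpow_natCast, Int.cast_natCast]
  ring

end Mordell

/-! ### The transformation law of `calR2` -/

lemma eulerProd_ne_zero {q : ℂ} (hq : ‖q‖ < 1) : eulerProd q ≠ 0 := by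
  have hn : ∀ n : ℕ, ‖q ^ (n + 1)‖ < 1 := fun n => by
    rw [norm_pow]
    exact pow_lt_one₀ (norm_nonneg _) hq n.succ_ne_zero
  have := tprod_one_add_ne_zero_of_summable (f := fun n : ℕ => -q ^ (n + 1)) (fun n e => by
    have h1 := hn n
    rw [show q ^ (n + 1) = 1 by linear_combination -e, norm_one] at h1
    exact lt_irrefl _ h1) (by
    simp only [norm_neg, norm_pow]
    exact (summable_nat_add_iff 1).2 (summable_geometric_of_lt_one (norm_nonneg _) hq))
  simpa only [eulerProd, sub_eq_add_neg] using this

lemma rankTerm_zero (w q : ℂ) : rankTerm w q 0 = 1 / (1 - cexp (2 * Real.pi * I * w)) := by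
  simp [rankTerm]

lemma tsum_rankTerm_eq {w q : ℂ}
    (hS : Summable fun n : {n : ℤ // n ≠ 0} => rankTerm w q n) :
    ∑' n : ℤ, rankTerm w q n = 1 / (1 - cexp (2 * Real.pi * I * w)) +
      ∑' n : {n : ℤ // n ≠ 0}, rankTerm w q n := by
  have h1 : HasSum (fun n : ({0} : Set ℤ) => rankTerm w q n) (rankTerm w q 0) :=
    hasSum_unique _
  have h2 : HasSum (fun n : (({0}ᶜ : Set ℤ)) => rankTerm w q n)
      (∑' n : {n : ℤ // n ≠ 0}, rankTerm w q n) := hS.hasSum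
  rw [(HasSum.add_compl (f := rankTerm w q) h1 h2).tsum_eq, rankTerm_zero]

section Law

variable {h h' : ℤ} {k : ℕ} {z w : ℂ}

lemma abs_realCoord_lt_iff (hz : 0 < z.re) :
    |realCoord z w| < 1 / (6 * k) ↔ |(w * (starRingEnd ℂ) z).re| < z.re / (6 * k) := by
  rw [realCoord, abs_div, abs_of_pos hz, div_lt_iff₀ hz, one_div, div_eq_inv_mul]

lemma rank_denom_ne_zero (hk : 0 < k) (hz : 0 < z.re) (hcop : IsCoprime h (k : ℤ))
    (hw : |realCoord z w| < 1 / (6 * k)) (hline : ∀ m : ℤ, m ≠ 0 → w ≠ m * (I * z)) {n : ℤ}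
    (hn : n ≠ 0) : 1 - cexp (2 * Real.pi * I * w) * nome k h z ^ n ≠ 0 := by
  intro h0
  obtain ⟨m, hm, hw⟩ := exists_eq_of_rank_denom_eq_zero hk hz hcop hw h0
  refine hline (-m) (fun hm0 => hn ?_) hw
  rw [hm, neg_eq_zero.1 hm0, mul_zero]

lemma summable_rankTerm_ne_zero (hk : 0 < k) (hz : 0 < z.re) (hcop : IsCoprime h (k : ℤ))
    (hw : |realCoord z w| < 1 / (6 * k)) (hline : ∀ m : ℤ, m ≠ 0 → w ≠ m * (I * z)) :
    Summable fun n : {n : ℤ // n ≠ 0} => rankTerm w (nome k h z) n :=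
  summable_rankTerm (S := {n | n ≠ 0}) (nome_ne_zero k h z) (norm_nome_lt_one hk h hz)
    fun _ => rank_denom_ne_zero hk hz hcop hw hline

lemma summable_dual_rankTerm_ne_zero (hk : 0 < k) (hz : 0 < z.re)
    (hw : |realCoord z w| < 1 / (6 * k)) :
    Summable fun n : {n : ℤ // n ≠ 0} => rankTerm (I * w / z) (nome k h' z⁻¹) n :=
  summable_rankTerm (S := {n | n ≠ 0}) (nome_ne_zero k h' z⁻¹)
    (norm_nome_lt_one hk h' (inv_re_pos hz)) fun _ => dual_denom_ne_zero hk hz hw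

/-- The transformation law at points where neither side is singular, from `rank_series_transform` by
splitting off the terms `n = 0`. -/
lemma calR2_eq_transRHS (hk : 0 < k) (hz : 0 < z.re) (hcop : IsCoprime h (k : ℤ)) {b : ℤ}
    (hb : h * h' = -1 + k * b) (hbk : Even (b + k)) (hpar : Odd (h' + k))
    (hw : |realCoord z w| < 1 / (6 * k)) (hline : ∀ m : ℤ, w ≠ m * (I * z)) :
    calR2 w (nome k h z) = transRHS h h' k z w := by
  have hz0 : z ≠ 0 := by rintro rfl; simp at hz
  have hkC : (k : ℂ) ≠ 0 := by exact_mod_cast hk.ne'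
  have key := rank_series_transform hk hz hcop hb hbk hpar hw hline
  rw [tsum_rankTerm_eq (summable_rankTerm_ne_zero hk hz hcop hw fun m _ => hline m),
    tsum_rankTerm_eq (summable_dual_rankTerm_ne_zero hk hz hw), lineSum_add_lineSum hk hz hpar,
    cexp_two_pi_I_mul_div] at key
  have hE := eulerProd_nome_transform k hk h h' (by
    rw [hb]; exact (Int.modEq_iff_dvd.2 ⟨-b, by ring⟩)) z hz
  have hE0 := eulerProd_ne_zero (norm_nome_lt_one hk h hz)
  have hE1 := eulerProd_ne_zero (norm_nome_lt_one hk h' (inv_re_pos hz))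
  have hρ : poleResidue k z w * (cexp (2 * Real.pi * w / z))⁻¹ = I * k / z *
      cexp (3 * Real.pi * k * w ^ 2 / z - Real.pi * I * w - Real.pi * w / z) := by
    rw [poleResidue, ← exp_neg, mul_assoc, ← exp_add]
    congr 2
    ring
  have hzpow : z ^ (-(1 / 2) : ℂ) = z ^ (1 / 2 : ℂ) / z := by
    rw [eq_div_iff hz0]
    nth_rw 2 [← cpow_one z]
    rw [← cpow_add _ _ hz0]
    norm_num
  have hexp : cexp (-(Real.pi * z / (12 * k))) =
      cexp (Real.pi / (12 * k) * (z⁻¹ - z)) * cexp (-(Real.pi / (12 * k) * z⁻¹)) := by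
    rw [← exp_add]
    congr 1
    ring
  rw [hρ] at key
  unfold transRHS calR2
  rw [hzpow, hexp, exp_neg (2 * Real.pi * w / z)]
  set E := eulerProd (nome k h z)
  set E1 := eulerProd (nome k h' z⁻¹)
  set S := ∑' n : {n : ℤ // n ≠ 0}, rankTerm w (nome k h z) n
  set S1 := ∑' n : {n : ℤ // n ≠ 0}, rankTerm (I * w / z) (nome k h' z⁻¹) n
  set J := ∑ ν ∈ Finset.range k,
        (-1) ^ ν * cexp (Real.pi * I * h' / k * (-3 * (ν : ℂ) ^ 2 + ν)) *
        (mordellInt 1 k ν z w + mordellInt (-1) k ν z w)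
  set P := 1 / (1 - cexp (2 * Real.pi * I * w))
  set Y := 1 - (cexp (2 * Real.pi * w / z))⁻¹ with hY
  set G := cexp (3 * Real.pi * k * w ^ 2 / z - Real.pi * I * w - Real.pi * w / z)
  set c := cexp (-(Real.pi / (12 * k) * z⁻¹))
  set e := cexp (Real.pi / (12 * k) * (z⁻¹ - z))
  have hM : 1 / E = omegaHK h k * z ^ (1 / 2 : ℂ) * e / E1 := by
    rw [div_eq_div_iff hE0 hE1, hE]; ring
  have hS : S = (E1 * (c * J) + I * k / z * G * (1 / Y + S1)) / k - P := by
    rw [← key]; field_simp; ring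
  rw [hM, hS, mul_comm z Y, ← div_div (I * G) Y z]
  field_simp
  ring

/-- The left-hand side has no term `n = 0`, hence is continuous at `w = 0`; the right-hand side agrees
with it near `0`. -/
theorem tendsto_transRHS (hk : 0 < k) (hz : 0 < z.re) (hcop : IsCoprime h (k : ℤ)) {b : ℤ}
    (hb : h * h' = -1 + k * b) (hbk : Even (b + k)) (hpar : Odd (h' + k)) :
    Tendsto (transRHS h h' k z) (𝓝[≠] 0) (𝓝 (calR2 0 (nome k h z))) := by
  have hz0 : z ≠ 0 := by rintro rfl; simp at hz
  have hkR : (0 : ℝ) < k := by exact_mod_cast hk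
  have h0 : |realCoord z 0| < 1 / (6 * k) := by
    simp only [realCoord, zero_mul, zero_re, zero_div, abs_zero]
    positivity
  have hlim : Tendsto (fun w => calR2 w (nome k h z)) (𝓝 0) (𝓝 (calR2 0 (nome k h z))) :=
    continuousAt_const.mul (continuousAt_tsum_rankTerm (S := {n | n ≠ 0}) (nome_ne_zero k h z)
      (norm_nome_lt_one hk h hz) fun _ => rank_denom_ne_zero hk hz hcop h0 fun m hm =>
        (mul_ne_zero (Int.cast_ne_zero.2 hm) (mul_ne_zero I_ne_zero hz0)).symm)
  refine (hlim.mono_left nhdsWithin_le_nhds).congr' ?_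
  have hstrip : ∀ᶠ w in 𝓝[≠] 0, |realCoord z w| < 1 / (6 * k) :=
    ((continuous_realCoord z).abs.continuousAt.eventually_lt_const h0).filter_mono
      nhdsWithin_le_nhds
  have hball : ∀ᶠ w in 𝓝[≠] (0 : ℂ), ‖w‖ < ‖z‖ :=
    (continuous_norm.continuousAt.eventually_lt_const (by simpa using hz0)).filter_mono
      nhdsWithin_le_nhds
  filter_upwards [hstrip, hball, self_mem_nhdsWithin] with w h1 h2 h3
  refine calR2_eq_transRHS hk hz hcop hb hbk hpar h1 fun m hm => ?_
  rcases eq_or_ne m 0 with rfl | hm0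
  · exact h3 (by simpa using hm)
  · rw [hm, norm_mul, norm_mul, norm_I, one_mul, norm_intCast] at h2
    have h4 : (1 : ℝ) ≤ |(m : ℝ)| := by exact_mod_cast Int.one_le_abs hm0
    nlinarith [norm_pos_iff.2 hz0]

end Law

theorem theorem3p1 (h h' : ℤ) (k : ℕ) (hk : 0 < k) (hhk : IsCoprime h (k : ℤ))
    (hodd : Odd k → Even h' ∧ h * h' ≡ -1 [ZMOD (k : ℤ)])
    (heven : Even k → h * h' ≡ -1 [ZMOD (2 * k : ℤ)])
    (z : ℂ) (hz : 0 < z.re) :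
    -- for real `z` the strip below is `|Re w| < 1/(6k)`; it always contains a neighbourhood of `0`
    (∀ w : ℂ, |(w * (starRingEnd ℂ) z).re| < z.re / (6 * k) →
      (∀ m : ℤ, m ≠ 0 → w ≠ m * (I * z)) →
        Summable (fun n : {n : ℤ // n ≠ 0} => rankTerm w (nome k h z) n) ∧
        Summable (fun n : {n : ℤ // n ≠ 0} => rankTerm (I * w / z) (nome k h' z⁻¹) n) ∧
        (∀ ν : ℤ, Integrable (mordellIntegrand 1 k ν z w) ∧
          Integrable (mordellIntegrand (-1) k ν z w)) ∧
        (w ≠ 0 → calR2 w (nome k h z) = transRHS h h' k z w)) ∧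
    -- the singularity of the right-hand side at `w = 0` is removable, with the right value
    Tendsto (transRHS h h' k z) (𝓝[≠] 0) (𝓝 (calR2 0 (nome k h z))) := by
  -- the conditions on `h'` are needed in two parities: for the multiplier of the rank terms, and for
  -- the `k`-periodicity of the summands in `μ`
  obtain ⟨b, hb, hbk, hpar⟩ : ∃ b : ℤ, h * h' = -1 + k * b ∧ Even (b + k) ∧ Odd (h' + k) := by
    rcases Nat.even_or_odd k with hk2 | hk2
    · obtain ⟨c, hc⟩ := Int.modEq_iff_dvd.1 (heven hk2).symm
      have hk2' : Even (k : ℤ) := by exact_mod_cast hk2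
      have hodd' : Odd (h * h') := by
        rw [show h * h' = 2 * (k * c - 1) + 1 by linear_combination hc]
        exact odd_two_mul_add_one _
      exact ⟨2 * c, by linear_combination hc, (even_two_mul c).add hk2',
        (Int.odd_mul.1 hodd').2.add_even hk2'⟩
    · obtain ⟨heven', hmod⟩ := hodd hk2
      obtain ⟨c, hc⟩ := Int.modEq_iff_dvd.1 hmod.symm
      have hk2' : Odd (k : ℤ) := by exact_mod_cast hk2
      have hodd' : Odd (k * c) := by
        rw [show (k : ℤ) * c = h * h' + 1 by linear_combination -hc]
        exact (heven'.mul_left h).add_one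
      exact ⟨c, by linear_combination hc, (Int.odd_mul.1 hodd').2.add_odd hk2',
        heven'.add_odd hk2'⟩
  refine ⟨fun w hw hline => ?_, tendsto_transRHS hk hz hhk hb hbk hpar⟩
  rw [← abs_realCoord_lt_iff hz] at hw
  refine ⟨summable_rankTerm_ne_zero hk hz hhk hw hline, summable_dual_rankTerm_ne_zero hk hz hw,
    fun ν => ⟨integrable_mordellIntegrand_one hk hz hw ν,
      integrable_mordellIntegrand_neg_one hk hz hw ν⟩,
    fun hw0 => calR2_eq_transRHS hk hz hhk hb hbk hpar hw fun m => ?_⟩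
  rcases eq_or_ne m 0 with rfl | hm
  · simpa using hw0
  · exact hline m hm
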